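/- Let $$\mathcal R(s)=\int_{0\swarrow 1}\frac{x^{-s}e^{\pi i x^2}}{e^{\pi i x}-e^{-\pi i x}}\,dx\qquad(s\in\mathbb C)$$ be Riemann's auxiliary function. Here the path of integration is the straight line of slope $1$ that crosses the real axis at a point between $0$ and $1$ (for instance at $\tfrac12$), run through from the upper right to the lower left, and $x^{-s}$ is the principal branch. Then: 1. $\mathcal R$ is an entire function. 2. The function $F(s)=s\,\pi^{-s/2}\,\Gamma(s/2)\,\mathcal R(s)$ extends to an entire function, and its zeros (the nontrivial zeros of $\mathcal R$), each repeated according to its multiplicity, can be listed as a family $(\rho_n)_{n\in\mathbb Z}$ with $\operatorname{Im}\rho_n>0$ for $n\ge 1$ and $\operatorname{Im}\rho_n\le 0$ for $n\le 0$. 3. There is a constant $a\in\mathbb C$ such that the following two statements hold for every such listing $(\rho_n)_{n\in\mathbb Z}$. First, for all $s\in\mathbb C$, $$\mathcal R(s)=-\frac{e^{as}}{2\,\Gamma(1+\frac s2)}\prod_{n\in\mathbb Z}\Bigl(1-\frac{s}{\rho_n}\Bigr)e^{s/\rho_n},$$ where the product converges unconditionally. Second, for every $s\in\mathbb C$ with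 $\mathcal R(s)\ne0$, $$\frac{\mathcal R'(s)}{\mathcal R(s)}=a-\frac12\,\frac{\Gamma'(1+\frac s2)}{\Gamma(1+\frac s2)}+\sum_{n\in\mathbb Z}\Bigl(\frac1{s-\rho_n}+\frac1{\rho_n}\Bigr),$$ where the series converges absolutely. This constant is $a=-2\mathcal R'(0)-\gamma/2$, where $\gamma$ is Euler's constant. -/

import Mathlib

noncomputable section

open Complex

/-- A parametrization of the path `0 ↙ 1`: the straight line of slope `1` that crosses the real
axis at `1/2`, run through from the upper right to the lower left as `u` goes from `-∞` to `∞`. -/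
def siegelPath (u : ℝ) : ℂ :=
  1 / 2 - exp (Real.pi * I / 4) * u

/-- The auxiliary function of Riemann,
`R(s) = ∫_{0↙1} x^(-s) e^(π i x²) / (e^(π i x) - e^(-π i x)) dx`,
where `x^(-s)` is the principal branch (the path does not meet the half-line `(-∞, 0]`).
The last factor is `dx/du` for `x = siegelPath u`. -/
def riemannR (s : ℂ) : ℂ :=
  ∫ u : ℝ, siegelPath u ^ (-s) * exp (Real.pi * I * siegelPath u ^ 2) /
      (exp (Real.pi * I * siegelPath u) - exp (-(Real.pi * I * siegelPath u))) *
    (-exp (Real.pi * I / 4))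

/-- `F(s) = s π^(-s/2) Γ(s/2) R(s)`. This is an entire function up to removable singularities at
`0, -2, -4, …`, the poles of `Γ(s/2)`, where the formula below takes a junk value. -/
def completedR (s : ℂ) : ℂ :=
  s * (Real.pi : ℂ) ^ (-s / 2) * Gamma (s / 2) * riemannR s

/-- `ρ` lists the zeros of the entire function `F` (the nontrivial zeros of `R`), each one repeated
according to its multiplicity, those in the open upper half-plane at the indices `n ≥ 1`
and the others at the indices `n ≤ 0`. The multiplicity of `z` is `meromorphicOrderAt completedR z`,
which does not depend on the value of `completedR` at `z` itself; it is `0` if `z` is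
not a zero. -/
structure IsZeroEnumeration (ρ : ℤ → ℂ) : Prop where
  finite_fiber : ∀ z : ℂ, {n : ℤ | ρ n = z}.Finite
  card_fiber : ∀ z : ℂ,
    (({n : ℤ | ρ n = z}.ncard : ℤ) : WithTop ℤ) = meromorphicOrderAt completedR z
  im_pos : ∀ n : ℤ, 1 ≤ n → 0 < (ρ n).im
  im_nonpos : ∀ n : ℤ, n ≤ 0 → (ρ n).im ≤ 0

end

open Complex Metric Filter Topology

/-! On lines of slope one the factor `e^(πix²)` decays like a Gaussian, so `R` is entire with `log
|R(s)| ≤ (1/2) max(-Re s, 0) log(2+|s|) + O(1+|s|)`. In particular its order is less than two and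
Hadamard's factorization in genus one applies (`ListsZeros.eq_canonical_product`). Moving the line
across the pole at `0` gives `R(0) = -1/2` and the trivial zeros `-2, -4, …`. The linear coefficient
in Hadamard's formula is `R'(0)/R(0) = -2R'(0)`, and Weierstrass's product turns the trivial zeros
into `e^(-γs/2) / Γ(1+s/2)` (`canonical_negEven`). Together these give the product and the value of
`a`; logarithmic differentiation gives the series.

The harder point is that a listing by `ℤ` exists at all: it needs infinitely many nontrivial zeros
with `Im > 0` and infinitely many with `Im ≤ 0`. Suppose that `R` has no zeros far down. There `log
R` is holomorphic; after rescaling by `m` and division by `m log m` it is bounded on compact sets,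
and it tends to `0` on the part of the half-plane inside a sector about the positive axis, where `R`
is close to `1`. Hence it tends to `0` on compact subsets of the open lower half-plane. Averaging
over a circle about `-m`, part of which lies in this half-plane, improves the exponent of `|R(-m)|`
from `(1/2) m log m` to `(15/32) m log m` (`eventually_norm_neg_nat_le_of_zero_free`).

This is impossible. The series `∑ w^m R(-m)/m!` is the integral of `e^(wx)` against the kernel, and
the improved bound would make its order at most `32/17 < 2`. But the difference of its values at
`2πi(w + 1/2)` and `2πi(w - 1/2)` is a constant times the Gaussian `e^(-πiw²)`, of order exactly two
(`siegelIntegral_exp_sub`, `not_eventually_norm_riemannR_neg_le`). Conjugation settles the upper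
half-plane. -/

/-! ### Local tools for Hadamard factorization -/

/-- A holomorphic zero-free function on a disc has a holomorphic logarithm there. -/
theorem exists_log_ball {E : ℂ → ℂ} {r : ℝ} (hr : 0 < r) (hE : DifferentiableOn ℂ E (ball 0 r))
    (h0 : ∀ z ∈ ball (0 : ℂ) r, E z ≠ 0) :
    ∃ g : ℂ → ℂ, DifferentiableOn ℂ g (ball 0 r) ∧ g 0 = 0 ∧
      ∀ z ∈ ball (0 : ℂ) r, E z = E 0 * exp (g z) := by
  have hd : DifferentiableOn ℂ (fun z => deriv E z / E z) (ball 0 r) :=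
    (hE.deriv isOpen_ball).div hE h0
  obtain ⟨g, hg0, hg⟩ := hd.isExactOn_ball.with_val_at 0 0
  have hgd : DifferentiableOn ℂ g (ball 0 r) := fun z hz =>
    (hg z hz).differentiableAt.differentiableWithinAt
  refine ⟨g, hgd, hg0, fun z hz => ?_⟩
  have hq : ∀ w ∈ ball (0 : ℂ) r, HasDerivAt (fun w => E w * exp (-g w)) 0 w := by
    intro w hw
    have h1 := (hE.differentiableAt (isOpen_ball.mem_nhds hw)).hasDerivAt
    have h2 := (hg w hw).neg.cexp
    refine (h1.mul h2).congr_deriv ?_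
    have h3 : E w * (deriv E w / E w) = deriv E w := mul_div_cancel₀ _ (h0 w hw)
    linear_combination (-exp (-g w)) * h3
  have hc := (convex_ball (0 : ℂ) r).is_const_of_fderivWithin_eq_zero (𝕜 := ℂ)
    (f := fun w => E w * exp (-g w))
    (fun w hw => (hq w hw).differentiableAt.differentiableWithinAt)
    (fun w hw => by
      rw [fderivWithin_of_isOpen isOpen_ball hw]
      ext
      simpa using (hq w hw).deriv) hz (mem_ball_self hr)
  simp only [hg0, neg_zero, exp_zero, mul_one] at hc
  rw [← hc, mul_assoc, ← exp_add]
  simp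

/-- The multiplicity of `1 - s / a` at `z`. -/
theorem analyticOrderAt_one_sub_div {a : ℂ} (ha : a ≠ 0) (z : ℂ) :
    analyticOrderAt (fun s => 1 - s / a) z = if a = z then 1 else 0 := by
  have hA : AnalyticAt ℂ (fun s : ℂ => 1 - s / a) z :=
    (by fun_prop : Differentiable ℂ (fun s : ℂ => 1 - s / a)).analyticAt z
  split_ifs with h
  · subst h
    refine hA.analyticOrderAt_eq_one_of_zero_deriv_ne_zero (by simp [ha]) ?_
    simp [ha]
  · rw [hA.analyticOrderAt_eq_zero]
    intro h0
    apply h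
    field_simp at h0
    linear_combination h0

/-- Dividing finitely many zeros out of an entire function. -/
theorem exists_eq_prod_mul {ι : Type*} {f : ℂ → ℂ} {τ : ι → ℂ} (hf : Differentiable ℂ f)
    (hfin : ∀ z, {i | τ i = z}.Finite)
    (hord : ∀ z, analyticOrderAt f z = ({i | τ i = z}.ncard : ℕ∞)) (hτ : ∀ i, τ i ≠ 0)
    (T : Finset ι) :
    ∃ E : ℂ → ℂ, Differentiable ℂ E ∧ (∀ s, f s = (∏ i ∈ T, (1 - s / τ i)) * E s) ∧
      ∀ z, analyticOrderAt f z = (({i | i ∈ T ∧ τ i = z}.ncard : ℕ) : ℕ∞) + analyticOrderAt E z := by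
  classical
  induction T using Finset.induction_on with
  | empty => exact ⟨f, hf, by simp, by simp⟩
  | insert a T ha ih =>
    obtain ⟨E, hE, hfE, hoE⟩ := ih
    have hsub : ∀ z, {i | i ∈ T ∧ τ i = z} ⊆ {i | τ i = z} := fun z i hi => hi.2
    have hsubf : ∀ z, {i | i ∈ T ∧ τ i = z}.Finite := fun z => (hfin z).subset (hsub z)
    -- Otherwise the indices in `T` would account for the full order of `f` at `τ a`, although `a ∉
    -- T` lies in the same fibre.
    have hE0 : E (τ a) = 0 := by
      apply apply_eq_zero_of_analyticOrderAt_ne_zero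
      intro h0
      have h1 := hoE (τ a)
      rw [h0, add_zero, hord, Nat.cast_inj] at h1
      have h2 : {i | i ∈ T ∧ τ i = τ a} = {i | τ i = τ a} :=
        Set.eq_of_subset_of_ncard_le (hsub _) h1.le (hfin _)
      have h3 : a ∈ {i | i ∈ T ∧ τ i = τ a} := by rw [h2]; rfl
      exact ha h3.1
    -- Since `1 - s/τ = -(s - τ)/τ`, the factor `-τ a` makes the difference quotient the exact
    -- cofactor.
    set D : ℂ → ℂ := fun s => -τ a * dslope E (τ a) s with hD
    have hDd : Differentiable ℂ D := by
      have : DifferentiableOn ℂ (dslope E (τ a)) Set.univ :=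
        (Complex.differentiableOn_dslope Filter.univ_mem).2 hE.differentiableOn
      exact (differentiableOn_univ.1 this).const_mul _
    have hED : ∀ s, E s = (1 - s / τ a) * D s := by
      intro s
      have h := sub_smul_dslope E (τ a) s
      rw [hE0, sub_zero, smul_eq_mul] at h
      rw [hD, ← h]
      have := hτ a
      field_simp
      ring
    refine ⟨D, hDd, fun s => ?_, fun z => ?_⟩
    · rw [hfE, hED, Finset.prod_insert ha]; ring
    · have h1 : analyticOrderAt E z = (if τ a = z then 1 else 0) + analyticOrderAt D z := by
        have : E = (fun s => 1 - s / τ a) * D := funext hED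
        rw [this, analyticOrderAt_mul
          ((by fun_prop : Differentiable ℂ (fun s : ℂ => 1 - s / τ a)).analyticAt z)
          (hDd.analyticAt z), analyticOrderAt_one_sub_div (hτ a)]
      rw [hoE, h1, ← add_assoc]
      congr 1
      split_ifs with h
      · have : {i | i ∈ insert a T ∧ τ i = z} = insert a {i | i ∈ T ∧ τ i = z} := by
          ext i; simp only [Finset.mem_insert, Set.mem_ofPred_eq, Set.mem_insert_iff]
          constructor
          · rintro ⟨h1 | h1, h2⟩ <;> tauto
          · rintro (h1 | h1)
            · subst h1; tauto
            · tauto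
        rw [this, Set.ncard_insert_of_notMem (fun h => ha h.1) (hsubf z)]
        push_cast; rfl
      · rw [add_zero]
        congr 2
        ext i; simp only [Finset.mem_insert, Set.mem_ofPred_eq]
        constructor
        · rintro h1; exact ⟨Or.inr h1.1, h1.2⟩
        · rintro ⟨h1 | h1, h2⟩
          · subst h1; exact absurd h2 h
          · exact ⟨h1, h2⟩

/-- Bound of an entire function after dividing out zeros. -/
theorem norm_le_of_eq_prod_mul {ι : Type*} {f E : ℂ → ℂ} {τ : ι → ℂ} {T : Finset ι} {r M : ℝ}
    (hr : 0 < r) (hτ : ∀ i, τ i ≠ 0) (hE : Differentiable ℂ E)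
    (hfE : ∀ s, f s = (∏ i ∈ T, (1 - s / τ i)) * E s) (hT : ∀ i ∈ T, ‖τ i‖ ≤ r)
    (hM : ∀ s, ‖s‖ ≤ 4 * r → ‖f s‖ ≤ M) :
    ∀ s, ‖s‖ ≤ 4 * r → 3 ^ T.card * ‖E s‖ ≤ M := by
  -- On `|s| = 4r` each factor satisfies `|1 - s/τ| ≥ 4 - 1`; the maximum principle carries the
  -- bound inside.
  have key : ∀ s ∈ sphere (0 : ℂ) (4 * r), ‖E s‖ ≤ M / 3 ^ T.card := by
    intro s hs
    have hs' : ‖s‖ = 4 * r := by simpa using hs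
    have h1 : (3 : ℝ) ^ T.card ≤ ∏ i ∈ T, ‖1 - s / τ i‖ := by
      rw [← Finset.prod_const]
      apply Finset.prod_le_prod (fun _ _ => by norm_num)
      intro i hi
      have hi' := hT i hi
      have hp : 0 < ‖τ i‖ := norm_pos_iff.2 (hτ i)
      have h2 : 4 ≤ ‖s / τ i‖ := by
        rw [norm_div, hs', le_div_iff₀ hp]; linarith
      have h3 := norm_sub_norm_le (s / τ i) 1
      rw [norm_one, norm_sub_rev] at h3
      linarith
    have h2 := hM s hs'.le
    rw [hfE, norm_mul, norm_prod] at h2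
    rw [le_div_iff₀ (by positivity), mul_comm]
    exact (mul_le_mul_of_nonneg_right h1 (norm_nonneg _)).trans h2
  intro s hs
  have h := Complex.norm_le_of_forall_mem_frontier_norm_le (U := ball (0 : ℂ) (4 * r))
    isBounded_ball hE.diffContOnCl (C := M / 3 ^ T.card)
    (fun z hz => key z (by rwa [frontier_ball _ (by positivity)] at hz)) (z := s)
    (by rw [closure_ball _ (by positivity)]; simpa using hs)
  rwa [le_div_iff₀ (by positivity), mul_comm] at h

/-- A holomorphic `g` on a disc of radius `r` with `g 0 = 0` and `Re g ≤ A` is close to its linear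
part near the centre. -/
theorem norm_sub_linear_le {g : ℂ → ℂ} {r A : ℝ} (hr : 0 < r) (hA : 0 < A)
    (hg : DifferentiableOn ℂ g (ball 0 r)) (h0 : g 0 = 0)
    (hre : ∀ z ∈ ball (0 : ℂ) r, (g z).re ≤ A) {s : ℂ} (hs : ‖s‖ < r / 2) :
    ‖g s - deriv g 0 * s‖ ≤ 16 * A * ‖s‖ ^ 2 / r ^ 2 := by
  have hr2 : 0 < r / 2 := by positivity
  have hnear : ∀ z : ℂ, ‖z‖ < r / 2 → ‖g z‖ ≤ 4 * A / r * ‖z‖ := by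
    intro z hz
    have h := borelCaratheodory_zero hA hg (fun z hz => hre z hz) hr
      (by rw [mem_ball_zero_iff]; linarith) h0 (z := z)
    refine h.trans ?_
    rw [div_le_iff₀ (by linarith)]
    have : 4 * A / r * ‖z‖ * (r - ‖z‖) = 2 * A * ‖z‖ * (2 * (r - ‖z‖) / r) := by
      field_simp; ring
    rw [this]
    have h2 : 1 ≤ 2 * (r - ‖z‖) / r := by rw [le_div_iff₀ hr]; linarith
    have h3 : 0 ≤ 2 * A * ‖z‖ := by positivity
    nlinarith
  set d := dslope g 0
  have hdd : DifferentiableOn ℂ d (ball 0 (r / 2)) :=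
    (Complex.differentiableOn_dslope (ball_mem_nhds 0 hr2)).2
      (hg.mono (ball_subset_ball (by linarith)))
  have hgd : ∀ z, z * d z = g z := by
    intro z
    have := sub_smul_dslope g 0 z
    simpa [h0] using this
  have hd0 : d 0 = deriv g 0 := dslope_same g 0
  have hB : ∀ z ∈ ball (0 : ℂ) (r / 2), ‖d z‖ ≤ 4 * A / r := by
    intro z hz
    rw [mem_ball_zero_iff] at hz
    by_cases hz0 : z = 0
    · rw [hz0, hd0]
      have hD := (hg.differentiableAt (ball_mem_nhds 0 hr)).hasDerivAt
      apply hD.le_of_lip' (by positivity)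
      filter_upwards [ball_mem_nhds (0 : ℂ) hr2] with w hw
      rw [mem_ball_zero_iff] at hw
      simpa [h0] using hnear w hw
    · have h := hnear z hz
      rw [← hgd z, norm_mul, mul_comm] at h
      exact le_of_mul_le_mul_right h (norm_pos_iff.2 hz0)
  -- The error is `s (d s - d 0)`, so the Schwarz lemma for `d` supplies the second factor of `s`.
  have hmaps : Set.MapsTo d (ball 0 (r / 2)) (closedBall (d 0) (8 * A / r)) := by
    intro z hz
    rw [mem_closedBall, dist_eq_norm]
    have h1 := hB z hz
    have h2 := hB 0 (mem_ball_self hr2)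
    refine (norm_sub_le _ _).trans ?_
    have : 8 * A / r = 4 * A / r + 4 * A / r := by ring
    linarith
  have h := Complex.dist_le_div_mul_dist_of_mapsTo_ball hdd hmaps (z := s)
    (by rw [mem_ball_zero_iff]; exact hs)
  rw [dist_eq_norm, dist_zero_right] at h
  have e : g s - deriv g 0 * s = s * (d s - d 0) := by
    rw [mul_sub, hgd, hd0]; ring
  rw [e, norm_mul]
  calc ‖s‖ * ‖d s - d 0‖ ≤ ‖s‖ * (8 * A / r / (r / 2) * ‖s‖) := by gcongr
    _ = 16 * A * ‖s‖ ^ 2 / r ^ 2 := by field_simp; ring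

/-- Elementary bound for the factors of a canonical product of genus one. -/
theorem norm_one_sub_mul_exp_sub_one_le {w : ℂ} (hw : ‖w‖ ≤ 1) :
    ‖(1 - w) * exp w - 1‖ ≤ 3 * ‖w‖ ^ 2 := by
  have h1 : ‖exp w - 1 - w‖ ≤ ‖w‖ ^ 2 := Complex.norm_exp_sub_one_sub_id_le hw
  have h2 : ‖exp w - 1‖ ≤ 2 * ‖w‖ := Complex.norm_exp_sub_one_le hw
  have e : (1 - w) * exp w - 1 = (exp w - 1 - w) - w * (exp w - 1) := by ring
  rw [e]
  refine (norm_sub_le _ _).trans ?_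
  rw [norm_mul]
  nlinarith [norm_nonneg w]

/-! ### Canonical products of genus one -/

section CanonicalProduct

variable {ι : Type*} {τ : ι → ℂ}

theorem eventually_le_norm_of_summable (hs : Summable fun i => (‖τ i‖ ^ 2)⁻¹) (hτ : ∀ i, τ i ≠ 0)
    (B : ℝ) : ∀ᶠ i in cofinite, B ≤ ‖τ i‖ := by
  have h := hs.tendsto_cofinite_zero.eventually
    (gt_mem_nhds (show (0 : ℝ) < ((|B| + 1) ^ 2)⁻¹ by positivity))
  filter_upwards [h] with i hi
  have hp : 0 < ‖τ i‖ := norm_pos_iff.2 (hτ i)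
  rw [inv_lt_inv₀ (by positivity) (by positivity)] at hi
  have := lt_of_pow_lt_pow_left₀ 2 (norm_nonneg _) hi
  linarith [le_abs_self B]

/-- All but finitely many `τ i` have norm at least `B`, and for these the factor differs from `1` by
at most `3B²/|τ|²` on the whole disc. -/
theorem multipliableLocallyUniformlyOn_canonical (hs : Summable fun i => (‖τ i‖ ^ 2)⁻¹)
    (hτ : ∀ i, τ i ≠ 0) (B : ℝ) :
    MultipliableLocallyUniformlyOn (fun i s => (1 - s / τ i) * exp (s / τ i)) (ball 0 B) := by
  have h := Summable.multipliableLocallyUniformlyOn_one_add (K := ball (0 : ℂ) B)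
    (f := fun i s => (1 - s / τ i) * exp (s / τ i) - 1) isOpen_ball
    (hs.mul_left (3 * B ^ 2)) ?_ (fun i => by fun_prop)
  · simpa using h
  · filter_upwards [eventually_le_norm_of_summable hs hτ B] with i hi s hsB
    rw [mem_ball_zero_iff] at hsB
    have hp : 0 < ‖τ i‖ := norm_pos_iff.2 (hτ i)
    have h1 : ‖s / τ i‖ ≤ 1 := by
      rw [norm_div, div_le_one hp]; linarith
    refine (norm_one_sub_mul_exp_sub_one_le h1).trans ?_
    rw [norm_div, div_pow, mul_assoc, div_eq_mul_inv]
    gcongr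

theorem multipliable_canonical (hs : Summable fun i => (‖τ i‖ ^ 2)⁻¹) (hτ : ∀ i, τ i ≠ 0) (s : ℂ) :
    Multipliable fun i => (1 - s / τ i) * exp (s / τ i) :=
  (multipliableLocallyUniformlyOn_canonical hs hτ (‖s‖ + 1)).multipliable
    (by rw [mem_ball_zero_iff]; linarith)

theorem summable_partial_fractions (hs : Summable fun i => (‖τ i‖ ^ 2)⁻¹) (hτ : ∀ i, τ i ≠ 0)
    {s : ℂ} (hne : ∀ i, s ≠ τ i) : Summable fun i => 1 / (s - τ i) + 1 / τ i := by
  apply Summable.of_norm_bounded_eventually (hs.mul_left (2 * ‖s‖))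
  filter_upwards [eventually_le_norm_of_summable hs hτ (2 * ‖s‖)] with i hi
  have hp : 0 < ‖τ i‖ := norm_pos_iff.2 (hτ i)
  have h1 : s - τ i ≠ 0 := sub_ne_zero.2 (hne i)
  have h2 := hτ i
  have e : 1 / (s - τ i) + 1 / τ i = s / ((s - τ i) * τ i) := by field_simp; ring
  have h3 : ‖τ i‖ / 2 ≤ ‖s - τ i‖ := by
    have := norm_sub_norm_le (τ i) s
    rw [norm_sub_rev] at this
    linarith
  rw [e, norm_div, norm_mul, ← div_eq_mul_inv, div_le_div_iff₀ (mul_pos (norm_pos_iff.2 h1) hp)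
    (by positivity)]
  have h4 : ‖τ i‖ ^ 2 ≤ 2 * (‖s - τ i‖ * ‖τ i‖) := by nlinarith
  nlinarith [norm_nonneg s]

theorem logDeriv_canonical (hs : Summable fun i => (‖τ i‖ ^ 2)⁻¹) (hτ : ∀ i, τ i ≠ 0)
    {s : ℂ} (hne : ∀ i, s ≠ τ i) (hp : ∏' i, (1 - s / τ i) * exp (s / τ i) ≠ 0) :
    logDeriv (fun s => ∏' i, (1 - s / τ i) * exp (s / τ i)) s =
      ∑' i, (1 / (s - τ i) + 1 / τ i) := by
  have hterm : ∀ i, logDeriv (fun s => (1 - s / τ i) * exp (s / τ i)) s =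
      1 / (s - τ i) + 1 / τ i := by
    intro i
    have h1 : s - τ i ≠ 0 := sub_ne_zero.2 (hne i)
    have h2 := hτ i
    have h3 : HasDerivAt (fun s => (1 - s / τ i) * exp (s / τ i))
        (-(1 / τ i) * exp (s / τ i) + (1 - s / τ i) * (exp (s / τ i) * (1 / τ i))) s := by
      have hd : HasDerivAt (fun s : ℂ => s / τ i) (1 / τ i) s := (hasDerivAt_id s).div_const _
      exact (hd.const_sub 1).mul hd.cexp
    rw [logDeriv_apply, h3.deriv]
    have h4 := exp_ne_zero (s / τ i)
    have h5 : 1 - s / τ i ≠ 0 := by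
      intro h; apply h1; field_simp at h; linear_combination -h
    rw [div_eq_iff (mul_ne_zero h5 h4)]
    have h6 : (1 - s / τ i) * (1 / (s - τ i)) = -(1 / τ i) := by field_simp; ring
    linear_combination (-exp (s / τ i)) * h6
  rw [logDeriv_tprod_eq_tsum (f := fun i s => (1 - s / τ i) * exp (s / τ i)) (s := ball 0 (‖s‖ + 1))
    isOpen_ball (by rw [mem_ball_zero_iff]; linarith) (fun i => ?_) (fun i => by fun_prop) ?_
    (multipliableLocallyUniformlyOn_canonical hs hτ _) hp]
  · simp_rw [hterm]
  · simp_rw [hterm]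
    exact summable_partial_fractions hs hτ hne
  · refine mul_ne_zero ?_ (exp_ne_zero _)
    intro h
    have h2 := hτ i
    apply hne i; field_simp at h; linear_combination -h

theorem differentiable_canonical (hs : Summable fun i => (‖τ i‖ ^ 2)⁻¹) (hτ : ∀ i, τ i ≠ 0) :
    Differentiable ℂ fun s => ∏' i, (1 - s / τ i) * exp (s / τ i) := by
  intro s
  have h := (multipliableLocallyUniformlyOn_canonical hs hτ (‖s‖ + 1)).hasProdLocallyUniformlyOn
  have := TendstoLocallyUniformlyOn.differentiableOn h
    (Eventually.of_forall fun T => by fun_prop) isOpen_ball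
  exact this.differentiableAt (isOpen_ball.mem_nhds (by rw [mem_ball_zero_iff]; linarith))

end CanonicalProduct

/-! ### Counting zeros and the factorization theorem -/

/-- A family listing the zeros of `f` with multiplicity. -/
structure ListsZeros {ι : Type*} (f : ℂ → ℂ) (τ : ι → ℂ) : Prop where
  finite_fiber : ∀ z, {i | τ i = z}.Finite
  card_fiber : ∀ z, analyticOrderAt f z = ({i | τ i = z}.ncard : ℕ∞)

section Hadamard

variable {ι : Type*} {f : ℂ → ℂ} {τ : ι → ℂ}

theorem ListsZeros.apply_eq_zero (h : ListsZeros f τ) (i : ι) : f (τ i) = 0 := by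
  apply apply_eq_zero_of_analyticOrderAt_ne_zero
  rw [h.card_fiber]
  have : {j | τ j = τ i}.ncard ≠ 0 := by
    exact Set.ncard_ne_zero_of_mem (a := i) rfl (h.finite_fiber _)
  exact_mod_cast this

theorem ListsZeros.ne_zero (h : ListsZeros f τ) (h0 : f 0 ≠ 0) (i : ι) : τ i ≠ 0 := by
  intro hi
  exact h0 (hi ▸ h.apply_eq_zero i)

/-- Bound for the number of zeros in a disc. -/
theorem ListsZeros.card_le (h : ListsZeros f τ) (hf : Differentiable ℂ f) (h0 : f 0 ≠ 0)
    {r A : ℝ} (hr : 0 < r) (hA : ∀ s, ‖s‖ ≤ 4 * r → ‖f s‖ ≤ Real.exp A) (T : Finset ι)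
    (hT : ∀ i ∈ T, ‖τ i‖ ≤ r) : (T.card : ℝ) ≤ A - Real.log ‖f 0‖ := by
  obtain ⟨E, hE, hfE, -⟩ := exists_eq_prod_mul hf h.finite_fiber h.card_fiber (h.ne_zero h0) T
  -- A form of Jensen's inequality: at the centre `E 0 = f 0`, so `3 ^ card * |f 0| ≤ e^A`, and `log
  -- 3 ≥ 1`.
  have h1 := norm_le_of_eq_prod_mul hr (h.ne_zero h0) hE hfE hT hA 0 (by rw [norm_zero]; positivity)
  have h2 : E 0 = f 0 := by rw [hfE]; simp
  rw [h2] at h1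
  have hp : 0 < ‖f 0‖ := norm_pos_iff.2 h0
  have h3 := Real.log_le_log (by positivity) h1
  rw [Real.log_exp, Real.log_mul (by positivity) hp.ne', Real.log_pow] at h3
  have h4 : 1 ≤ Real.log 3 := by
    rw [Real.le_log_iff_exp_le (by norm_num)]
    linarith [Real.exp_one_lt_d9]
  have h5 : (T.card : ℝ) * 1 ≤ T.card * Real.log 3 := mul_le_mul_of_nonneg_left h4 (Nat.cast_nonneg _)
  linarith

theorem ListsZeros.finite_le (h : ListsZeros f τ) (hf : Differentiable ℂ f) (h0 : f 0 ≠ 0)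
    {r A : ℝ} (hr : 0 < r) (hA : ∀ s, ‖s‖ ≤ 4 * r → ‖f s‖ ≤ Real.exp A) :
    {i | ‖τ i‖ ≤ r}.Finite := by
  by_contra hinf
  obtain ⟨T, hT, hc⟩ := Set.Infinite.exists_subset_card_eq hinf (⌈A - Real.log ‖f 0‖⌉₊ + 1)
  have h1 := h.card_le hf h0 hr hA T (fun i hi => hT hi)
  have h2 := Nat.le_ceil (A - Real.log ‖f 0‖)
  rw [hc] at h1
  push_cast at h1
  linarith

/-- The inverse squares of the zeros are summable if the function has order less than two. -/
theorem ListsZeros.summable (h : ListsZeros f τ) (hf : Differentiable ℂ f) (h0 : f 0 ≠ 0)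
    {C : ℝ} (hC : ∀ (k : ℕ) (s : ℂ), ‖s‖ ≤ 4 ^ k → ‖f s‖ ≤ Real.exp (C * 8 ^ k)) :
    Summable fun i => (‖τ i‖ ^ 2)⁻¹ := by
  classical
  have hτ := h.ne_zero h0
  set D : ℝ := 8 * |C| + |Real.log ‖f 0‖| with hD
  have hD0 : 0 ≤ D := by positivity
  have hcount : ∀ (k : ℕ) (T : Finset ι), (∀ i ∈ T, ‖τ i‖ ≤ 4 ^ k) → (T.card : ℝ) ≤ D * 8 ^ k := by
    intro k T hT
    have h1 := h.card_le hf h0 (r := 4 ^ k) (A := C * 8 ^ (k + 1)) (by positivity)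
      (fun s hs => hC (k + 1) s (by rw [pow_succ]; linarith)) T hT
    have h2 : (1 : ℝ) ≤ 8 ^ k := one_le_pow₀ (by norm_num)
    have h3 : C * 8 ^ (k + 1) ≤ 8 * |C| * 8 ^ k := by
      rw [pow_succ]; nlinarith [le_abs_self C]
    have h4 : |Real.log ‖f 0‖| ≤ |Real.log ‖f 0‖| * 8 ^ k :=
      le_mul_of_one_le_right (abs_nonneg _) h2
    have h5 := neg_abs_le (Real.log ‖f 0‖)
    rw [hD, add_mul]
    linarith
  have hfin1 : {i | ‖τ i‖ ≤ 1}.Finite :=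
    h.finite_le hf h0 one_pos (A := C * 8 ^ 1) (fun s hs => hC 1 s (by linarith))
  rw [← hfin1.summable_compl_iff]
  have hex : ∀ i, ∃ k : ℕ, ‖τ i‖ ≤ 4 ^ k := fun i =>
    (pow_unbounded_of_one_lt ‖τ i‖ (by norm_num : (1 : ℝ) < 4)).imp fun _ h => h.le
  -- Shells in powers of `4`: shell `k` has at most `D * 8^k` zeros, each contributing at most `16 /
  -- 16^k`, so the shells are dominated by a geometric series of ratio `1/2`.
  let κ : ι → ℕ := fun i => Nat.find (hex i)
  have hκ : ∀ i, ‖τ i‖ ≤ 4 ^ κ i := fun i => Nat.find_spec (hex i)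
  have hterm : ∀ i, ¬ ‖τ i‖ ≤ 1 → (‖τ i‖ ^ 2)⁻¹ ≤ 16 * (16 ^ κ i)⁻¹ := by
    intro i hi
    have hk0 : κ i ≠ 0 := by
      intro h0
      apply hi
      simpa [h0] using hκ i
    obtain ⟨m, hm⟩ := Nat.exists_eq_succ_of_ne_zero hk0
    have h1 : ¬ ‖τ i‖ ≤ 4 ^ m := Nat.find_min (hex i) (by change m < κ i; omega)
    push Not at h1
    have h2 : (16 : ℝ) ^ m ≤ ‖τ i‖ ^ 2 := by
      have : (16 : ℝ) ^ m = (4 ^ m) ^ 2 := by rw [← pow_mul, mul_comm, pow_mul]; norm_num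
      rw [this]
      gcongr
    rw [hm, pow_succ (16 : ℝ), mul_inv]
    have h3 : (‖τ i‖ ^ 2)⁻¹ ≤ (16 ^ m : ℝ)⁻¹ := inv_anti₀ (by positivity) h2
    linarith
  have hgeo : Summable fun k : ℕ => 16 * D * (1 / 2 : ℝ) ^ k :=
    (summable_geometric_of_lt_one (by norm_num) (by norm_num)).mul_left _
  refine summable_of_sum_le (c := ∑' k : ℕ, 16 * D * (1 / 2 : ℝ) ^ k) (fun i => by simp only [Function.comp]; positivity) ?_
  intro u
  set v : Finset ι := u.map (Function.Embedding.subtype _) with hv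
  have hv' : ∀ i ∈ v, ¬ ‖τ i‖ ≤ 1 := by
    intro i hi
    rw [hv, Finset.mem_map] at hi
    obtain ⟨j, -, rfl⟩ := hi
    exact j.2
  have e1 : ∑ i ∈ u, ((fun i => (‖τ i‖ ^ 2)⁻¹) ∘ Subtype.val) i = ∑ i ∈ v, (‖τ i‖ ^ 2)⁻¹ := by
    rw [hv, Finset.sum_map]; rfl
  refine e1.le.trans ?_
  calc ∑ i ∈ v, (‖τ i‖ ^ 2)⁻¹ ≤ ∑ i ∈ v, 16 * ((16 : ℝ) ^ κ i)⁻¹ :=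
        Finset.sum_le_sum fun i hi => hterm i (hv' i hi)
    _ = ∑ k ∈ v.image κ, ∑ i ∈ v with κ i = k, 16 * ((16 : ℝ) ^ κ i)⁻¹ :=
        (Finset.sum_fiberwise_of_maps_to (fun i hi => Finset.mem_image_of_mem κ hi) _).symm
    _ ≤ ∑ k ∈ v.image κ, 16 * D * (1 / 2 : ℝ) ^ k := by
        apply Finset.sum_le_sum
        intro k _
        have h1 : ∑ i ∈ v with κ i = k, 16 * ((16 : ℝ) ^ κ i)⁻¹ =
            ((v.filter fun i => κ i = k).card : ℝ) * (16 * ((16 : ℝ) ^ k)⁻¹) := by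
          rw [← nsmul_eq_mul, ← Finset.sum_const]
          refine Finset.sum_congr rfl fun i hi => ?_
          rw [(Finset.mem_filter.1 hi).2]
        rw [h1]
        have h2 := hcount k (v.filter fun i => κ i = k) (fun i hi => by
          have := hκ i
          rwa [(Finset.mem_filter.1 hi).2] at this)
        calc _ ≤ D * 8 ^ k * (16 * ((16 : ℝ) ^ k)⁻¹) := by gcongr
          _ = 16 * D * (1 / 2 : ℝ) ^ k := by
            have : (1 / 2 : ℝ) ^ k = 8 ^ k * (16 ^ k)⁻¹ := by
              rw [← inv_pow, ← mul_pow]; norm_num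
            rw [this]; ring
    _ ≤ ∑' k : ℕ, 16 * D * (1 / 2 : ℝ) ^ k :=
        hgeo.sum_le_tsum _ (fun k _ => by positivity)

/-- **Hadamard factorization** for entire functions of order less than two. -/
theorem ListsZeros.eq_canonical_product (h : ListsZeros f τ) (hf : Differentiable ℂ f)
    (h0 : f 0 ≠ 0) {C : ℝ}
    (hC : ∀ (k : ℕ) (s : ℂ), ‖s‖ ≤ 4 ^ k → ‖f s‖ ≤ Real.exp (C * 8 ^ k)) (s : ℂ) :
    f s = f 0 * exp (deriv f 0 / f 0 * s) * ∏' i, (1 - s / τ i) * exp (s / τ i) := by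
  classical
  have hτ := h.ne_zero h0
  have hfin : ∀ k : ℕ, {i | ‖τ i‖ ≤ 4 ^ k}.Finite := fun k =>
    h.finite_le hf h0 (r := 4 ^ k) (A := C * 8 ^ (k + 1)) (by positivity)
      (fun s hs => hC (k + 1) s (by rw [pow_succ]; linarith))
  let T : ℕ → Finset ι := fun k => (hfin k).toFinset
  have hTmem : ∀ k i, i ∈ T k ↔ ‖τ i‖ ≤ 4 ^ k := fun k i => by simp [T]
  have hT : Tendsto T atTop atTop := by
    apply tendsto_atTop_finset_of_monotone
    · intro k l hkl i hi
      rw [hTmem] at hi ⊢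
      exact hi.trans (pow_le_pow_right₀ (by norm_num) hkl)
    · intro i
      obtain ⟨k, hk⟩ := pow_unbounded_of_one_lt ‖τ i‖ (by norm_num : (1 : ℝ) < 4)
      exact ⟨k, (hTmem k i).2 hk.le⟩
  set A : ℕ → ℝ := fun k => |C| * 8 ^ (k + 1) + |Real.log ‖f 0‖| + 1 with hA
  -- The cofactor of the zeros in the disc of radius `4^k` is zero-free there, and the real part of
  -- its normalized logarithm is at most `A k = O(8^k)`. The deviation of this logarithm from its
  -- linear part is therefore `O(8^k |s|²/16^k)`, which vanishes in the limit.
  have main : ∀ k : ℕ, ‖s‖ < 4 ^ k / 2 → ∃ e : ℂ, ‖e‖ ≤ 16 * A k * ‖s‖ ^ 2 / (4 ^ k) ^ 2 ∧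
      f s = f 0 * exp (deriv f 0 / f 0 * s) * (∏ i ∈ T k, (1 - s / τ i) * exp (s / τ i)) *
        exp e := by
    intro k hk
    have hr : (0 : ℝ) < 4 ^ k := by positivity
    obtain ⟨E, hE, hfE, hoE⟩ := exists_eq_prod_mul hf h.finite_fiber h.card_fiber hτ (T k)
    have hE0 : E 0 = f 0 := by rw [hfE]; simp
    have hEne : ∀ z ∈ ball (0 : ℂ) (4 ^ k), E z ≠ 0 := by
      intro z hz
      rw [mem_ball_zero_iff] at hz
      have h1 := hoE z
      have h2 : {i | i ∈ T k ∧ τ i = z} = {i | τ i = z} := by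
        ext i
        simp only [Set.mem_ofPred_eq, and_iff_right_iff_imp]
        intro hi
        rw [hTmem, hi]; exact hz.le
      rw [h2, h.card_fiber] at h1
      have h3 : analyticOrderAt E z = 0 := by
        have : (({i | τ i = z}.ncard : ℕ) : ℕ∞) + 0 = ({i | τ i = z}.ncard : ℕ) +
          analyticOrderAt E z := by rw [add_zero]; exact h1
        exact (WithTop.add_left_cancel (ENat.natCast_ne_top _) this).symm
      rwa [(hE.analyticAt z).analyticOrderAt_eq_zero] at h3
    have hEle : ∀ z, ‖z‖ ≤ 4 * 4 ^ k → ‖E z‖ ≤ Real.exp (C * 8 ^ (k + 1)) := by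
      intro z hz
      have h1 := norm_le_of_eq_prod_mul hr hτ hE hfE (fun i hi => (hTmem k i).1 hi)
        (fun s hs => hC (k + 1) s (by rw [pow_succ]; linarith)) z hz
      have h2 : (1 : ℝ) ≤ 3 ^ (T k).card := one_le_pow₀ (by norm_num)
      exact (le_mul_of_one_le_left (norm_nonneg _) h2).trans h1
    obtain ⟨g, hg, hg0, hEg⟩ := exists_log_ball hr hE.differentiableOn hEne
    have hA0 : 0 < A k := by positivity
    have hp : 0 < ‖f 0‖ := norm_pos_iff.2 h0
    have hre : ∀ z ∈ ball (0 : ℂ) (4 ^ k), (g z).re ≤ A k := by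
      intro z hz
      have h1 := hEg z hz
      rw [mem_ball_zero_iff] at hz
      have h2 := hEle z (by linarith)
      rw [h1, hE0, norm_mul, Complex.norm_exp] at h2
      have h3 := Real.log_le_log (by positivity) h2
      rw [Real.log_mul hp.ne' (Real.exp_ne_zero _), Real.log_exp, Real.log_exp] at h3
      have h4 := neg_abs_le (Real.log ‖f 0‖)
      have h5 : C * 8 ^ (k + 1) ≤ |C| * 8 ^ (k + 1) := by
        gcongr; exact le_abs_self C
      simp only [hA]
      linarith
    have herr := norm_sub_linear_le hr hA0 hg hg0 hre hk
    refine ⟨g s - deriv g 0 * s, herr, ?_⟩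
    -- The missing sum `∑ 1/τ` is exactly what the convergence factors `exp (s/τ)` contribute, so
    -- the linear coefficient does not depend on `k`.
    have hlog : deriv f 0 / f 0 = deriv g 0 - ∑ i ∈ T k, 1 / τ i := by
      have h1 : deriv E 0 = f 0 * deriv g 0 := by
        have hEe : E =ᶠ[𝓝 0] fun z => E 0 * exp (g z) := by
          filter_upwards [ball_mem_nhds (0 : ℂ) hr] with z hz using hEg z hz
        rw [hEe.deriv_eq]
        have := ((hg.differentiableAt (ball_mem_nhds 0 hr)).hasDerivAt.cexp).const_mul (E 0)
        rw [this.deriv, hg0, exp_zero, hE0, one_mul]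
      have h2 : HasDerivAt (fun s => ∏ i ∈ T k, (1 - s / τ i)) (-∑ i ∈ T k, 1 / τ i) 0 := by
        have := HasDerivAt.fun_finsetProd (u := T k) (x := (0 : ℂ)) (f := fun i s => 1 - s / τ i)
          (f' := fun i => -(1 / τ i)) (fun i _ => ((hasDerivAt_id (0 : ℂ)).div_const _).const_sub 1)
        simpa using this
      have h3 := (h2.mul (hE 0).hasDerivAt)
      have h4 : f = (fun s => ∏ i ∈ T k, (1 - s / τ i)) * E := funext hfE
      have h5 : deriv f 0 = (-∑ i ∈ T k, 1 / τ i) * f 0 + f 0 * deriv g 0 := by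
        rw [h4, h3.deriv, h1, hE0]
        simp [hE0]
      rw [h5]
      field_simp
      ring
    rw [hfE, hEg s (by rw [mem_ball_zero_iff]; linarith), hE0, Finset.prod_mul_distrib,
      ← exp_sum, hlog]
    have h1 : exp (g s) = exp ((deriv g 0 - ∑ i ∈ T k, 1 / τ i) * s) * exp (∑ i ∈ T k, s / τ i) *
        exp (g s - deriv g 0 * s) := by
      rw [← exp_add, ← exp_add]
      congr 1
      have : ∑ i ∈ T k, s / τ i = (∑ i ∈ T k, 1 / τ i) * s := by
        rw [Finset.sum_mul]
        exact Finset.sum_congr rfl fun i _ => by ring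
      rw [this]; ring
    rw [h1]
    ring
  have hlim : Tendsto (fun k : ℕ => 16 * A k * ‖s‖ ^ 2 / (4 ^ k) ^ 2) atTop (𝓝 0) := by
    have hh : Tendsto (fun k : ℕ => (1 / 2 : ℝ) ^ k) atTop (𝓝 0) :=
      tendsto_pow_atTop_nhds_zero_of_lt_one (by norm_num) (by norm_num)
    have hs : Tendsto (fun k : ℕ => (1 / 16 : ℝ) ^ k) atTop (𝓝 0) :=
      tendsto_pow_atTop_nhds_zero_of_lt_one (by norm_num) (by norm_num)
    have := (hh.const_mul (16 * 8 * |C| * ‖s‖ ^ 2)).add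
      (hs.const_mul (16 * ‖s‖ ^ 2 * (|Real.log ‖f 0‖| + 1)))
    rw [mul_zero, mul_zero, add_zero] at this
    refine this.congr fun k => ?_
    have e1 : ((4 : ℝ) ^ k) ^ 2 = 16 ^ k := by rw [← pow_mul, mul_comm, pow_mul]; norm_num
    have e2 : (1 / 2 : ℝ) ^ k = 8 ^ k / 16 ^ k := by rw [← div_pow]; norm_num
    have e3 : (1 / 16 : ℝ) ^ k = 1 / 16 ^ k := by rw [div_pow, one_pow]
    rw [e1, e2, e3, hA]
    field_simp
    ring
  have hev : ∀ᶠ k : ℕ in atTop, ‖s‖ < 4 ^ k / 2 := by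
    have := (tendsto_pow_atTop_atTop_of_one_lt (by norm_num : (1 : ℝ) < 4)).eventually_gt_atTop
      (2 * ‖s‖)
    filter_upwards [this] with k hk
    linarith
  choose! e he hfe using main
  have he0 : Tendsto e atTop (𝓝 0) :=
    squeeze_zero_norm' (hev.mono fun k hk => he k hk) hlim
  have hprod := ((multipliable_canonical (h.summable hf h0 hC) hτ s).hasProd.comp hT)
  have h1 := (hprod.const_mul (f 0 * exp (deriv f 0 / f 0 * s))).mul
    ((continuous_exp.tendsto 0).comp he0)
  rw [exp_zero, mul_one] at h1
  refine tendsto_nhds_unique (tendsto_const_nhds.congr' ?_) h1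
  filter_upwards [hev] with k hk
  exact hfe k hk

end Hadamard

/-! ### Smallness in a zero-free half-plane -/

/-- Quantitative propagation of smallness on concentric discs. -/
theorem exists_tendsto_zero_bound {ρ₀ ρ ρ₁ r M : ℝ} (h₀ : 0 < ρ₀) (h₀r : ρ₀ < r) (hρ : 0 ≤ ρ)
    (hρ₁ : ρ < ρ₁) (h₁r : ρ₁ < r) :
    ∃ B : ℝ → ℝ, Tendsto B (𝓝 0) (𝓝 0) ∧ ∀ (δ : ℝ) (h : ℂ → ℂ), DifferentiableOn ℂ h (ball 0 r) →
      (∀ z ∈ sphere (0 : ℂ) ρ₁, ‖h z‖ ≤ M) → (∀ z ∈ sphere (0 : ℂ) ρ₀, ‖h z‖ ≤ δ) →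
      ∀ z : ℂ, ‖z‖ ≤ ρ → ‖h z‖ ≤ B δ := by
  have hρ₁0 : 0 < ρ₁ := hρ.trans_lt hρ₁
  -- `F δ n` is the better of the Cauchy estimates for the `n`-th Taylor term on the two circles.
  -- The first choice is summable because `ρ < ρ₁`; the second tends to `0` with `δ` for fixed `n`,
  -- so dominated convergence applies.
  set F : ℝ → ℕ → ℝ := fun δ n => min (|M| * (ρ / ρ₁) ^ n) (|δ| * (ρ / ρ₀) ^ n) with hF
  have hF0 : ∀ δ n, 0 ≤ F δ n := fun δ n => le_min (by positivity) (by positivity)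
  have hsum : Summable fun n : ℕ => |M| * (ρ / ρ₁) ^ n :=
    (summable_geometric_of_lt_one (by positivity) ((div_lt_one hρ₁0).2 hρ₁)).mul_left _
  have hsF : ∀ δ, Summable (F δ) := fun δ =>
    hsum.of_nonneg_of_le (hF0 δ) (fun n => min_le_left _ _)
  refine ⟨fun δ => ∑' n, F δ n, ?_, ?_⟩
  · have : (0 : ℝ) = ∑' n : ℕ, (0 : ℝ) := by simp
    rw [this]
    conv => enter [2]; rw [← this]
    refine tendsto_tsum_of_dominated_convergence hsum (fun n => ?_)
      (Eventually.of_forall fun δ n => ?_)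
    · have hc : Continuous fun δ : ℝ => F δ n := by
        simp only [hF]; fun_prop
      have h := hc.tendsto 0
      have e : F 0 n = 0 := by
        simp only [hF, abs_zero, zero_mul]
        exact min_eq_right (by positivity)
      rwa [e] at h
    · rw [Real.norm_of_nonneg (hF0 δ n)]
      exact min_le_left _ _
  · intro δ h hd hM hδ z hz
    have hT := Complex.hasSum_taylorSeries_on_ball hd (z := z)
      (by rw [mem_ball_zero_iff]; linarith)
    have hcoef : ∀ (n : ℕ) (R A : ℝ), 0 < R → R < r → (∀ z ∈ sphere (0 : ℂ) R, ‖h z‖ ≤ A) →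
        ‖(n.factorial : ℂ)⁻¹ • (z - 0) ^ n • iteratedDeriv n h 0‖ ≤ |A| * (ρ / R) ^ n := by
      intro n R A hR hRr hA
      have hcl : DiffContOnCl ℂ h (ball 0 R) :=
        (hd.mono (closedBall_subset_ball hRr)).diffContOnCl_ball subset_rfl
      have h1 := Complex.norm_iteratedDeriv_le_of_forall_mem_sphere_norm_le n hR hcl
        (C := |A|) (fun z hz => (hA z hz).trans (le_abs_self A))
      rw [norm_smul, norm_smul, sub_zero, norm_pow, norm_inv, Complex.norm_natCast]
      have hfp : (0 : ℝ) < n.factorial := by exact_mod_cast n.factorial_pos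
      calc ((n.factorial : ℝ))⁻¹ * (‖z‖ ^ n * ‖iteratedDeriv n h 0‖)
          ≤ ((n.factorial : ℝ))⁻¹ * (ρ ^ n * (n.factorial * |A| / R ^ n)) := by gcongr
        _ = |A| * (ρ / R) ^ n := by rw [div_pow]; field_simp
    have hb : ∀ n : ℕ, ‖(n.factorial : ℂ)⁻¹ • (z - 0) ^ n • iteratedDeriv n h 0‖ ≤ F δ n :=
      fun n => le_min (hcoef n ρ₁ M hρ₁0 h₁r hM) (hcoef n ρ₀ δ h₀ h₀r hδ)
    rw [← hT.tsum_eq]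
    exact tsum_of_norm_bounded (hsF δ).hasSum hb

/-- A conformal map of the unit disc onto the lower half-plane with `0 ↦ X - i`. -/
noncomputable def lowerCayley (X : ℝ) (z : ℂ) : ℂ := X - I * ((1 + z) / (1 - z))

theorem one_sub_ne_zero_of_mem_ball {z : ℂ} (hz : ‖z‖ < 1) : 1 - z ≠ 0 := by
  intro h
  have : z = 1 := by linear_combination -h
  rw [this, norm_one] at hz
  exact lt_irrefl _ hz

theorem lowerCayley_im_neg (X : ℝ) {z : ℂ} (hz : ‖z‖ < 1) : (lowerCayley X z).im < 0 := by
  have h1 := one_sub_ne_zero_of_mem_ball hz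
  have h2 : 0 < normSq (1 - z) := normSq_pos.2 h1
  have h3 : normSq z < 1 := by
    rw [normSq_eq_norm_sq]; nlinarith [norm_nonneg z]
  have h4 : (lowerCayley X z).im = -((1 - normSq z) / normSq (1 - z)) := by
    simp only [lowerCayley, sub_im, ofReal_im, mul_im, I_re, I_im, div_re, div_im, add_re, add_im,
      one_re, one_im, sub_re, normSq_apply]
    ring
  rw [h4]
  have : 0 < (1 - normSq z) / normSq (1 - z) := div_pos (by linarith) h2
  linarith

theorem norm_lowerCayley_le {X ρ : ℝ} (hX : 0 ≤ X) (hρ : ρ < 1) {z : ℂ} (hz : ‖z‖ ≤ ρ) :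
    ‖lowerCayley X z‖ ≤ X + 2 / (1 - ρ) := by
  unfold lowerCayley
  refine (norm_sub_le _ _).trans ?_
  rw [norm_real, Real.norm_of_nonneg hX, norm_mul, norm_I, one_mul, norm_div]
  have h1 : ‖1 + z‖ ≤ 2 := (norm_add_le _ _).trans (by rw [norm_one]; linarith)
  have h2 : 1 - ρ ≤ ‖1 - z‖ := by
    have := norm_sub_norm_le 1 z
    rw [norm_one] at this; linarith
  gcongr

theorem differentiableOn_lowerCayley (X : ℝ) : DifferentiableOn ℂ (lowerCayley X) (ball 0 1) := by
  unfold lowerCayley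
  refine (DifferentiableOn.const_sub ?_ _)
  refine DifferentiableOn.const_mul ?_ _
  exact DifferentiableOn.div (by fun_prop) (by fun_prop)
    (fun z hz => one_sub_ne_zero_of_mem_ball (by simpa using hz))

/-- Locates a fixed disc of parameters whose dilated images lie in the sector about the positive
axis, where `f` is controlled. -/
theorem norm_lowerCayley_sub_le (X : ℝ) {z : ℂ} (hz : ‖z‖ ≤ 1 / 5) :
    ‖lowerCayley X z - (X - I)‖ ≤ 1 / 2 := by
  have h1 := one_sub_ne_zero_of_mem_ball (z := z) (by linarith)
  have e : lowerCayley X z - (X - I) = -(I * (2 * z / (1 - z))) := by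
    unfold lowerCayley; field_simp; ring
  have h2 : 4 / 5 ≤ ‖1 - z‖ := by
    have := norm_sub_norm_le 1 z
    rw [norm_one] at this; linarith
  rw [e, norm_neg, norm_mul, norm_I, one_mul, norm_div, norm_mul, div_le_iff₀ (by linarith)]
  simp only [norm_ofNat]
  linarith

/-- The compact part `Im p ≤ -1/4`, `‖p‖ ≤ 2` of the lower half-plane is in the image of a smaller
disc. -/
theorem exists_lowerCayley_eq {X : ℝ} (hX : 0 ≤ X) :
    ∃ ρ : ℝ, 0 ≤ ρ ∧ ρ < 1 ∧ ∀ p : ℂ, p.im ≤ -1 / 4 → ‖p‖ ≤ 2 →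
      ∃ z : ℂ, ‖z‖ ≤ ρ ∧ lowerCayley X z = p := by
  have hlt : 1 - 1 / (X + 3) ^ 2 < 1 := by
    have : 0 < 1 / (X + 3) ^ 2 := by positivity
    linarith
  -- With `w = I (p - X)`, `|(w-1)/(w+1)|² = 1 - 4 Re w / |w+1|²`, where `4 Re w = -4 Im p ≥ 1` and
  -- `|w+1| ≤ X + 3`.
  refine ⟨Real.sqrt (1 - 1 / (X + 3) ^ 2), Real.sqrt_nonneg _, ?_, fun p hp hp2 => ?_⟩
  · rw [Real.sqrt_lt' one_pos]; simpa using hlt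
  · set w : ℂ := I * (p - X) with hw
    have hwre : w.re = -p.im := by simp [hw]
    have hw1 : w + 1 ≠ 0 := by
      intro h
      have := congrArg re h
      simp only [add_re, one_re, zero_re, hwre] at this
      linarith
    refine ⟨(w - 1) / (w + 1), ?_, ?_⟩
    · apply Real.le_sqrt_of_sq_le
      have hn : ‖w + 1‖ ≤ X + 3 := by
        refine (norm_add_le _ _).trans ?_
        rw [hw, norm_mul, norm_I, one_mul, norm_one]
        have := norm_sub_le p (X : ℂ)
        rw [norm_real, Real.norm_of_nonneg hX] at this
        linarith
      have hpos : 0 < ‖w + 1‖ := norm_pos_iff.2 hw1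
      have e : ‖w - 1‖ ^ 2 = ‖w + 1‖ ^ 2 - 4 * w.re := by
        rw [← normSq_eq_norm_sq, ← normSq_eq_norm_sq, normSq_apply, normSq_apply]
        simp only [sub_re, add_re, one_re, sub_im, add_im, one_im]
        ring
      rw [norm_div, div_pow, e, sub_div, div_self (by positivity)]
      have h1 : 1 / (X + 3) ^ 2 ≤ 4 * w.re / ‖w + 1‖ ^ 2 := by
        have : (1 : ℝ) ≤ 4 * w.re := by rw [hwre]; linarith
        gcongr
      linarith
    · unfold lowerCayley
      have e : (1 + (w - 1) / (w + 1)) / (1 - (w - 1) / (w + 1)) = w := by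
        have : 1 - (w - 1) / (w + 1) ≠ 0 := by
          have : 1 - (w - 1) / (w + 1) = 2 / (w + 1) := by field_simp; ring
          rw [this]
          exact div_ne_zero two_ne_zero hw1
        field_simp
        ring
      rw [e, hw]
      linear_combination (X - p) * I_mul_I

/-- Shows that the growth exponent on a set of diameter `O(m)` about the origin is `O(m log m)`,
with a constant independent of `m`. -/
theorem mul_log_two_add_le {Q L C m x : ℝ} (hQ : 0 ≤ Q) (hC : 0 ≤ C) (hm : 1 ≤ m)
    (hL : Real.log m = L) (hL1 : 1 ≤ L) (hx0 : 0 ≤ x) (hx : x ≤ Q * m) :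
    x / 2 * Real.log (2 + x) + C * (1 + x) ≤
      (Q / 2 * (1 + Real.log (2 + Q)) + C * (1 + Q)) * (m * L) := by
  have h1 : Real.log (2 + x) ≤ (1 + Real.log (2 + Q)) * L := by
    have h2 : Real.log (2 + x) ≤ Real.log ((2 + Q) * m) :=
      Real.log_le_log (by linarith) (by nlinarith)
    rw [Real.log_mul (by positivity) (by positivity), hL] at h2
    have h3 : 0 ≤ Real.log (2 + Q) := Real.log_nonneg (by linarith)
    nlinarith
  have h0 : 0 ≤ Real.log (2 + x) := Real.log_nonneg (by linarith)
  have h3 : 0 ≤ Real.log (2 + Q) := Real.log_nonneg (by linarith)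
  have h4 : x / 2 * Real.log (2 + x) ≤ (Q * m) / 2 * ((1 + Real.log (2 + Q)) * L) := by
    gcongr
  have h5 : 1 + x ≤ (1 + Q) * (m * L) := by
    have : m ≤ m * L := le_mul_of_one_le_right (by linarith) hL1
    nlinarith
  have h6 : C * (1 + x) ≤ C * ((1 + Q) * (m * L)) := by gcongr
  linarith

section OneSided

variable {f : ℂ → ℂ} {C K r₀ y₀ : ℝ}

set_option maxHeartbeats 1000000 in
/-- If `f` has no zeros far down in the lower half-plane, then `log ‖f‖` is small there, since it is
bounded near the positive real axis. -/
theorem eventually_norm_le_of_zero_free (hf : Differentiable ℂ f) (hC : 0 ≤ C)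
    (hg : ∀ s, ‖f s‖ ≤ Real.exp (max (-s.re) 0 / 2 * Real.log (2 + ‖s‖) + C * (1 + ‖s‖)))
    (hK : 0 ≤ K)
    (hsec : ∀ s : ℂ, r₀ ≤ s.re → K * |s.im| ≤ s.re → 1 / 2 ≤ ‖f s‖ ∧ ‖f s‖ ≤ 2)
    (hy : 0 ≤ y₀) (hz : ∀ s : ℂ, s.im < -y₀ → f s ≠ 0) {ρ ε : ℝ} (hρ : 0 ≤ ρ) (hρ1 : ρ < 1)
    (hε : 0 < ε) :
    ∀ᶠ m : ℝ in atTop, ∀ z : ℂ, ‖z‖ ≤ ρ →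
      ‖f (m * lowerCayley (2 * K + 1) z - I * y₀)‖ ≤ Real.exp (ε * (m * Real.log m)) := by
  -- Near the centre the real part is at least `m (X - 1/2) = 2Km + m/2`, while the imaginary part
  -- is at most `2m` in absolute value once `m ≥ 2 y₀`; such points lie in the sector.
  set X : ℝ := 2 * K + 1 with hX
  obtain ⟨ρ₁, hρρ₁, hρ₁1⟩ := exists_between hρ1
  obtain ⟨ρ₂', hρ₁₂', hρ₂'1⟩ := exists_between hρ₁1
  set ρ₂ := max ρ₂' (1 / 2) with hρ₂
  have hρ₁₂ : ρ₁ < ρ₂ := hρ₁₂'.trans_le (le_max_left _ _)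
  have hρ₂h : 1 / 2 ≤ ρ₂ := le_max_right _ _
  have hρ₂1 : ρ₂ < 1 := max_lt hρ₂'1 (by norm_num)
  have hρ₁0 : 0 < ρ₁ := hρ.trans_lt hρρ₁
  set Q : ℝ := X + 2 / (1 - ρ₂) + 1 with hQ
  have hX0 : 0 ≤ X := by positivity
  have hQ0 : 0 ≤ Q := by
    have : 0 < 1 - ρ₂ := by linarith
    positivity
  set M₀ : ℝ := Q / 2 * (1 + Real.log (2 + Q)) + C * (1 + Q) with hM₀
  have hM₀0 : 0 ≤ M₀ := by
    have : 0 ≤ Real.log (2 + Q) := Real.log_nonneg (by linarith)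
    positivity
  obtain ⟨B, hB, hBh⟩ := exists_tendsto_zero_bound (ρ₀ := 1 / 10) (ρ := ρ) (ρ₁ := ρ₁) (r := ρ₂)
    (M := 2 * (M₀ + 1) * ρ₁ / (ρ₂ - ρ₁)) (by norm_num) (by linarith) hρ hρρ₁ hρ₁₂
  have hlog : Tendsto (fun m : ℝ => m * Real.log m) atTop atTop :=
    tendsto_id.atTop_mul_atTop₀ Real.tendsto_log_atTop
  have hBε : ∀ᶠ m : ℝ in atTop, B (4 * (m * Real.log m)⁻¹) < ε / 2 := by
    have h1 : Tendsto (fun m : ℝ => 4 * (m * Real.log m)⁻¹) atTop (𝓝 0) := by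
      simpa using hlog.inv_tendsto_atTop.const_mul 4
    exact (hB.comp h1).eventually (gt_mem_nhds (by positivity))
  filter_upwards [hBε, Real.tendsto_log_atTop.eventually_ge_atTop 1, eventually_ge_atTop 1,
    eventually_ge_atTop (2 * y₀), eventually_ge_atTop (2 * r₀),
    hlog.eventually_ge_atTop (2 * Real.log 2 / ε)] with m hmB hL1 hm1 hmy hmr hmL
  intro z₁ hz₁
  set L := Real.log m with hL
  have hm0 : 0 < m := by linarith
  have hmL0 : 0 < m * L := by positivity
  have hmL1 : 1 ≤ m * L := by nlinarith
  set F : ℂ → ℂ := fun z => f (m * lowerCayley X z - I * y₀) with hF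
  have hFd : DifferentiableOn ℂ F (ball 0 1) :=
    hf.comp_differentiableOn (((differentiableOn_lowerCayley X).const_mul _).sub_const _)
  have hFne : ∀ z ∈ ball (0 : ℂ) 1, F z ≠ 0 := by
    intro z hzb
    apply hz
    have := lowerCayley_im_neg X (z := z) (by simpa using hzb)
    have h1 : (m * lowerCayley X z - I * y₀).im = m * (lowerCayley X z).im - y₀ := by simp
    rw [h1]
    nlinarith
  obtain ⟨h, hhd, hh0, hhF⟩ := exists_log_ball one_pos hFd hFne
  have hsmall : ∀ z : ℂ, ‖z‖ ≤ 1 / 5 → 1 / 2 ≤ ‖F z‖ ∧ ‖F z‖ ≤ 2 := by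
    intro z hz5
    have h1 := norm_lowerCayley_sub_le X hz5
    have h2 := (abs_re_le_norm _).trans h1
    have h3 := (abs_im_le_norm _).trans h1
    simp only [sub_re, ofReal_re, I_re, sub_im, ofReal_im, I_im, abs_le] at h2 h3
    have hre : (m * lowerCayley X z - I * y₀).re = m * (lowerCayley X z).re := by simp
    have him : (m * lowerCayley X z - I * y₀).im = m * (lowerCayley X z).im - y₀ := by simp
    have h4 : X - 1 / 2 ≤ (lowerCayley X z).re := by linarith
    have h5 : m * (X - 1 / 2) ≤ m * (lowerCayley X z).re := by gcongr
    apply hsec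
    · rw [hre]
      have : m * (1 / 2) ≤ m * (X - 1 / 2) := by gcongr; linarith
      linarith
    · rw [hre, him]
      have h6 : |m * (lowerCayley X z).im - y₀| ≤ 2 * m := by
        rw [abs_le]; constructor <;> nlinarith
      have h7 : K * |m * (lowerCayley X z).im - y₀| ≤ K * (2 * m) := by gcongr
      have : m * (X - 1 / 2) = K * (2 * m) + m / 2 := by rw [hX]; ring
      linarith
  have hF0 := hsmall 0 (by norm_num)
  have hF0p : 0 < ‖F 0‖ := by linarith [hF0.1]
  have hnorm : ∀ z ∈ ball (0 : ℂ) 1, ‖F z‖ = ‖F 0‖ * Real.exp (h z).re := by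
    intro z hz1
    rw [hhF z hz1, norm_mul, Complex.norm_exp]
  have hre : ∀ z ∈ ball (0 : ℂ) 1, (h z).re = Real.log ‖F z‖ - Real.log ‖F 0‖ := by
    intro z hz1
    rw [hnorm z hz1, Real.log_mul hF0p.ne' (Real.exp_ne_zero _), Real.log_exp]
    ring
  have hlog2 : Real.log 2 ≤ 1 := by linarith [Real.log_two_lt_d9]
  have hlogF0 : -Real.log 2 ≤ Real.log ‖F 0‖ := by
    have := Real.log_le_log (by norm_num) hF0.1
    rwa [one_div, Real.log_inv] at this
  have hbig : ∀ z ∈ ball (0 : ℂ) ρ₂, (h z).re ≤ (M₀ + 1) * (m * L) := by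
    intro z hz2
    rw [mem_ball_zero_iff] at hz2
    have hz1 : z ∈ ball (0 : ℂ) 1 := by rw [mem_ball_zero_iff]; linarith
    rw [hre z hz1]
    set s := m * lowerCayley X z - I * y₀ with hs
    have h1 : ‖s‖ ≤ Q * m := by
      refine (norm_sub_le _ _).trans ?_
      have := norm_lowerCayley_le hX0 hρ₂1 hz2.le
      rw [norm_mul, norm_mul, norm_I, norm_real, norm_real, Real.norm_of_nonneg hm0.le,
        Real.norm_of_nonneg hy, one_mul, hQ]
      have h2 := mul_le_mul_of_nonneg_left this hm0.le
      have e : (X + 2 / (1 - ρ₂) + 1) * m = m * (X + 2 / (1 - ρ₂)) + m := by ring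
      rw [e]
      linarith
    have h2 := hg s
    have h3 : max (-s.re) 0 ≤ ‖s‖ :=
      max_le ((neg_le_abs _).trans (abs_re_le_norm s)) (norm_nonneg _)
    have h4 : 0 ≤ Real.log (2 + ‖s‖) := Real.log_nonneg (by linarith [norm_nonneg s])
    have h5 : max (-s.re) 0 / 2 * Real.log (2 + ‖s‖) + C * (1 + ‖s‖) ≤ M₀ * (m * L) := by
      refine le_trans ?_ (mul_log_two_add_le hQ0 hC hm1 hL.symm hL1 (norm_nonneg s) h1)
      gcongr
    have h6 : Real.log ‖F z‖ ≤ M₀ * (m * L) := by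
      have hpos : 0 < ‖F z‖ := norm_pos_iff.2 (hFne z hz1)
      rw [Real.log_le_iff_le_exp hpos]
      exact h2.trans (Real.exp_le_exp.2 h5)
    nlinarith
  have hM1 : ∀ z ∈ sphere (0 : ℂ) ρ₁, ‖h z‖ ≤ 2 * ((M₀ + 1) * (m * L)) * ρ₁ / (ρ₂ - ρ₁) := by
    intro z hzs
    rw [mem_sphere_zero_iff_norm] at hzs
    have := borelCaratheodory_zero (M := (M₀ + 1) * (m * L)) (R := ρ₂) (z := z) (by positivity)
      (hhd.mono (ball_subset_ball hρ₂1.le)) (fun z hz => hbig z hz) (by linarith)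
      (by rw [mem_ball_zero_iff]; linarith) hh0
    rwa [hzs] at this
  have hδ : ∀ z ∈ sphere (0 : ℂ) (1 / 10), ‖h z‖ ≤ 4 := by
    intro z hzs
    rw [mem_sphere_zero_iff_norm] at hzs
    have := borelCaratheodory_zero (M := 2) (R := 1 / 5) (z := z) (by positivity)
      (hhd.mono (ball_subset_ball (by norm_num))) (fun z hz => ?_) (by norm_num)
      (by rw [mem_ball_zero_iff]; linarith) hh0
    · rw [hzs] at this
      refine this.trans ?_
      norm_num
    · rw [mem_ball_zero_iff] at hz
      change (h z).re ≤ 2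
      have hz1 : z ∈ ball (0 : ℂ) 1 := by rw [mem_ball_zero_iff]; linarith
      rw [hre z hz1]
      have := Real.log_le_log (norm_pos_iff.2 (hFne z hz1)) (hsmall z hz.le).2
      linarith
  have hmLc : ‖((m * L : ℝ) : ℂ)‖ = m * L := by rw [norm_real, Real.norm_of_nonneg hmL0.le]
  -- After division by `m log m`, the logarithm is bounded on radius `ρ₁` uniformly in `m` and is at
  -- most `4/(m log m)` on radius `1/10`, so the smallness spreads to radius `ρ`.
  have hfin := hBh (4 * (m * L)⁻¹) (fun z => h z / ((m * L : ℝ) : ℂ))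
    ((hhd.mono (ball_subset_ball hρ₂1.le)).div_const _)
    (fun z hz => by
      rw [norm_div, hmLc, div_le_iff₀ hmL0]
      refine (hM1 z hz).trans (le_of_eq ?_)
      ring)
    (fun z hz => by
      rw [norm_div, hmLc, ← div_eq_mul_inv]
      have := hδ z hz
      gcongr) z₁ hz₁
  rw [norm_div, hmLc, div_le_iff₀ hmL0] at hfin
  have hz11 : z₁ ∈ ball (0 : ℂ) 1 := by rw [mem_ball_zero_iff]; linarith
  change ‖F z₁‖ ≤ _
  rw [hnorm z₁ hz11]
  have h1 : ‖F 0‖ ≤ Real.exp (Real.log 2) := by rw [Real.exp_log two_pos]; exact hF0.2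
  calc ‖F 0‖ * Real.exp (h z₁).re ≤ Real.exp (Real.log 2) * Real.exp (h z₁).re := by gcongr
    _ = Real.exp (Real.log 2 + (h z₁).re) := (Real.exp_add _ _).symm
    _ ≤ Real.exp (ε * (m * L)) := by
      apply Real.exp_le_exp.2
      have h2 := (re_le_norm (h z₁)).trans hfin
      rw [div_le_iff₀ hε] at hmL
      nlinarith

/-- If `f` has no zeros far down in the lower half-plane, then `f (-m)` is smaller than the growth
of `f` permits. -/
theorem eventually_norm_neg_nat_le_of_zero_free (hf : Differentiable ℂ f) (hC : 0 ≤ C)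
    (hg : ∀ s, ‖f s‖ ≤ Real.exp (max (-s.re) 0 / 2 * Real.log (2 + ‖s‖) + C * (1 + ‖s‖)))
    (hK : 0 ≤ K)
    (hsec : ∀ s : ℂ, r₀ ≤ s.re → K * |s.im| ≤ s.re → 1 / 2 ≤ ‖f s‖ ∧ ‖f s‖ ≤ 2)
    (hy : 0 ≤ y₀) (hz : ∀ s : ℂ, s.im < -y₀ → f s ≠ 0) :
    ∀ᶠ m : ℝ in atTop, ‖f (-m)‖ ≤ Real.exp (15 / 32 * (m * Real.log m)) := by
  obtain ⟨ρ, hρ0, hρ1, hρ⟩ := exists_lowerCayley_eq (X := 2 * K + 1) (by positivity)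
  have hev := eventually_norm_le_of_zero_free hf hC hg hK hsec hy hz hρ0 hρ1
    (ε := 1 / 32) (by norm_num)
  filter_upwards [hev, eventually_ge_atTop 2, eventually_ge_atTop (10 * y₀),
    Real.tendsto_log_atTop.eventually_ge_atTop (100 + 300 * C)] with m hm hm2 hmy hmL
  set L := Real.log m with hL
  have hm0 : 0 < m := by linarith
  have hL0 : 0 ≤ L := by linarith
  -- Dividing by `m` and adding `y₀/m ≤ 1/10` leaves imaginary part at most `-7/20 + 1/10 = -1/4`,
  -- inside the compact set reached by the Cayley map.
  have hlow : ∀ w : ℂ, ‖w‖ = m / 2 → w.im ≤ -(7 / 20) * m →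
      ‖f (-m + w)‖ ≤ Real.exp (1 / 32 * (m * L)) := by
    intro w hw hwim
    obtain ⟨z, hz, hzp⟩ := hρ ((-m + w + I * y₀) / m) (by
        have : ((-m + w + I * y₀) / m).im = (w.im + y₀) / m := by
          rw [div_ofReal_im]; simp
        rw [this, div_le_iff₀ hm0]
        linarith) (by
        rw [norm_div, norm_real, Real.norm_of_nonneg hm0.le, div_le_iff₀ hm0]
        refine (norm_add_le _ _).trans ?_
        have := norm_add_le (-m : ℂ) w
        rw [norm_neg, norm_real, Real.norm_of_nonneg hm0.le, hw] at this
        rw [norm_mul, norm_I, norm_real, Real.norm_of_nonneg hy]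
        linarith)
    have h1 := hm z hz
    rw [hzp] at h1
    have hmc : (m : ℂ) ≠ 0 := by exact_mod_cast hm0.ne'
    have e : (m : ℂ) * ((-m + w + I * y₀) / m) - I * y₀ = -m + w := by
      field_simp; ring
    rwa [e] at h1
  have hgen : ∀ w : ℂ, ‖w‖ = m / 2 →
      ‖f (-m + w)‖ ≤ Real.exp ((m - w.re) / 2 * (L + 2) + C * (3 * m)) := by
    intro w hw
    refine (hg _).trans (Real.exp_le_exp.2 ?_)
    have h1 := (abs_le.1 ((abs_re_le_norm w).trans hw.le))
    have h2 : -((-m + w : ℂ)).re = m - w.re := by simp; ring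
    have h3 : ‖(-m + w : ℂ)‖ ≤ 3 / 2 * m := by
      have := norm_add_le (-m : ℂ) w
      rw [norm_neg, norm_real, Real.norm_of_nonneg hm0.le, hw] at this
      linarith
    rw [h2, max_eq_left (by linarith)]
    have h4 : Real.log (2 + ‖(-m + w : ℂ)‖) ≤ L + 2 := by
      have h5 : Real.log (2 + ‖(-m + w : ℂ)‖) ≤ Real.log (m * 4) :=
        Real.log_le_log (by positivity) (by linarith)
      rw [Real.log_mul hm0.ne' (by norm_num)] at h5
      have h6 : Real.log 4 = 2 * Real.log 2 := by
        rw [show (4 : ℝ) = 2 ^ 2 by norm_num, Real.log_pow]; norm_num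
      linarith [Real.log_two_lt_d9]
    have h7 : 0 ≤ (m - w.re) / 2 := by linarith
    gcongr
    linarith
  -- One of four rotated points lies on the low arc and costs `1/32`. The other three cost `(3m + Re
  -- w)/2 ≤ 7m/4` times `L + 2`. As `7/4 + 1/32 < 4 * (15/32)`, the remaining `3/32` of `m L`
  -- absorbs the linear terms.
  set B : ℝ := 7 / 4 * m * (L + 2) + C * (9 * m) + 1 / 32 * (m * L) with hB
  have hprod : ∀ w : ℂ, ‖w‖ = m / 2 → w.im ≤ -(7 / 20) * m →
      ‖f (-m + w) * f (-m + I * w) * f (-m + -w) * f (-m + -(I * w))‖ ≤ Real.exp B := by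
    intro w hw hwim
    have hw2 : ‖I * w‖ = m / 2 := by rw [norm_mul, norm_I, one_mul, hw]
    have a1 := hlow w hw hwim
    have a2 := hgen (I * w) hw2
    have a3 := hgen (-w) (by rw [norm_neg, hw])
    have a4 := hgen (-(I * w)) (by rw [norm_neg, hw2])
    have h1 := (abs_le.1 ((abs_re_le_norm w).trans hw.le))
    rw [norm_mul, norm_mul, norm_mul]
    calc _ ≤ Real.exp (1 / 32 * (m * L)) *
        Real.exp ((m - (I * w).re) / 2 * (L + 2) + C * (3 * m)) *
        Real.exp ((m - (-w).re) / 2 * (L + 2) + C * (3 * m)) *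
        Real.exp ((m - (-(I * w)).re) / 2 * (L + 2) + C * (3 * m)) := by gcongr
      _ = Real.exp ((3 * m + w.re) / 2 * (L + 2) + C * (9 * m) + 1 / 32 * (m * L)) := by
        rw [← Real.exp_add, ← Real.exp_add, ← Real.exp_add, neg_re, neg_re]
        congr 1; ring
      _ ≤ Real.exp B := by
        apply Real.exp_le_exp.2
        rw [hB]
        nlinarith
  -- The product over the four quarter turns replaces an average of `log |f|` over the circle: its
  -- value at `0` is `f (-m) ^ 4`.
  set g : ℂ → ℂ := fun z => f (-m + z) * f (-m + I * z) * f (-m + -z) * f (-m + -(I * z)) with hgdef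
  have hgd : Differentiable ℂ g := by
    have h1 : Differentiable ℂ fun z : ℂ => f (-m + z) := hf.comp (by fun_prop)
    have h2 : Differentiable ℂ fun z : ℂ => f (-m + I * z) := hf.comp (by fun_prop)
    have h3 : Differentiable ℂ fun z : ℂ => f (-m + -z) := hf.comp (by fun_prop)
    have h4 : Differentiable ℂ fun z : ℂ => f (-m + -(I * z)) := hf.comp (by fun_prop)
    exact ((h1.mul h2).mul h3).mul h4
  have hrot : ∀ z, g (I * z) = g z := by
    intro z
    have e : I * (I * z) = -z := by rw [← mul_assoc, I_mul_I]; ring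
    simp only [hgdef, e, neg_neg]
    ring
  -- Some quarter turn of `z` always reaches the low arc: otherwise both coordinates are below
  -- `7m/20` in absolute value, while `2 (7/20)² < 1/4`.
  have hsph : ∀ z : ℂ, ‖z‖ = m / 2 → ‖g z‖ ≤ Real.exp B := by
    intro z hz
    have hsq : z.re ^ 2 + z.im ^ 2 = m ^ 2 / 4 := by
      have := Complex.sq_norm z
      rw [hz, normSq_apply] at this
      linarith
    have hn : ∀ w : ℂ, ‖w‖ = m / 2 → ‖I * w‖ = m / 2 := fun w hw => by
      rw [norm_mul, norm_I, one_mul, hw]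
    by_cases c1 : z.im ≤ -(7 / 20) * m
    · exact hprod z hz c1
    by_cases c2 : (I * z).im ≤ -(7 / 20) * m
    · rw [← hrot]; exact hprod _ (hn _ hz) c2
    by_cases c3 : (I * (I * z)).im ≤ -(7 / 20) * m
    · rw [← hrot, ← hrot]; exact hprod _ (hn _ (hn _ hz)) c3
    by_cases c4 : (I * (I * (I * z))).im ≤ -(7 / 20) * m
    · rw [← hrot, ← hrot, ← hrot]; exact hprod _ (hn _ (hn _ (hn _ hz))) c4
    exfalso
    simp at c1 c2 c3 c4
    nlinarith
  have hmax := Complex.norm_le_of_forall_mem_frontier_norm_le (U := ball (0 : ℂ) (m / 2))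
    isBounded_ball hgd.diffContOnCl (C := Real.exp B)
    (fun z hz => hsph z (by rwa [frontier_ball _ (by positivity), mem_sphere_zero_iff_norm] at hz))
    (z := 0) (subset_closure (mem_ball_self (by positivity)))
  have e : g 0 = f (-m) ^ 4 := by simp [hgdef]; ring
  rw [e, norm_pow] at hmax
  have h5 : B ≤ 4 * (15 / 32 * (m * L)) := by
    rw [hB]
    have : m * (100 + 300 * C) ≤ m * L := by gcongr
    nlinarith [mul_nonneg hC hm0.le]
  have h6 : ‖f (-m)‖ ^ 4 ≤ Real.exp (15 / 32 * (m * L)) ^ 4 := by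
    rw [← Real.exp_nat_mul]
    exact hmax.trans (Real.exp_le_exp.2 (by push_cast; linarith))
  exact le_of_pow_le_pow_left₀ (by norm_num) (Real.exp_pos _).le h6

end OneSided

open MeasureTheory

/-! ### The Siegel kernel on lines of slope one; growth and holomorphy of `R` -/

/-- The line of slope one through the real point `c`, parametrized downwards. -/
noncomputable def slopeLine (c u : ℝ) : ℂ := c - exp (Real.pi * I / 4) * u

/-- The function `e^(πix) - e^(-πix)`. -/
noncomputable def sinDenom (x : ℂ) : ℂ := exp (Real.pi * I * x) - exp (-(Real.pi * I * x))

/-- The kernel `e^(πix²) / (e^(πix) - e^(-πix))`. -/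
noncomputable def siegelKernel (x : ℂ) : ℂ := exp (Real.pi * I * x ^ 2) / sinDenom x

/-- The integral of `φ` against the Siegel kernel over the line of slope one through `c`. -/
noncomputable def siegelIntegral (φ : ℂ → ℂ) (c : ℝ) : ℂ :=
  ∫ u : ℝ, φ (slopeLine c u) * siegelKernel (slopeLine c u) * (-exp (Real.pi * I / 4))

theorem riemannR_eq_siegelIntegral (s : ℂ) :
    riemannR s = siegelIntegral (fun x => x ^ (-s)) (1 / 2) := by
  unfold riemannR siegelIntegral siegelKernel sinDenom
  congr 1
  ext u
  have : siegelPath u = slopeLine (1 / 2) u := by simp [siegelPath, slopeLine]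
  rw [this, mul_div_assoc]

theorem exp_pi_mul_I_div_four : exp (Real.pi * I / 4) = (√2 / 2 : ℝ) + (√2 / 2 : ℝ) * I := by
  have : (Real.pi * I / 4 : ℂ) = ((Real.pi / 4 : ℝ) : ℂ) * I := by push_cast; ring
  rw [this, exp_mul_I, ← ofReal_cos, ← ofReal_sin, Real.cos_pi_div_four, Real.sin_pi_div_four]

theorem exp_pi_mul_I_div_four_sq : exp (Real.pi * I / 4) ^ 2 = I := by
  rw [← exp_nat_mul]
  have : ((2 : ℕ) * (Real.pi * I / 4) : ℂ) = Real.pi / 2 * I := by push_cast; ring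
  rw [this, exp_pi_div_two_mul_I]

theorem norm_exp_pi_mul_I_div_four : ‖exp (Real.pi * I / 4)‖ = 1 := by
  rw [Complex.norm_exp]; simp

theorem slopeLine_re (c u : ℝ) : (slopeLine c u).re = c - √2 / 2 * u := by
  rw [slopeLine, exp_pi_mul_I_div_four]; simp

theorem slopeLine_im (c u : ℝ) : (slopeLine c u).im = -(√2 / 2 * u) := by
  rw [slopeLine, exp_pi_mul_I_div_four]; simp

theorem continuous_slopeLine (c : ℝ) : Continuous (slopeLine c) := by
  unfold slopeLine; fun_prop

theorem continuous_sinDenom : Continuous sinDenom := by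
  unfold sinDenom; fun_prop

theorem differentiable_sinDenom : Differentiable ℂ sinDenom := by
  unfold sinDenom; fun_prop

theorem norm_exp_pi_mul_I_mul_sq (x : ℂ) :
    ‖exp (Real.pi * I * x ^ 2)‖ = Real.exp (-(2 * Real.pi * (x.re * x.im))) := by
  rw [Complex.norm_exp]
  congr 1
  simp [pow_two]
  ring

theorem norm_sinDenom_sq (x : ℂ) :
    ‖sinDenom x‖ ^ 2 = 2 * Real.cosh (2 * Real.pi * x.im) - 2 * Real.cos (2 * Real.pi * x.re) := by
  have e1 : (Real.pi * I * x : ℂ) =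
      ((-(Real.pi * x.im) : ℝ) : ℂ) + ((Real.pi * x.re : ℝ) : ℂ) * I := by
    apply Complex.ext <;> simp
  have e2 : (-(Real.pi * I * x) : ℂ) =
      ((Real.pi * x.im : ℝ) : ℂ) + ((-(Real.pi * x.re) : ℝ) : ℂ) * I := by
    apply Complex.ext <;> simp
  rw [sinDenom, e2, e1, Complex.sq_norm, normSq_apply, exp_add, exp_add, exp_mul_I, exp_mul_I,
    ← ofReal_exp, ← ofReal_exp, ← ofReal_cos, ← ofReal_sin, ← ofReal_cos, ← ofReal_sin,
    Real.cos_neg, Real.sin_neg]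
  set a := Real.pi * x.re
  set b := Real.pi * x.im
  have h1 : 2 * Real.pi * x.im = b + b := by ring
  have h2 : 2 * Real.pi * x.re = 2 * a := by ring
  rw [h1, h2, Real.cosh_eq, Real.cos_two_mul, neg_add, Real.exp_add, Real.exp_add]
  have h3 : Real.exp b * Real.exp (-b) = 1 := by rw [← Real.exp_add]; simp
  have h4 := Real.sin_sq_add_cos_sq a
  simp only [sub_re, sub_im, add_re, add_im, ofReal_re, ofReal_im,
    mul_re, mul_im, I_re, I_im, ofReal_neg, neg_re, neg_im]
  ring_nf
  ring_nf at h3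
  have h5 : Real.sin a ^ 2 = 1 - Real.cos a ^ 2 := by linarith
  rw [h5]
  linear_combination (2 - 4 * Real.cos a ^ 2) * h3

theorem one_add_sq_div_two_le_cosh (x : ℝ) : 1 + x ^ 2 / 2 ≤ Real.cosh x := by
  have h1 : Real.cosh x = 1 + 2 * Real.sinh (x / 2) ^ 2 := by
    have h := Real.cosh_two_mul (x / 2)
    have h2 := Real.cosh_sq (x / 2)
    rw [mul_div_cancel₀ x two_ne_zero] at h
    linarith
  have h2 : (x / 2) ^ 2 ≤ Real.sinh (x / 2) ^ 2 := by
    rw [sq_le_sq, Real.abs_sinh]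
    exact Real.self_le_sinh_iff.2 (abs_nonneg _)
  rw [h1]
  linarith

theorem one_le_norm_sinDenom_of_im {x : ℂ} (hx : 1 / 5 ≤ |x.im|) : 1 ≤ ‖sinDenom x‖ := by
  have h1 := norm_sinDenom_sq x
  have h2 := Real.cos_le_one (2 * Real.pi * x.re)
  have h3 : 1 + (2 * Real.pi * x.im) ^ 2 / 2 ≤ Real.cosh (2 * Real.pi * x.im) :=
    one_add_sq_div_two_le_cosh _
  have h4 : 1 / 25 ≤ x.im ^ 2 := by
    rw [← sq_abs]; nlinarith
  have h5 : 9 ≤ Real.pi ^ 2 := by nlinarith [Real.pi_gt_three]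
  have h6 : 1 ≤ ‖sinDenom x‖ ^ 2 := by
    have : 9 * (1 / 25) ≤ Real.pi ^ 2 * x.im ^ 2 := by gcongr
    nlinarith
  nlinarith [norm_nonneg (sinDenom x)]

/-- On such a line the cosine changes sign, and with `t = 2πv` one has `cosh t + cos t ≥ (1 + t²/2)
+ (1 - t²/2) = 2`. -/
theorem one_le_norm_sinDenom_of_half (n : ℤ) (v : ℝ) {x : ℂ} (hre : x.re = n + 1 / 2 - v)
    (him : x.im = -v) : 1 ≤ ‖sinDenom x‖ := by
  have h1 := norm_sinDenom_sq x
  have h2 : Real.cos (2 * Real.pi * x.re) = -Real.cos (2 * Real.pi * v) := by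
    have : 2 * Real.pi * x.re = Real.pi - 2 * Real.pi * v + n * (2 * Real.pi) := by
      rw [hre]; ring
    rw [this, Real.cos_add_int_mul_two_pi, Real.cos_pi_sub]
  have h3 : 1 + (2 * Real.pi * x.im) ^ 2 / 2 ≤ Real.cosh (2 * Real.pi * x.im) :=
    one_add_sq_div_two_le_cosh _
  have h4 := Real.one_sub_sq_div_two_le_cos (x := 2 * Real.pi * v)
  rw [him] at h3
  rw [h2, him] at h1
  nlinarith [norm_nonneg (sinDenom x)]

theorem one_le_norm_sinDenom_slopeLine (n : ℤ) (u : ℝ) :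
    1 ≤ ‖sinDenom (slopeLine (n + 1 / 2) u)‖ :=
  one_le_norm_sinDenom_of_half n (√2 / 2 * u) (slopeLine_re _ _) (slopeLine_im _ _)

theorem norm_siegelKernel_le {x : ℂ} (h : 1 ≤ ‖sinDenom x‖) :
    ‖siegelKernel x‖ ≤ Real.exp (-(2 * Real.pi * (x.re * x.im))) := by
  rw [siegelKernel, norm_div, norm_exp_pi_mul_I_mul_sq]
  exact div_le_self (Real.exp_pos _).le h

theorem sqrt_two_div_two_sq : (√2 / 2) ^ 2 = 1 / 2 := by
  rw [div_pow, Real.sq_sqrt (by norm_num)]; norm_num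

theorem norm_slopeLine_sq (c u : ℝ) :
    ‖slopeLine c u‖ ^ 2 = (c - √2 / 2 * u) ^ 2 + (√2 / 2 * u) ^ 2 := by
  rw [Complex.sq_norm, normSq_apply, slopeLine_re, slopeLine_im]; ring

/-- With `v = u/√2` the kernel contributes `-2πv²` to the exponent and a numerator of size `exp
(|x|²/2)` contributes `v²`, so `-2v² = -u²` remains with room for the linear terms. -/
theorem exponent_le {c : ℝ} (hc : |c| ≤ 3 / 2) (v : ℝ) :
    ((c - v) ^ 2 + v ^ 2) / 2 + 2 * Real.pi * ((c - v) * v) ≤ 10 - 2 * v ^ 2 := by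
  obtain ⟨h1, h2⟩ := abs_le.1 hc
  have hc2 : c ^ 2 ≤ 9 / 4 := by nlinarith
  have hX : (c - v) * v ≤ 9 / 16 := by nlinarith [sq_nonneg (v - c / 2)]
  have hp1 := Real.pi_gt_three
  have hp2 := Real.pi_lt_d2
  have h3 : (2 * Real.pi - 6) * ((c - v) * v) ≤ (2 * Real.pi - 6) * (9 / 16) :=
    mul_le_mul_of_nonneg_left hX (by linarith)
  nlinarith [sq_nonneg (6 * v - 5 * c)]

/-- Gaussian domination of `φ` times the kernel on half-integral lines near the origin. -/
theorem norm_mul_siegelKernel_le {n : ℤ} (hn : |(n : ℝ) + 1 / 2| ≤ 3 / 2) {a : ℂ} {A u : ℝ}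
    (ha : ‖a‖ ≤ A * Real.exp (‖slopeLine (n + 1 / 2) u‖ ^ 2 / 2)) (hA : 0 ≤ A) :
    ‖a * siegelKernel (slopeLine (n + 1 / 2) u) * (-exp (Real.pi * I / 4))‖ ≤
      A * Real.exp 10 * Real.exp (-1 * u ^ 2) := by
  rw [norm_mul, norm_neg, norm_exp_pi_mul_I_div_four, mul_one, norm_mul]
  have h1 := norm_siegelKernel_le (one_le_norm_sinDenom_slopeLine n u)
  calc _ ≤ A * Real.exp (‖slopeLine (n + 1 / 2) u‖ ^ 2 / 2) *
        Real.exp (-(2 * Real.pi * ((slopeLine (n + 1 / 2) u).re *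
          (slopeLine (n + 1 / 2) u).im))) := by gcongr
    _ ≤ A * Real.exp 10 * Real.exp (-1 * u ^ 2) := by
      rw [mul_assoc A, mul_assoc A, ← Real.exp_add, ← Real.exp_add]
      refine mul_le_mul_of_nonneg_left (Real.exp_le_exp.2 ?_) hA
      rw [norm_slopeLine_sq, slopeLine_re, slopeLine_im]
      have := exponent_le hn (√2 / 2 * u)
      have h2 : 2 * (√2 / 2 * u) ^ 2 = u ^ 2 := by rw [mul_pow, sqrt_two_div_two_sq]; ring
      linarith

theorem integrable_gaussian (A : ℝ) : Integrable fun u : ℝ => A * Real.exp (-1 * u ^ 2) :=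
  (integrable_exp_neg_mul_sq one_pos).const_mul A

theorem slopeLine_mem_slitPlane {c : ℝ} (hc : 0 < c) (u : ℝ) : slopeLine c u ∈ slitPlane := by
  rw [mem_slitPlane_iff, slopeLine_re, slopeLine_im]
  by_cases h : u = 0
  · left; simp [h, hc]
  · right
    have : √2 / 2 * u ≠ 0 := mul_ne_zero (by positivity) h
    simpa using this

theorem half_le_norm_slopeLine {c : ℝ} (u : ℝ) : c ^ 2 / 2 ≤ ‖slopeLine c u‖ ^ 2 := by
  rw [norm_slopeLine_sq]
  nlinarith [sq_nonneg (c - 2 * (√2 / 2 * u))]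

/-- Growth of powers off the origin. -/
theorem norm_cpow_neg_le {x : ℂ} (hx : 1 / 3 ≤ ‖x‖) (s : ℂ) :
    ‖x ^ (-s)‖ ≤
      Real.exp (max (-s.re) 0 / 2 * Real.log (2 + ‖s‖) + 6 * ‖s‖) * Real.exp (‖x‖ ^ 2 / 2) := by
  have hx0 : 0 < ‖x‖ := by linarith
  rw [norm_cpow_of_ne_zero (norm_pos_iff.1 hx0), div_eq_mul_inv, ← Real.exp_neg,
    Real.rpow_def_of_pos hx0, ← Real.exp_add, ← Real.exp_add]
  apply Real.exp_le_exp.2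
  have h1 : -(arg x * (-s).im) ≤ 4 * ‖s‖ := by
    have ha := abs_arg_le_pi x
    have hs := abs_im_le_norm s
    have : -(arg x * (-s).im) ≤ |arg x| * |s.im| := by
      rw [← abs_mul]; simp only [neg_im, mul_neg, neg_neg]; exact le_abs_self _
    have h3 : |arg x| * |s.im| ≤ 4 * ‖s‖ := by
      gcongr
      linarith [Real.pi_lt_d2]
    linarith
  have h2 : Real.log ‖x‖ * (-s).re ≤
      max (-s.re) 0 / 2 * Real.log (2 + ‖s‖) + 2 * ‖s‖ + ‖x‖ ^ 2 / 2 := by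
    rw [neg_re]
    have hre := abs_le.1 (abs_re_le_norm s)
    rcases le_or_gt 0 s.re with hs | hs
    · rw [max_eq_right (by linarith)]
      have h4 : -2 ≤ Real.log ‖x‖ := by
        rw [Real.le_log_iff_exp_le hx0]
        refine le_trans ?_ hx
        rw [Real.exp_neg, one_div]
        apply inv_anti₀ (by norm_num)
        linarith [Real.add_one_le_exp (2 : ℝ)]
      nlinarith [sq_nonneg ‖x‖]
    · rw [max_eq_left (by linarith)]
      set a := -s.re
      have ha : 0 < a := by linarith
      -- Applying `log t ≤ t` to `t = |x|²/a` bounds `a log |x|` by `(a/2) log a + |x|²/2`: the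
      -- source of the coefficient `1/2` in the growth of `R`.
      have h5 : Real.log (‖x‖ ^ 2 / a) ≤ ‖x‖ ^ 2 / a :=
        (Real.log_le_sub_one_of_pos (by positivity)).trans (by linarith)
      rw [Real.log_div (by positivity) ha.ne', Real.log_pow] at h5
      have h6 : a * (2 * Real.log ‖x‖ - Real.log a) ≤ ‖x‖ ^ 2 := by
        have := mul_le_mul_of_nonneg_left h5 ha.le
        rw [mul_div_cancel₀ _ ha.ne'] at this
        exact_mod_cast this
      have h7 : Real.log a ≤ Real.log (2 + ‖s‖) := Real.log_le_log ha (by linarith)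
      have h8 : a * Real.log a ≤ a * Real.log (2 + ‖s‖) := by gcongr
      have := norm_nonneg s
      linarith
  linarith

theorem third_le_norm_slopeLine_half (u : ℝ) : 1 / 3 ≤ ‖slopeLine (1 / 2) u‖ := by
  have h := half_le_norm_slopeLine (c := 1 / 2) u
  nlinarith [norm_nonneg (slopeLine (1 / 2) u)]

theorem continuous_siegelKernel_slopeLine (n : ℤ) :
    Continuous fun u => siegelKernel (slopeLine (n + 1 / 2) u) := by
  unfold siegelKernel
  have h1 := continuous_slopeLine ((n : ℝ) + 1 / 2)
  have h2 := continuous_sinDenom.comp h1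
  refine Continuous.div (by fun_prop) h2 (fun u h => ?_)
  have := one_le_norm_sinDenom_slopeLine n u
  rw [h, norm_zero] at this
  linarith

theorem continuous_cpow_slopeLine {c : ℝ} (hc : 0 < c) (s : ℂ) :
    Continuous fun u => slopeLine c u ^ (-s) :=
  (continuous_slopeLine c).cpow continuous_const (slopeLine_mem_slitPlane hc)

theorem norm_riemannR_integrand_le (s : ℂ) (u : ℝ) :
    ‖slopeLine (1 / 2) u ^ (-s) * siegelKernel (slopeLine (1 / 2) u) *
      (-exp (Real.pi * I / 4))‖ ≤
      Real.exp (max (-s.re) 0 / 2 * Real.log (2 + ‖s‖) + 6 * ‖s‖) * Real.exp 10 *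
        Real.exp (-1 * u ^ 2) := by
  have h := norm_mul_siegelKernel_le (n := 0) (u := u) (a := slopeLine (1 / 2) u ^ (-s))
    (A := Real.exp (max (-s.re) 0 / 2 * Real.log (2 + ‖s‖) + 6 * ‖s‖)) (by norm_num [abs_le]) (by
      simpa using norm_cpow_neg_le (third_le_norm_slopeLine_half u) s) (by positivity)
  simpa using h

/-- The coefficient `1/2` and the restriction to negative `Re s` both matter: the argument about
zeros improves on exactly this bound at `s = -m`. -/
theorem exists_norm_riemannR_le : ∃ C : ℝ, 0 ≤ C ∧ ∀ s, ‖riemannR s‖ ≤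
    Real.exp (max (-s.re) 0 / 2 * Real.log (2 + ‖s‖) + C * (1 + ‖s‖)) := by
  set G := ∫ u : ℝ, Real.exp 10 * Real.exp (-1 * u ^ 2) with hG
  have hG0 : 0 ≤ G := integral_nonneg fun u => by positivity
  refine ⟨6 + G, by positivity, fun s => ?_⟩
  rw [riemannR_eq_siegelIntegral, siegelIntegral]
  set M := max (-s.re) 0 / 2 * Real.log (2 + ‖s‖)
  have h1 := norm_integral_le_of_norm_le (integrable_gaussian _)
    (Eventually.of_forall (norm_riemannR_integrand_le s))
  refine h1.trans ?_
  have e : ∫ u : ℝ, Real.exp (M + 6 * ‖s‖) * Real.exp 10 * Real.exp (-1 * u ^ 2) =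
      Real.exp (M + 6 * ‖s‖) * G := by
    rw [hG, ← integral_const_mul]
    congr 1; ext u; ring
  rw [e]
  have h2 : G ≤ Real.exp G := by linarith [Real.add_one_le_exp G]
  calc Real.exp (M + 6 * ‖s‖) * G ≤ Real.exp (M + 6 * ‖s‖) * Real.exp G := by gcongr
    _ = Real.exp (M + 6 * ‖s‖ + G) := (Real.exp_add _ _).symm
    _ ≤ _ := by
      apply Real.exp_le_exp.2
      nlinarith [norm_nonneg s]

theorem differentiable_riemannR : Differentiable ℂ riemannR := by
  intro s₀
  set D : ℝ := (‖s₀‖ + 2) / 2 * Real.log (2 + (‖s₀‖ + 2)) + 6 * (‖s₀‖ + 2) with hD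
  let F : ℂ → ℝ → ℂ := fun s u => slopeLine (1 / 2) u ^ (-s) * siegelKernel (slopeLine (1 / 2) u) *
      (-exp (Real.pi * I / 4))
  let F' : ℂ → ℝ → ℂ := fun s u => -(slopeLine (1 / 2) u ^ (-s) * log (slopeLine (1 / 2) u)) *
    siegelKernel (slopeLine (1 / 2) u) * (-exp (Real.pi * I / 4))
  have hk : Continuous fun u => siegelKernel (slopeLine (1 / 2) u) := by
    simpa using continuous_siegelKernel_slopeLine 0
  have hp := fun s => continuous_cpow_slopeLine (c := 1 / 2) (by norm_num) s
  have hl : Continuous fun u => log (slopeLine (1 / 2) u) :=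
    (continuous_slopeLine _).clog (slopeLine_mem_slitPlane (by norm_num))
  have hFc : ∀ s, Continuous (F s) := fun s => ((hp s).mul hk).mul continuous_const
  have hF'c : ∀ s, Continuous (F' s) := fun s => (((hp s).mul hl).neg.mul hk).mul continuous_const
  have hne : ∀ u, slopeLine (1 / 2) u ≠ 0 := fun u =>
    slitPlane_ne_zero (slopeLine_mem_slitPlane (by norm_num) u)
  have hderiv : ∀ u s, HasDerivAt (fun s => F s u) (F' s u) s := by
    intro u s
    have h1 := ((hasDerivAt_neg s).const_cpow (c := slopeLine (1 / 2) u) (Or.inl (hne u)))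
    refine ((h1.mul_const (siegelKernel (slopeLine (1 / 2) u))).mul_const _).congr_deriv ?_
    simp only [F']
    ring
  have hbd : ∀ s ∈ ball s₀ 2, ∀ u, ‖F s u‖ ≤ Real.exp D * Real.exp 10 * Real.exp (-1 * u ^ 2) := by
    intro s hs u
    refine (norm_riemannR_integrand_le s u).trans ?_
    have h1 : ‖s‖ ≤ ‖s₀‖ + 2 := by
      rw [mem_ball, dist_eq_norm] at hs
      have := norm_le_norm_add_norm_sub' s s₀
      linarith
    have h2 : max (-s.re) 0 ≤ ‖s₀‖ + 2 :=
      max_le (((neg_le_abs _).trans (abs_re_le_norm s)).trans h1) (by positivity)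
    have h3 : 0 ≤ Real.log (2 + ‖s‖) := Real.log_nonneg (by linarith [norm_nonneg s])
    have h4 : Real.log (2 + ‖s‖) ≤ Real.log (2 + (‖s₀‖ + 2)) :=
      Real.log_le_log (by positivity) (by linarith)
    have h5 : max (-s.re) 0 / 2 * Real.log (2 + ‖s‖) + 6 * ‖s‖ ≤ D := by
      rw [hD]; gcongr
    gcongr
  have h := hasDerivAt_integral_of_dominated_loc_of_deriv_le (μ := volume) (F := F) (F' := F')
    (x₀ := s₀) (s := ball s₀ 1) (bound := fun u => Real.exp D * Real.exp 10 * Real.exp (-1 * u ^ 2))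
    (ball_mem_nhds s₀ one_pos) (Eventually.of_forall fun s => (hFc s).aestronglyMeasurable)
    ((integrable_gaussian _).mono' (hFc s₀).aestronglyMeasurable
      (Eventually.of_forall (hbd s₀ (mem_ball_self two_pos)))) (hF'c s₀).aestronglyMeasurable
    (Eventually.of_forall fun u s hs => ?_) (integrable_gaussian _)
    (Eventually.of_forall fun u s _ => hderiv u s)
  · have e : riemannR = fun s => ∫ u, F s u := by
      ext s; rw [riemannR_eq_siegelIntegral]; rfl
    rw [e]
    exact h.2.differentiableAt
  -- The derivative in `s` is dominated through Cauchy's estimate on unit circles, which is why the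
  -- integrand was bounded on a ball of radius `2`.
  · have hd : Differentiable ℂ fun s => F s u := fun s => (hderiv u s).differentiableAt
    have := Complex.norm_deriv_le_of_forall_mem_sphere_norm_le (c := s) (R := 1)
      (f := fun s => F s u) (C := Real.exp D * Real.exp 10 * Real.exp (-1 * u ^ 2))
      one_pos hd.diffContOnCl (fun z hz => hbd z (by
        rw [mem_ball] at hs ⊢
        rw [mem_sphere] at hz
        linarith [dist_triangle z s s₀]) u)
    rwa [(hderiv u s).deriv, div_one] at this

/-! ### Moving the line across an integer -/

/-- Coordinates on the strip around the lines of slope one near `n`. -/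
noncomputable def stripPoint (n : ℤ) (ζ : ℂ) : ℂ := n - exp (Real.pi * I / 4) * ζ

theorem stripPoint_re (n : ℤ) (ζ : ℂ) : (stripPoint n ζ).re = n - √2 / 2 * (ζ.re - ζ.im) := by
  rw [stripPoint, exp_pi_mul_I_div_four]; simp; ring

theorem stripPoint_im (n : ℤ) (ζ : ℂ) : (stripPoint n ζ).im = -(√2 / 2 * (ζ.re + ζ.im)) := by
  rw [stripPoint, exp_pi_mul_I_div_four]; simp; ring

theorem differentiable_stripPoint (n : ℤ) : Differentiable ℂ (stripPoint n) := by
  unfold stripPoint; fun_prop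

theorem stripPoint_eq_slopeLine (n : ℤ) (d ξ : ℝ) :
    stripPoint n (ξ + (√2 / 2 * d : ℝ) * I) = slopeLine (n + d) (ξ + √2 / 2 * d) := by
  have h : √2 * √2 = 2 := Real.mul_self_sqrt (by norm_num)
  apply Complex.ext
  · rw [stripPoint_re, slopeLine_re]; simp; linear_combination (d / 2) * h
  · rw [stripPoint_im, slopeLine_im]; simp

theorem siegelIntegral_eq_strip (φ : ℂ → ℂ) (n : ℤ) (d : ℝ) :
    siegelIntegral φ (n + d) = ∫ ξ : ℝ, φ (stripPoint n (ξ + (√2 / 2 * d : ℝ) * I)) *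
      siegelKernel (stripPoint n (ξ + (√2 / 2 * d : ℝ) * I)) * (-exp (Real.pi * I / 4)) := by
  simp_rw [stripPoint_eq_slopeLine]
  rw [siegelIntegral, ← integral_add_right_eq_self _ (√2 / 2 * d)]

theorem sinDenom_intCast (n : ℤ) : sinDenom n = 0 := by
  have e : (Real.pi * I * n : ℂ) = n * (2 * Real.pi * I) + -(n * (Real.pi * I)) := by ring
  have e2 : -(Real.pi * I * n : ℂ) = -(n * (Real.pi * I)) := by ring
  rw [sinDenom, e2, e, sub_eq_add_neg, exp_add, exp_int_mul_two_pi_mul_I, one_mul, add_neg_cancel]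

theorem exp_pi_mul_I_mul_int_sq (n : ℤ) : exp (Real.pi * I * (n : ℂ) ^ 2) =
    exp (Real.pi * I * n) := by
  obtain ⟨k, hk⟩ := Int.even_mul_pred_self n
  have hk' : ((n * (n - 1) : ℤ) : ℂ) = ((k + k : ℤ) : ℂ) := by rw [hk]
  push_cast at hk'
  have e : (Real.pi * I * (n : ℂ) ^ 2) = Real.pi * I * n + k * (2 * Real.pi * I) := by
    linear_combination Real.pi * I * hk'
  rw [e, exp_add, exp_int_mul_two_pi_mul_I, mul_one]

theorem hasDerivAt_sinDenom (x : ℂ) : HasDerivAt sinDenom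
    (Real.pi * I * (exp (Real.pi * I * x) + exp (-(Real.pi * I * x)))) x := by
  have h1 : HasDerivAt (fun x : ℂ => Real.pi * I * x) (Real.pi * I) x := by
    simpa using (hasDerivAt_id x).const_mul (Real.pi * I : ℂ)
  refine (h1.cexp.sub h1.neg.cexp).congr_deriv ?_
  simp only [Pi.neg_apply]
  ring

/-- The closed strip between the lines of slope one through `n - 1/2` and `n + 1/2`, in strip
coordinates. -/
def unitStrip : Set ℂ := {ζ | |ζ.im| ≤ √2 / 4}

theorem sqrt_two_div_four_bounds : 7 / 20 < √2 / 4 ∧ √2 / 4 < 9 / 25 := by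
  constructor
  · have : 7 / 5 < √2 := Real.lt_sqrt_of_sq_lt (by norm_num)
    linarith
  · have : √2 < 36 / 25 := by rw [Real.sqrt_lt' (by norm_num)]; norm_num
    linarith

theorem one_le_norm_sinDenom_stripPoint_of_re (n : ℤ) {ζ : ℂ} (hζ : ζ ∈ unitStrip)
    (h1 : 1 ≤ |ζ.re|) : 1 ≤ ‖sinDenom (stripPoint n ζ)‖ := by
  apply one_le_norm_sinDenom_of_im
  rw [stripPoint_im, abs_neg, abs_mul, abs_of_pos (by positivity)]
  obtain ⟨h2, h3⟩ := sqrt_two_div_four_bounds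
  have h4 : |ζ.im| ≤ √2 / 4 := hζ
  have h5 : |ζ.re| - |ζ.im| ≤ |ζ.re + ζ.im| := by
    have := abs_sub_abs_le_abs_sub ζ.re (-ζ.im)
    rwa [abs_neg, sub_neg_eq_add] at this
  nlinarith

theorem one_le_norm_sinDenom_stripPoint_add (n : ℤ) (ξ : ℝ) :
    1 ≤ ‖sinDenom (stripPoint n (ξ + (√2 / 4 : ℝ) * I))‖ := by
  have e : (√2 / 4 : ℝ) = √2 / 2 * (1 / 2) := by ring
  rw [e, stripPoint_eq_slopeLine]
  exact one_le_norm_sinDenom_slopeLine n _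

theorem one_le_norm_sinDenom_stripPoint_sub (n : ℤ) (ξ : ℝ) :
    1 ≤ ‖sinDenom (stripPoint n (ξ + (-(√2 / 4) : ℝ) * I))‖ := by
  have e : (-(√2 / 4) : ℝ) = √2 / 2 * (-(1 / 2)) := by ring
  rw [e, stripPoint_eq_slopeLine]
  have := one_le_norm_sinDenom_slopeLine (n - 1) (ξ + √2 / 2 * (-(1 / 2)))
  convert this using 4
  push_cast; ring

/-- The zeros of `sin πx` are the integers, and the strip is too narrow to contain one other than
`n`. -/
theorem sinDenom_stripPoint_ne_zero (n : ℤ) {ζ : ℂ} (hζ : ζ ∈ unitStrip) (h0 : ζ ≠ 0) :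
    sinDenom (stripPoint n ζ) ≠ 0 := by
  intro h
  have h1 := norm_sinDenom_sq (stripPoint n ζ)
  rw [h, norm_zero] at h1
  have h2 := Real.cos_le_one (2 * Real.pi * (stripPoint n ζ).re)
  have h3 := one_add_sq_div_two_le_cosh (2 * Real.pi * (stripPoint n ζ).im)
  have h4 : (stripPoint n ζ).im = 0 := by
    by_contra h5
    have : 0 < (2 * Real.pi * (stripPoint n ζ).im) ^ 2 := by
      have := Real.pi_pos
      positivity
    nlinarith
  rw [h4, mul_zero, Real.cosh_zero] at h1
  have hs : 0 < √2 := by positivity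
  have h5 : ζ.re = -ζ.im := by
    rw [stripPoint_im] at h4
    have : √2 / 2 * (ζ.re + ζ.im) = 0 := by linarith
    rcases mul_eq_zero.1 this with h6 | h6 <;> linarith
  have h6 : Real.cos (2 * Real.pi * (stripPoint n ζ).re) = 1 := by linarith
  rw [Real.cos_eq_one_iff] at h6
  obtain ⟨k, hk⟩ := h6
  have hk' : (k : ℝ) = (stripPoint n ζ).re := by
    have := Real.pi_pos
    have h7 : (2 * Real.pi) * k = (2 * Real.pi) * (stripPoint n ζ).re := by linarith
    exact mul_left_cancel₀ (by positivity) h7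
  rw [stripPoint_re, h5] at hk'
  have h7 : ((k - n : ℤ) : ℝ) = √2 * ζ.im := by push_cast; linarith
  have h8 : |ζ.im| ≤ √2 / 4 := hζ
  have h9 : |((k - n : ℤ) : ℝ)| < 1 := by
    rw [h7, abs_mul, abs_of_pos hs]
    have : √2 * √2 = 2 := Real.mul_self_sqrt (by norm_num)
    nlinarith
  have h10 : k - n = 0 := by
    rw [← Int.abs_lt_one_iff]
    exact_mod_cast h9
  rw [h10] at h7
  have h11 : ζ.im = 0 := by
    rcases mul_eq_zero.1 (show √2 * ζ.im = 0 by rw [← h7]; simp) with h | h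
    · linarith
    · exact h
  exact h0 (Complex.ext (by rw [h5, h11]; simp) (by rw [h11]; simp))

/-- In strip coordinates the exponent is `-π (Re ζ)²` plus a term linear in `n Re ζ` and bounded
terms. A numerator of size `exp (|ζ|²)` costs one square, `exp (-(Re ζ)²)` keeps another, and the
spare `π - 2 ≥ 1` absorbs the linear term into `B`. -/
theorem exists_norm_mul_siegelKernel_stripPoint_le (n : ℤ) {A : ℝ} (hA : 0 ≤ A) :
    ∃ B : ℝ, 0 ≤ B ∧ ∀ (ζ a : ℂ), ζ ∈ unitStrip → 1 ≤ ‖sinDenom (stripPoint n ζ)‖ →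
      ‖a‖ ≤ A * Real.exp (‖ζ‖ ^ 2) →
      ‖a * siegelKernel (stripPoint n ζ) * (-exp (Real.pi * I / 4))‖ ≤
        B * Real.exp (-1 * ζ.re ^ 2) := by
  refine ⟨A * Real.exp (1 + 8 * |(n : ℝ)| + 16 * |(n : ℝ)| ^ 2), by positivity, ?_⟩
  intro ζ a hζ hd ha
  rw [norm_mul, norm_neg, norm_exp_pi_mul_I_div_four, mul_one, norm_mul]
  have h1 := norm_siegelKernel_le hd
  calc _ ≤ A * Real.exp (‖ζ‖ ^ 2) * Real.exp (-(2 * Real.pi * ((stripPoint n ζ).re *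
        (stripPoint n ζ).im))) := by gcongr
    _ ≤ _ := by
      rw [mul_assoc A, mul_assoc A, ← Real.exp_add, ← Real.exp_add]
      refine mul_le_mul_of_nonneg_left (Real.exp_le_exp.2 ?_) hA
      rw [stripPoint_re, stripPoint_im, Complex.sq_norm, normSq_apply]
      have h4 : |ζ.im| ≤ √2 / 4 := hζ
      obtain ⟨h2, h3⟩ := sqrt_two_div_four_bounds
      have h5 : ζ.im ^ 2 ≤ 13 / 100 := by rw [← sq_abs]; nlinarith [abs_nonneg ζ.im]
      have e : -(2 * Real.pi * (((n : ℝ) - √2 / 2 * (ζ.re - ζ.im)) * -(√2 / 2 * (ζ.re + ζ.im)))) =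
          Real.pi * (√2 * n * (ζ.re + ζ.im)) - Real.pi * ζ.re ^ 2 + Real.pi * ζ.im ^ 2 := by
        have := sqrt_two_div_two_sq
        linear_combination (-2 * Real.pi * (ζ.re ^ 2 - ζ.im ^ 2)) * this
      rw [e]
      have hp1 := Real.pi_gt_three
      have hp2 := Real.pi_lt_d2
      have h6 : √2 * n * (ζ.re + ζ.im) ≤ 36 / 25 * |(n : ℝ)| * (|ζ.re| + 9 / 25) := by
        refine (le_abs_self _).trans ?_
        rw [abs_mul, abs_mul, abs_of_pos (show 0 < √2 by positivity)]
        have : |ζ.re + ζ.im| ≤ |ζ.re| + 9 / 25 := (abs_add_le _ _).trans (by linarith)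
        gcongr
        linarith
      have h7 : Real.pi * (√2 * n * (ζ.re + ζ.im)) ≤
          3.15 * (36 / 25 * |(n : ℝ)| * (|ζ.re| + 9 / 25)) := by
        have h0 : 0 ≤ 36 / 25 * |(n : ℝ)| * (|ζ.re| + 9 / 25) := by positivity
        nlinarith
      have h8 : Real.pi * ζ.im ^ 2 ≤ 3.15 * (13 / 100) := by gcongr
      have h9 : 3 * ζ.re ^ 2 ≤ Real.pi * ζ.re ^ 2 := by gcongr
      have h10 : ζ.re ^ 2 = |ζ.re| ^ 2 := (sq_abs _).symm
      rw [h10] at h9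
      have h11 : ζ.re * ζ.re = |ζ.re| ^ 2 := by rw [sq_abs, sq]
      rw [h11, h10]
      have h0 := abs_nonneg (n : ℝ)
      nlinarith [sq_nonneg (|ζ.re| - 4 * |(n : ℝ)|)]

/-- The polar part `1/ζ` is not integrable along either edge of the strip, but the difference over
the two edges is a multiple of the Cauchy density. -/
theorem inv_sub_inv_eq {b : ℝ} (hb : 0 < b) (ξ : ℝ) :
    1 / ((ξ : ℂ) + (-b : ℝ) * I) - 1 / (ξ + b * I) =
      (2 * I / b) * (((1 + (ξ / b) ^ 2)⁻¹ : ℝ) : ℂ) := by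
  have hbc : (b : ℂ) ≠ 0 := by exact_mod_cast hb.ne'
  have h1 : (ξ : ℂ) + (-b : ℝ) * I ≠ 0 := by
    intro h; have := congrArg im h; simp at this; exact hb.ne' this
  have h2 : (ξ : ℂ) + b * I ≠ 0 := by
    intro h; have := congrArg im h; simp at this; exact hb.ne' this
  have h3 : ((1 + (ξ / b) ^ 2 : ℝ) : ℂ) ≠ 0 := by
    have : (0 : ℝ) < 1 + (ξ / b) ^ 2 := by positivity
    exact_mod_cast this.ne'
  have h4 : ((ξ : ℂ) + (-b : ℝ) * I) * (ξ + b * I) = b ^ 2 * ((1 + (ξ / b) ^ 2 : ℝ) : ℂ) := by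
    push_cast
    field_simp
    linear_combination (-(b : ℂ) ^ 2) * I_sq
  rw [div_sub_div _ _ h1 h2, h4, ofReal_inv]
  push_cast at h3 ⊢
  field_simp
  ring

theorem integrable_inv_sub_inv {b : ℝ} (hb : 0 < b) :
    Integrable fun ξ : ℝ => 1 / ((ξ : ℂ) + (-b : ℝ) * I) - 1 / (ξ + b * I) := by
  simp_rw [inv_sub_inv_eq hb]
  exact ((integrable_inv_one_add_sq.comp_div hb.ne').ofReal).const_mul _

theorem integral_inv_sub_inv {b : ℝ} (hb : 0 < b) :
    ∫ ξ : ℝ, (1 / ((ξ : ℂ) + (-b : ℝ) * I) - 1 / (ξ + b * I)) = 2 * Real.pi * I := by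
  simp_rw [inv_sub_inv_eq hb]
  rw [integral_const_mul, integral_complex_ofReal,
    Measure.integral_comp_div (fun x : ℝ => (1 + x ^ 2)⁻¹) b, integral_univ_inv_one_add_sq,
    abs_of_pos hb, smul_eq_mul]
  have hbc : (b : ℂ) ≠ 0 := by exact_mod_cast hb.ne'
  push_cast
  field_simp

set_option maxHeartbeats 1000000 in
/-- Moving the path of integration across the pole at `n`. -/
theorem siegelIntegral_sub_half (n : ℤ) {φ : ℂ → ℂ} {U : Set ℂ} (hU : IsOpen U)
    (hsub : ∀ ζ ∈ unitStrip, stripPoint n ζ ∈ U) (hφ : DifferentiableOn ℂ φ U) {A : ℝ}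
    (hA : 0 ≤ A) (hb : ∀ ζ ∈ unitStrip, ‖φ (stripPoint n ζ)‖ ≤ A * Real.exp (‖ζ‖ ^ 2)) :
    siegelIntegral φ (n - 1 / 2) - siegelIntegral φ (n + 1 / 2) = φ n := by
  set b : ℝ := √2 / 4 with hbdef
  have hb0 : 0 < b := by positivity
  obtain ⟨B, hB0, hB⟩ := exists_norm_mul_siegelKernel_stripPoint_le n hA
  set ω := exp (Real.pi * I / 4) with hω
  have hω0 : ω ≠ 0 := exp_ne_zero _
  set f : ℂ → ℂ := fun ζ => φ (stripPoint n ζ) * siegelKernel (stripPoint n ζ) * (-ω) with hf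
  have hfb : ∀ ζ ∈ unitStrip, 1 ≤ ‖sinDenom (stripPoint n ζ)‖ →
      ‖f ζ‖ ≤ B * Real.exp (-1 * ζ.re ^ 2) := fun ζ hζ hd => hB ζ _ hζ hd (hb ζ hζ)
  set D : ℂ → ℂ := fun ζ => sinDenom (stripPoint n ζ) with hD
  have hDd : Differentiable ℂ D := differentiable_sinDenom.comp (differentiable_stripPoint n)
  have hP0 : stripPoint n 0 = n := by simp [stripPoint]
  have hD0 : D 0 = 0 := by simp only [hD, hP0, sinDenom_intCast]
  -- Splitting off the simple zero, `D ζ = ζ E ζ` with `E` zero-free on the strip, so the integrand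
  -- is `q ζ / ζ` with `q` holomorphic near the strip.
  set E := dslope D 0 with hE
  have hEd : Differentiable ℂ E := differentiableOn_univ.1
    ((Complex.differentiableOn_dslope Filter.univ_mem).2 hDd.differentiableOn)
  have hDE : ∀ ζ, ζ * E ζ = D ζ := by
    intro ζ
    have := sub_smul_dslope D 0 ζ
    simpa [hD0] using this
  have hen : exp (-(Real.pi * I * n)) = exp (Real.pi * I * n) := by
    have := sinDenom_intCast n
    rw [sinDenom, sub_eq_zero] at this
    exact this.symm
  have hE0 : E 0 = -ω * (2 * Real.pi * I * exp (Real.pi * I * n)) := by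
    rw [hE, dslope_same]
    have h1 : HasDerivAt (stripPoint n) (-ω) 0 := by
      unfold stripPoint
      simpa using ((hasDerivAt_id (0 : ℂ)).const_mul ω).const_sub (n : ℂ)
    have h2 := HasDerivAt.comp (0 : ℂ) (hasDerivAt_sinDenom (stripPoint n 0)) h1
    have h3 : deriv D 0 = _ := h2.deriv
    rw [h3, hP0, hen]
    ring
  have hπ : (Real.pi : ℂ) ≠ 0 := by exact_mod_cast Real.pi_ne_zero
  have hE0' : E 0 ≠ 0 := by
    rw [hE0]
    exact mul_ne_zero (neg_ne_zero.2 hω0)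
      (mul_ne_zero (mul_ne_zero (mul_ne_zero two_ne_zero hπ) I_ne_zero) (exp_ne_zero _))
  set V : Set ℂ := stripPoint n ⁻¹' U ∩ E ⁻¹' {0}ᶜ with hV
  have hVo : IsOpen V := (hU.preimage (differentiable_stripPoint n).continuous).inter
    (isOpen_compl_singleton.preimage hEd.continuous)
  have hSV : ∀ ζ ∈ unitStrip, ζ ∈ V := by
    intro ζ hζ
    refine ⟨hsub ζ hζ, ?_⟩
    change E ζ ≠ 0
    by_cases h0 : ζ = 0
    · rw [h0]; exact hE0'
    · intro h
      apply sinDenom_stripPoint_ne_zero n hζ h0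
      change D ζ = 0
      rw [← hDE, h, mul_zero]
  have h0S : (0 : ℂ) ∈ unitStrip := by
    change |(0 : ℂ).im| ≤ √2 / 4
    simp
    positivity
  set q : ℂ → ℂ := fun ζ => φ (stripPoint n ζ) * exp (Real.pi * I * stripPoint n ζ ^ 2) * (-ω) / E ζ
    with hq
  have hqd : DifferentiableOn ℂ q V := by
    have h1 : DifferentiableOn ℂ (fun ζ => φ (stripPoint n ζ)) V :=
      hφ.comp (differentiable_stripPoint n).differentiableOn (fun ζ hζ => hζ.1)
    have h2 : Differentiable ℂ fun ζ => exp (Real.pi * I * stripPoint n ζ ^ 2) :=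
      (((differentiable_stripPoint n).pow 2).const_mul _).cexp
    exact ((h1.mul h2.differentiableOn).mul_const _).div hEd.differentiableOn (fun ζ hζ => hζ.2)
  have hq0 : q 0 = φ n / (2 * Real.pi * I) := by
    simp only [hq, hP0, exp_pi_mul_I_mul_int_sq, hE0]
    have := exp_ne_zero (Real.pi * I * n)
    have := I_ne_zero
    field_simp
  -- The integrand becomes `r + q 0 / ζ`: Cauchy's theorem on rectangles handles `r`, and the polar
  -- part is integrated explicitly.
  set r := dslope q 0 with hr
  have hrd : DifferentiableOn ℂ r V :=
    (Complex.differentiableOn_dslope (hVo.mem_nhds (hSV 0 h0S))).2 hqd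
  have hrf : ∀ ζ, ζ ≠ 0 → f ζ = r ζ + q 0 * (1 / ζ) := by
    intro ζ h0
    have h1 := sub_smul_dslope q 0 ζ
    rw [sub_zero, smul_eq_mul] at h1
    have h2 : f ζ = q ζ / ζ := by
      simp only [hf, hq, siegelKernel]
      rw [div_div, mul_comm (E ζ), hDE]
      ring
    rw [h2]
    have h3 : q ζ = ζ * r ζ + q 0 := by rw [hr, h1]; ring
    rw [h3]
    field_simp
  have hline : ∀ (c : ℝ), |c| ≤ √2 / 4 → ∀ ξ : ℝ, (ξ : ℂ) + (c : ℝ) * I ∈ unitStrip := by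
    intro c hc ξ
    change |((ξ : ℂ) + (c : ℝ) * I).im| ≤ √2 / 4
    simpa using hc
  have hbb : |b| ≤ √2 / 4 := (abs_of_pos hb0).le
  have hbb' : |-b| ≤ √2 / 4 := by rw [abs_neg]; exact hbb
  have hne : ∀ c : ℝ, c ≠ 0 → ∀ ξ : ℝ, (ξ : ℂ) + (c : ℝ) * I ≠ 0 := by
    intro c hc ξ h
    have := congrArg im h
    simp at this
    exact hc this
  have hrc : ∀ c : ℝ, |c| ≤ √2 / 4 → Continuous fun ξ : ℝ => r (ξ + (c : ℝ) * I) := by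
    intro c hc
    exact hrd.continuousOn.comp_continuous (by fun_prop) (fun ξ => hSV _ (hline c hc ξ))
  have hfc : ∀ c : ℝ, |c| ≤ √2 / 4 → c ≠ 0 → Continuous fun ξ : ℝ => f (ξ + (c : ℝ) * I) := by
    intro c hc hc0
    simp_rw [hrf _ (hne c hc0 _)]
    refine (hrc c hc).add (continuous_const.mul (continuous_const.div (by fun_prop) (hne c hc0)))
  have hfi : ∀ c : ℝ, |c| ≤ √2 / 4 → c ≠ 0 →
      (∀ ξ : ℝ, 1 ≤ ‖sinDenom (stripPoint n (ξ + (c : ℝ) * I))‖) →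
      Integrable fun ξ : ℝ => f (ξ + (c : ℝ) * I) := by
    intro c hc hc0 hd
    refine (integrable_gaussian B).mono' (hfc c hc hc0).aestronglyMeasurable
      (Eventually.of_forall fun ξ => ?_)
    have := hfb _ (hline c hc ξ) (hd ξ)
    simpa using this
  have hfi1 := hfi b hbb hb0.ne' (one_le_norm_sinDenom_stripPoint_add n)
  have hfi2 := hfi (-b) hbb' (neg_ne_zero.2 hb0.ne') (one_le_norm_sinDenom_stripPoint_sub n)
  have hJ1 : siegelIntegral φ (n + 1 / 2) = ∫ ξ : ℝ, f (ξ + (b : ℝ) * I) := by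
    rw [siegelIntegral_eq_strip]
    have : √2 / 2 * (1 / 2) = b := by rw [hbdef]; ring
    rw [this]
  have hJ2 : siegelIntegral φ (n - 1 / 2) = ∫ ξ : ℝ, f (ξ + (-b : ℝ) * I) := by
    have e : (n : ℝ) - 1 / 2 = n + (-(1 / 2)) := by ring
    rw [e, siegelIntegral_eq_strip]
    have : √2 / 2 * (-(1 / 2)) = -b := by rw [hbdef]; ring
    rw [this]
  set Vr : ℝ → ℂ := fun T => ∫ y : ℝ in (-b)..b, r ((T : ℝ) + y * I) with hVr
  have hrect : ∀ T : ℝ, 1 ≤ T →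
      (∫ ξ in (-T)..T, f (ξ + (-b : ℝ) * I)) - (∫ ξ in (-T)..T, f (ξ + (b : ℝ) * I)) =
        q 0 * (∫ ξ in (-T)..T, (1 / ((ξ : ℂ) + (-b : ℝ) * I) - 1 / (ξ + b * I))) -
          I * Vr T + I * Vr (-T) := by
    intro T hT
    have h1 := Complex.integral_boundary_rect_eq_zero_of_differentiableOn r
      ⟨-T, -b⟩ ⟨T, b⟩ (hrd.mono ?_)
    · simp only [smul_eq_mul] at h1
      rw [intervalIntegral.integral_congr (fun ξ _ => hrf _ (hne (-b) (neg_ne_zero.2 hb0.ne') ξ)),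
        intervalIntegral.integral_congr (g := fun ξ : ℝ => r (ξ + (b : ℝ) * I) +
          q 0 * (1 / (ξ + (b : ℝ) * I))) (fun ξ _ => hrf _ (hne b hb0.ne' ξ)),
        intervalIntegral.integral_add, intervalIntegral.integral_add,
        intervalIntegral.integral_const_mul, intervalIntegral.integral_const_mul,
        intervalIntegral.integral_sub]
      · simp only [hVr]
        linear_combination h1
      all_goals apply Continuous.intervalIntegrable
      · exact continuous_const.div (by fun_prop) (hne (-b) (neg_ne_zero.2 hb0.ne'))
      · exact continuous_const.div (by fun_prop) (hne b hb0.ne')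
      · exact hrc b hbb
      · exact continuous_const.mul (continuous_const.div (by fun_prop) (hne b hb0.ne'))
      · exact hrc (-b) hbb'
      · exact continuous_const.mul
          (continuous_const.div (by fun_prop) (hne (-b) (neg_ne_zero.2 hb0.ne')))
    · intro ζ hζ
      apply hSV
      have h2 : ζ.im ∈ Set.uIcc (-b) b := hζ.2
      rw [Set.uIcc_of_le (by linarith)] at h2
      exact abs_le.2 h2
  -- On the vertical sides `r` is the Gaussian-small integrand minus `q 0 / ζ`, and both tend to
  -- `0`.
  have hVt : ∀ σ : ℝ, |σ| = 1 → Tendsto (fun T : ℝ => Vr (σ * T)) atTop (𝓝 0) := by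
    intro σ hσ
    have hlim : Tendsto (fun T : ℝ => (B * Real.exp (-T) + ‖q 0‖ * T⁻¹) * |b - -b|) atTop
        (𝓝 0) := by
      have h1 := (Real.tendsto_exp_neg_atTop_nhds_zero.const_mul B).add
        (tendsto_inv_atTop_zero.const_mul ‖q 0‖)
      simpa using h1.mul_const |b - -b|
    refine squeeze_zero_norm' ?_ hlim
    filter_upwards [eventually_ge_atTop 1] with T hT
    apply intervalIntegral.norm_integral_le_of_norm_le_const
    intro y hy
    rw [Set.uIoc_of_le (by linarith)] at hy
    have hmem : ((σ * T : ℝ) : ℂ) + y * I ∈ unitStrip :=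
      hline y (abs_le.2 ⟨hy.1.le, hy.2⟩) (σ * T)
    have hre : (((σ * T : ℝ) : ℂ) + y * I).re = σ * T := by simp
    have habs : |σ * T| = T := by rw [abs_mul, hσ, one_mul, abs_of_pos (by linarith)]
    have hn : T ≤ ‖((σ * T : ℝ) : ℂ) + y * I‖ := by
      have := abs_re_le_norm (((σ * T : ℝ) : ℂ) + y * I)
      rwa [hre, habs] at this
    have hz0 : ((σ * T : ℝ) : ℂ) + y * I ≠ 0 := norm_pos_iff.1 (by linarith)
    have h1 := hfb _ hmem (one_le_norm_sinDenom_stripPoint_of_re n hmem (by rw [hre, habs]; exact hT))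
    have h2 : r (((σ * T : ℝ) : ℂ) + y * I) = f (((σ * T : ℝ) : ℂ) + y * I) -
        q 0 * (1 / (((σ * T : ℝ) : ℂ) + y * I)) := by rw [hrf _ hz0]; ring
    rw [h2]
    refine (norm_sub_le _ _).trans (add_le_add (h1.trans ?_) ?_)
    · apply mul_le_mul_of_nonneg_left _ hB0
      apply Real.exp_le_exp.2
      rw [hre, ← sq_abs, habs]
      nlinarith
    · rw [norm_mul, one_div, norm_inv]
      exact mul_le_mul_of_nonneg_left (inv_anti₀ (by linarith) hn) (norm_nonneg _)
  have hV1 := hVt 1 (by simp)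
  have hV2 := hVt (-1) (by simp)
  simp only [one_mul, neg_one_mul] at hV1 hV2
  have hL := (intervalIntegral_tendsto_integral hfi2 tendsto_neg_atTop_atBot tendsto_id).sub
    (intervalIntegral_tendsto_integral hfi1 tendsto_neg_atTop_atBot tendsto_id)
  have hR := (((intervalIntegral_tendsto_integral (integrable_inv_sub_inv hb0)
    tendsto_neg_atTop_atBot tendsto_id).const_mul (q 0)).sub (hV1.const_mul I)).add
    (hV2.const_mul I)
  rw [integral_inv_sub_inv hb0, mul_zero, sub_zero, add_zero] at hR
  have hfinal := tendsto_nhds_unique (hL.congr' (by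
    filter_upwards [eventually_ge_atTop 1] with T hT using hrect T hT)) hR
  rw [hJ1, hJ2, hfinal, hq0]
  have := I_ne_zero
  field_simp

/-! ### Values at the even non-positive integers; behaviour in a right sector -/

theorem slopeLine_neg (c u : ℝ) : slopeLine (-c) (-u) = -slopeLine c u := by
  simp [slopeLine]; ring

theorem siegelKernel_neg (x : ℂ) : siegelKernel (-x) = -siegelKernel x := by
  have : sinDenom (-x) = -sinDenom x := by simp [sinDenom]
  rw [siegelKernel, this, siegelKernel, neg_sq, div_neg]

theorem siegelIntegral_neg {φ : ℂ → ℂ} (hφ : ∀ x, φ (-x) = φ x) (c : ℝ) :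
    siegelIntegral φ (-c) = -siegelIntegral φ c := by
  rw [siegelIntegral, ← integral_neg_eq_self, siegelIntegral, ← integral_neg]
  congr 1
  ext u
  rw [slopeLine_neg, siegelKernel_neg, hφ]
  ring

/-- The kernel is odd, so for an even power the integrals over the lines through `-1/2` and `1/2`
are opposite; their difference, the residue term at `0`, is therefore `-2R`. -/
theorem riemannR_neg_two_mul (k : ℕ) : riemannR (-(2 * k)) = -(0 ^ (2 * k)) / 2 := by
  have h := siegelIntegral_sub_half 0 (φ := fun x => x ^ (2 * k)) isOpen_univ
    (fun _ _ => Set.mem_univ _) (by fun_prop) (A := k.factorial) (by positivity) (by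
      intro ζ _
      have h1 : ‖stripPoint 0 ζ‖ = ‖ζ‖ := by
        simp [stripPoint, norm_exp_pi_mul_I_div_four]
      rw [norm_pow, h1, pow_mul]
      have := Real.pow_div_factorial_le_exp (‖ζ‖ ^ 2) (by positivity) k
      rw [div_le_iff₀ (by positivity)] at this
      linarith)
  have h2 : siegelIntegral (fun x => x ^ (2 * k)) (1 / 2) = riemannR (-(2 * k)) := by
    rw [riemannR_eq_siegelIntegral]
    congr 1
    ext x
    rw [neg_neg, ← cpow_natCast]
    push_cast
    rfl
  simp only [Int.cast_zero, zero_sub, zero_add] at h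
  rw [siegelIntegral_neg (fun x => by rw [pow_mul, neg_sq, ← pow_mul]), h2] at h
  linear_combination -h / 2

theorem riemannR_zero : riemannR 0 = -1 / 2 := by
  have := riemannR_neg_two_mul 0
  simpa using this

theorem riemannR_neg_two_mul_succ (k : ℕ) : riemannR (-(2 * (k + 1))) = 0 := by
  have := riemannR_neg_two_mul (k + 1)
  rw [zero_pow (by positivity)] at this
  simpa using this

theorem half_le_re_sub_im_stripPoint_one {ζ : ℂ} (hζ : ζ ∈ unitStrip) :
    1 / 2 ≤ (stripPoint 1 ζ).re - (stripPoint 1 ζ).im := by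
  rw [stripPoint_re, stripPoint_im]
  have h4 : |ζ.im| ≤ √2 / 4 := hζ
  have h : √2 * √2 = 2 := Real.mul_self_sqrt (by norm_num)
  have := (abs_le.1 h4).1
  have h5 := mul_le_mul_of_nonneg_left this (Real.sqrt_nonneg 2)
  push_cast
  nlinarith

theorem stripPoint_one_mem_slitPlane {ζ : ℂ} (hζ : ζ ∈ unitStrip) :
    stripPoint 1 ζ ∈ slitPlane := by
  have := half_le_re_sub_im_stripPoint_one hζ
  rw [mem_slitPlane_iff]
  by_contra h
  push Not at h
  rw [h.2] at this
  linarith [h.1]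

theorem third_le_norm_stripPoint_one {ζ : ℂ} (hζ : ζ ∈ unitStrip) :
    1 / 3 ≤ ‖stripPoint 1 ζ‖ := by
  have := half_le_re_sub_im_stripPoint_one hζ
  have h1 : ‖stripPoint 1 ζ‖ ^ 2 = _ := Complex.sq_norm _
  rw [normSq_apply] at h1
  have := norm_nonneg (stripPoint 1 ζ)
  nlinarith [sq_nonneg ((stripPoint 1 ζ).re + (stripPoint 1 ζ).im)]

/-- The pole at `1` contributes `1^(-s) = 1`. The new line stays at distance greater than `1` from
the origin, which makes the remaining integral small to the right. -/
theorem riemannR_eq_one_add (s : ℂ) :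
    riemannR s = 1 + siegelIntegral (fun x => x ^ (-s)) (3 / 2) := by
  have h := siegelIntegral_sub_half 1 (φ := fun x => x ^ (-s)) isOpen_slitPlane
    (fun ζ hζ => stripPoint_one_mem_slitPlane hζ)
    (fun x hx => (differentiableAt_id.cpow_const hx).differentiableWithinAt)
    (A := Real.exp (max (-s.re) 0 / 2 * Real.log (2 + ‖s‖) + 6 * ‖s‖) * Real.exp 1)
    (by positivity) (by
      intro ζ hζ
      refine (norm_cpow_neg_le (third_le_norm_stripPoint_one hζ) s).trans ?_
      rw [mul_assoc, ← Real.exp_add 1]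
      refine mul_le_mul_of_nonneg_left (Real.exp_le_exp.2 ?_) (by positivity)
      have : ‖stripPoint 1 ζ‖ ≤ 1 + ‖ζ‖ := by
        rw [stripPoint]
        refine (norm_sub_le _ _).trans ?_
        simp [norm_exp_pi_mul_I_div_four]
      nlinarith [sq_nonneg (1 - ‖ζ‖), norm_nonneg (stripPoint 1 ζ), norm_nonneg ζ])
  rw [riemannR_eq_siegelIntegral]
  norm_num at h
  rw [← h]
  ring_nf

theorem norm_cpow_neg_slopeLine_le {s : ℂ} (hs : 200 * |s.im| ≤ s.re) (u : ℝ) :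
    ‖slopeLine (3 / 2) u ^ (-s)‖ ≤ Real.exp (-s.re / 30) := by
  have h0 := half_le_norm_slopeLine (c := 3 / 2) u
  set x := slopeLine (3 / 2) u
  have hx0 : 0 < ‖x‖ := by
    by_contra h
    have : ‖x‖ = 0 := le_antisymm (not_lt.1 h) (norm_nonneg _)
    rw [this] at h0
    norm_num at h0
  rw [norm_cpow_of_ne_zero (norm_pos_iff.1 hx0), div_eq_mul_inv, ← Real.exp_neg,
    Real.rpow_def_of_pos hx0, ← Real.exp_add]
  apply Real.exp_le_exp.2
  have hs0 : 0 ≤ s.re := le_trans (by positivity) hs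
  have h1 : -(arg x * (-s).im) ≤ 4 * |s.im| := by
    have ha := abs_arg_le_pi x
    have : -(arg x * (-s).im) ≤ |arg x| * |s.im| := by
      rw [← abs_mul]; simp only [neg_im, mul_neg, neg_neg]; exact le_abs_self _
    have h3 : |arg x| * |s.im| ≤ 4 * |s.im| := by
      gcongr
      linarith [Real.pi_lt_d2]
    linarith
  -- From `|x|² ≥ 9/8`. The argument of `x` costs at most `4 |Im s| ≤ Re s / 50`, and `1/18 - 1/50 >
  -- 1/30`.
  have h2 : 1 / 18 ≤ Real.log ‖x‖ := by
    have h3 := Real.one_sub_inv_le_log_of_pos (x := ‖x‖ ^ 2) (by positivity)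
    rw [Real.log_pow] at h3
    have h4 : (‖x‖ ^ 2)⁻¹ ≤ ((3 / 2) ^ 2 / 2)⁻¹ := inv_anti₀ (by norm_num) h0
    norm_num at h4 h3
    linarith
  rw [neg_re] at *
  nlinarith

theorem exists_riemannR_sector : ∃ r₀ : ℝ, ∀ s : ℂ, r₀ ≤ s.re → 200 * |s.im| ≤ s.re →
    1 / 2 ≤ ‖riemannR s‖ ∧ ‖riemannR s‖ ≤ 2 := by
  set G := ∫ u : ℝ, Real.exp 10 * Real.exp (-1 * u ^ 2) with hG
  have hG0 : 0 ≤ G := integral_nonneg fun u => by positivity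
  refine ⟨60 * (G + 1), fun s hs hK => ?_⟩
  have hJ : ‖siegelIntegral (fun x => x ^ (-s)) (3 / 2)‖ ≤ 1 / 2 := by
    have h1 : ∀ u : ℝ, ‖slopeLine (3 / 2) u ^ (-s) * siegelKernel (slopeLine (3 / 2) u) *
        (-exp (Real.pi * I / 4))‖ ≤
        Real.exp (-s.re / 30) * Real.exp 10 * Real.exp (-1 * u ^ 2) := by
      intro u
      have := norm_mul_siegelKernel_le (n := 1) (u := u) (a := slopeLine (3 / 2) u ^ (-s))
        (A := Real.exp (-s.re / 30)) (by norm_num [abs_le]) (by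
          refine (norm_cpow_neg_slopeLine_le hK u).trans ?_
          apply le_mul_of_one_le_right (Real.exp_pos _).le
          apply Real.one_le_exp
          positivity) (by positivity)
      norm_num at this ⊢
      exact this
    have h2 := norm_integral_le_of_norm_le (integrable_gaussian _) (Eventually.of_forall h1)
    refine h2.trans ?_
    have e : ∫ u : ℝ, Real.exp (-s.re / 30) * Real.exp 10 * Real.exp (-1 * u ^ 2) =
        Real.exp (-s.re / 30) * G := by
      rw [hG, ← integral_const_mul]
      congr 1; ext u; ring
    rw [e]
    have h3 : 2 * G ≤ Real.exp (s.re / 30) := by linarith [Real.add_one_le_exp (s.re / 30)]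
    have h4 : Real.exp (-s.re / 30) * Real.exp (s.re / 30) = 1 := by
      rw [← Real.exp_add, neg_div, neg_add_cancel, Real.exp_zero]
    nlinarith [Real.exp_pos (-s.re / 30)]
  rw [riemannR_eq_one_add]
  set J := siegelIntegral (fun x => x ^ (-s)) (3 / 2)
  have h1 := norm_add_le 1 J
  have h2 := norm_sub_le (1 + J) J
  rw [add_sub_cancel_right] at h2
  rw [norm_one] at h1 h2
  constructor <;> linarith

/-! ### The generating function of `R(-m)` against a Gaussian -/

theorem riemannR_neg_natCast (m : ℕ) :
    riemannR (-m) = siegelIntegral (fun x => x ^ m) (1 / 2) := by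
  rw [riemannR_eq_siegelIntegral]
  congr 1
  ext x
  rw [neg_neg, cpow_natCast]

theorem norm_exp_mul_le (w x : ℂ) : Real.exp (‖w‖ * ‖x‖) ≤
    Real.exp (‖w‖ ^ 2 / 2) * Real.exp (‖x‖ ^ 2 / 2) := by
  rw [← Real.exp_add]
  apply Real.exp_le_exp.2
  nlinarith [sq_nonneg (‖w‖ - ‖x‖)]

theorem norm_mul_kernel_half_le (w : ℂ) {a : ℂ} {u : ℝ}
    (ha : ‖a‖ ≤ Real.exp (‖w‖ * ‖slopeLine (1 / 2) u‖)) :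
    ‖a * siegelKernel (slopeLine (1 / 2) u) * (-exp (Real.pi * I / 4))‖ ≤
      Real.exp (‖w‖ ^ 2 / 2) * Real.exp 10 * Real.exp (-1 * u ^ 2) := by
  have := norm_mul_siegelKernel_le (n := 0) (u := u) (a := a) (A := Real.exp (‖w‖ ^ 2 / 2))
    (by norm_num [abs_le]) (by simpa using ha.trans (norm_exp_mul_le w _)) (by positivity)
  simpa using this

theorem continuous_kernel_half : Continuous fun u => siegelKernel (slopeLine (1 / 2) u) := by
  simpa using continuous_siegelKernel_slopeLine 0

theorem integrable_exp_mul_kernel (w : ℂ) : Integrable fun u : ℝ =>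
    exp (w * slopeLine (1 / 2) u) * siegelKernel (slopeLine (1 / 2) u) *
      (-exp (Real.pi * I / 4)) := by
  have h1 := continuous_kernel_half
  have h2 := continuous_slopeLine (1 / 2)
  refine (integrable_gaussian _).mono' (by fun_prop : Continuous _).aestronglyMeasurable
    (Eventually.of_forall fun u => norm_mul_kernel_half_le w ?_)
  rw [← norm_mul]
  exact norm_exp_le_exp_norm _

/-- The generating function of the values of `R` at the non-positive integers. -/
theorem hasSum_siegelIntegral_exp (w : ℂ) :
    HasSum (fun m : ℕ => w ^ m / m.factorial * riemannR (-m))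
      (siegelIntegral (fun x => exp (w * x)) (1 / 2)) := by
  have h1 := continuous_kernel_half
  have h2 := continuous_slopeLine (1 / 2)
  let K : ℝ → ℂ := fun u => siegelKernel (slopeLine (1 / 2) u) * (-exp (Real.pi * I / 4))
  have hK : Continuous K := by fun_prop
  have hreal : ∀ u, HasSum (fun m : ℕ => (‖w‖ * ‖slopeLine (1 / 2) u‖) ^ m / m.factorial * ‖K u‖)
      (Real.exp (‖w‖ * ‖slopeLine (1 / 2) u‖) * ‖K u‖) := by
    intro u
    have := NormedSpace.expSeries_div_hasSum_exp (‖w‖ * ‖slopeLine (1 / 2) u‖)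
    rw [← Real.exp_eq_exp_ℝ] at this
    exact this.mul_right _
  have h := hasSum_integral_of_dominated_convergence (μ := volume)
    (F := fun (m : ℕ) (u : ℝ) => (w * slopeLine (1 / 2) u) ^ m / m.factorial * K u)
    (f := fun u => exp (w * slopeLine (1 / 2) u) * K u)
    (fun m u => (‖w‖ * ‖slopeLine (1 / 2) u‖) ^ m / m.factorial * ‖K u‖)
    (fun m => (by fun_prop : Continuous _).aestronglyMeasurable)
    (fun m => Eventually.of_forall fun u => by
      rw [norm_mul, norm_div, norm_pow, norm_mul, Complex.norm_natCast])
    (Eventually.of_forall fun u => (hreal u).summable) ?_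
    (Eventually.of_forall fun u => ?_)
  · have e1 : (fun m : ℕ => w ^ m / m.factorial * riemannR (-m)) =
        fun m : ℕ => ∫ u, (w * slopeLine (1 / 2) u) ^ m / m.factorial * K u := by
      funext m
      rw [riemannR_neg_natCast, siegelIntegral, ← integral_const_mul]
      congr 1
      ext u
      simp only [K]
      rw [mul_pow]
      ring
    have e2 : siegelIntegral (fun x => exp (w * x)) (1 / 2) =
        ∫ u, exp (w * slopeLine (1 / 2) u) * K u := by
      rw [siegelIntegral]
      congr 1
      ext u
      simp only [K, mul_assoc]
    rw [e1, e2]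
    exact h
  · simp_rw [(hreal _).tsum_eq]
    refine (integrable_gaussian (Real.exp (‖w‖ ^ 2 / 2) * Real.exp 10)).mono' (by fun_prop : Continuous _).aestronglyMeasurable
      (Eventually.of_forall fun u => ?_)
    have := norm_mul_kernel_half_le w (a := (Real.exp (‖w‖ * ‖slopeLine (1 / 2) u‖) : ℂ)) (u := u)
      (by rw [norm_real, Real.norm_of_nonneg (Real.exp_pos _).le])
    refine le_trans (le_of_eq ?_) this
    simp only [K]
    rw [mul_assoc, norm_mul, norm_mul (ofReal _), norm_real, norm_norm]
  · have := NormedSpace.expSeries_div_hasSum_exp (w * slopeLine (1 / 2) u)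
    rw [← Complex.exp_eq_exp_ℂ] at this
    exact this.mul_right _

/-- The difference of the exponentials is `e^(2πiwx)` times the denominator of the kernel; the
denominator cancels and a pure Gaussian integral is left. -/
theorem siegelIntegral_exp_sub (w : ℂ) :
    siegelIntegral (fun x => exp (2 * Real.pi * I * (w + 1 / 2) * x)) (1 / 2) -
      siegelIntegral (fun x => exp (2 * Real.pi * I * (w - 1 / 2) * x)) (1 / 2) =
      -exp (Real.pi * I / 4) * exp (-(Real.pi * I * w ^ 2)) := by
  rw [siegelIntegral, siegelIntegral, ← integral_sub (integrable_exp_mul_kernel _)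
    (integrable_exp_mul_kernel _)]
  set ω := exp (Real.pi * I / 4) with hω
  have hω2 : ω ^ 2 = I := exp_pi_mul_I_div_four_sq
  have hq := integral_cexp_quadratic (b := -Real.pi) (by simpa using Real.pi_pos)
    (-(Real.pi * I * ω * (1 + 2 * w))) (Real.pi * I * (1 / 4 + w))
  have hπ : (Real.pi : ℂ) ≠ 0 := by exact_mod_cast Real.pi_ne_zero
  have e1 : (Real.pi * I * (1 / 4 + w) - (-(Real.pi * I * ω * (1 + 2 * w))) ^ 2 / (4 * -Real.pi) : ℂ)
      = -(Real.pi * I * w ^ 2) := by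
    field_simp
    linear_combination (I * (1 + 2 * w) ^ 2) * hω2 + (1 + 2 * w) ^ 2 * I_sq
  rw [e1, neg_neg, div_self hπ, one_cpow, one_mul] at hq
  rw [← hq, ← integral_const_mul]
  congr 1
  ext u
  have hd : sinDenom (slopeLine (1 / 2) u) ≠ 0 := by
    intro h
    have := one_le_norm_sinDenom_slopeLine 0 u
    norm_num at this
    rw [h, norm_zero] at this
    linarith
  set x := slopeLine (1 / 2) u with hx
  have e2 : exp (2 * Real.pi * I * (w + 1 / 2) * x) - exp (2 * Real.pi * I * (w - 1 / 2) * x) =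
      exp (2 * Real.pi * I * w * x) * sinDenom x := by
    rw [sinDenom, mul_sub (exp _), ← exp_add, ← exp_add]
    congr 2 <;> ring
  have e3 : exp (2 * Real.pi * I * w * x) * exp (Real.pi * I * x ^ 2) =
      exp (-Real.pi * u ^ 2 + -(Real.pi * I * ω * (1 + 2 * w)) * u + Real.pi * I * (1 / 4 + w)) := by
    rw [← exp_add]
    congr 1
    rw [hx, slopeLine, ← hω]
    push_cast
    linear_combination (Real.pi * I * u ^ 2) * hω2 + (Real.pi * u ^ 2) * I_sq
  rw [← e3, ← sub_mul, ← sub_mul, e2, siegelKernel]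
  field_simp

/-- An entire series whose coefficients have order `2 - δ` grows more slowly than a Gaussian. -/
theorem norm_moment_term_le {A y : ℝ} (hA : 0 ≤ A) (hy : 1 ≤ y) {w c : ℂ}
    (hw : 2 * Real.pi * ‖w‖ * (2 * Real.exp 1) ≤ y ^ 17) (m : ℕ)
    (hc : ‖c‖ ≤ A * Real.exp (15 / 32 * (m * Real.log m))) :
    ‖(2 * Real.pi * I * w) ^ m / m.factorial * c‖ ≤ A * Real.exp (y ^ 32) * (1 / 2) ^ m := by
  have hπ := Real.pi_pos
  have hn : ‖2 * Real.pi * I * w‖ = 2 * Real.pi * ‖w‖ := by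
    simp [abs_of_pos hπ]
  rw [norm_mul, norm_div, norm_pow, hn, Complex.norm_natCast]
  set v := 2 * Real.pi * ‖w‖ with hv
  have hv0 : 0 ≤ v := by positivity
  rcases Nat.eq_zero_or_pos m with rfl | hm
  · simp at hc ⊢
    refine hc.trans (le_mul_of_one_le_right hA ?_)
    apply Real.one_le_exp
    positivity
  have hm0 : (0 : ℝ) < m := by exact_mod_cast hm
  have hf : Real.exp (m * Real.log m) * Real.exp (-m) ≤ m.factorial := by
    have h1 := Real.pow_div_factorial_le_exp (m : ℝ) hm0.le m
    rw [div_le_iff₀ (by positivity)] at h1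
    have h2 : Real.exp (m * Real.log m) = (m : ℝ) ^ m := by
      rw [mul_comm, ← Real.rpow_def_of_pos hm0, Real.rpow_natCast]
    rw [h2, Real.exp_neg, ← div_eq_mul_inv, div_le_iff₀ (Real.exp_pos _)]
    linarith
  -- The factor `2e` in the hypothesis on `w` pays for the `e^(-m)` in the lower bound for `m!` and
  -- for the geometric weight `(1/2)^m`.
  have hv1 : v ^ m ≤ Real.exp (m * (17 * Real.log y)) * Real.exp (-m) * (1 / 2) ^ m := by
    have h3 : v ≤ Real.exp (17 * Real.log y) * Real.exp (-1) * (1 / 2) := by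
      have h4 : Real.exp (17 * Real.log y) = y ^ 17 := by
        rw [mul_comm, ← Real.rpow_def_of_pos (by linarith)]
        exact_mod_cast Real.rpow_natCast y 17
      rw [h4, Real.exp_neg]
      have := Real.exp_pos 1
      field_simp
      linarith
    calc v ^ m ≤ (Real.exp (17 * Real.log y) * Real.exp (-1) * (1 / 2)) ^ m := by gcongr
      _ = _ := by
        rw [mul_pow, mul_pow, ← Real.exp_nat_mul, ← Real.exp_nat_mul]
        ring_nf
  -- The order is `1 / (1 - 15/32) = 32/17`; writing `|w|` as about `y^17` and the bound as `y^32`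
  -- avoids fractional powers. The maximum over `m` is estimated by `log t ≤ t - 1` at `t = y^32 /
  -- m`.
  have hlog : 17 / 32 * (m * (32 * Real.log y - Real.log m)) ≤ y ^ 32 := by
    have h5 := Real.log_le_sub_one_of_pos (x := y ^ 32 / m) (by positivity)
    rw [Real.log_div (by positivity) hm0.ne', Real.log_pow] at h5
    push_cast at h5
    have h6 : m * (32 * Real.log y - Real.log m) ≤ y ^ 32 := by
      calc _ ≤ m * (y ^ 32 / m) := by gcongr; linarith
        _ = _ := by field_simp
    have : 0 ≤ y ^ 32 := by positivity
    linarith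
  rw [div_mul_eq_mul_div, div_le_iff₀ (by positivity)]
  calc v ^ m * ‖c‖ ≤ (Real.exp (m * (17 * Real.log y)) * Real.exp (-m) * (1 / 2) ^ m) *
        (A * Real.exp (15 / 32 * (m * Real.log m))) := by gcongr
    _ = A * (1 / 2) ^ m * (Real.exp (17 / 32 * (m * (32 * Real.log y - Real.log m))) *
        (Real.exp (m * Real.log m) * Real.exp (-m))) := by
      have : Real.exp (m * (17 * Real.log y)) * Real.exp (15 / 32 * (m * Real.log m)) =
          Real.exp (17 / 32 * (m * (32 * Real.log y - Real.log m))) *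
            Real.exp (m * Real.log m) := by
        rw [← Real.exp_add, ← Real.exp_add]
        congr 1
        ring
      linear_combination (A * (1 / 2) ^ m * Real.exp (-m)) * this
    _ ≤ A * (1 / 2) ^ m * (Real.exp (y ^ 32) * m.factorial) := by gcongr
    _ = _ := by ring

theorem norm_siegelIntegral_exp_le {A y : ℝ} (hA : 0 ≤ A) (hy : 1 ≤ y) {w : ℂ}
    (hw : 2 * Real.pi * ‖w‖ * (2 * Real.exp 1) ≤ y ^ 17)
    (hc : ∀ m : ℕ, ‖riemannR (-m)‖ ≤ A * Real.exp (15 / 32 * (m * Real.log m))) :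
    ‖siegelIntegral (fun x => exp (2 * Real.pi * I * w * x)) (1 / 2)‖ ≤
      2 * (A * Real.exp (y ^ 32)) := by
  rw [← (hasSum_siegelIntegral_exp (2 * Real.pi * I * w)).tsum_eq]
  have h1 := hasSum_geometric_two.mul_left (A * Real.exp (y ^ 32))
  rw [mul_comm (2 : ℝ)]
  exact tsum_of_norm_bounded h1 fun m => norm_moment_term_le hA hy hw m (hc m)

/-- The values of `R` at the negative integers are not too small. -/
theorem not_eventually_norm_riemannR_neg_le :
    ¬ ∀ᶠ m : ℝ in atTop, ‖riemannR (-m)‖ ≤ Real.exp (15 / 32 * (m * Real.log m)) := by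
  intro h
  obtain ⟨A, hA, hc⟩ : ∃ A : ℝ, 1 ≤ A ∧
      ∀ m : ℕ, ‖riemannR (-m)‖ ≤ A * Real.exp (15 / 32 * (m * Real.log m)) := by
    obtain ⟨N, hN⟩ := eventually_atTop.1 (tendsto_natCast_atTop_atTop.eventually h)
    refine ⟨1 + ∑ m ∈ Finset.range N, ‖riemannR (-m)‖, ?_, fun m => ?_⟩
    · have := Finset.sum_nonneg (s := Finset.range N) fun m _ => norm_nonneg (riemannR (-m))
      linarith
    · have h0 := Finset.sum_nonneg (s := Finset.range N) fun m _ => norm_nonneg (riemannR (-m))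
      rcases lt_or_ge m N with hm | hm
      · have h1 := Finset.single_le_sum (s := Finset.range N)
          (fun m _ => norm_nonneg (riemannR (-m))) (Finset.mem_range.2 hm)
        have h2 : 1 ≤ Real.exp (15 / 32 * (m * Real.log m)) := by
          apply Real.one_le_exp
          have := Real.log_natCast_nonneg m
          positivity
        nlinarith
      · have h3 := hN m hm
        push_cast at h3
        nlinarith [Real.exp_pos (15 / 32 * (m * Real.log m))]
  -- Beyond `4A`, so that `e^(y^32) ≤ 4A` is absurd, and at least `100`, so that `r ≥ y^17/80` gives
  -- `πr² ≥ 2y^32`. In `r`, the `40` bounds `4πe` and the `-1` leaves room for the shifts by `1/2`.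
  set y := 4 * A + 100 with hy
  have hy1 : 1 ≤ y := by linarith
  set r := y ^ 17 / 40 - 1 with hr
  set ω := exp (Real.pi * I / 4) with hω
  have hω1 : ‖ω‖ = 1 := norm_exp_pi_mul_I_div_four
  have hpow : y ≤ y ^ 17 := le_self_pow₀ hy1 (by norm_num)
  have hr0 : y ^ 17 / 80 ≤ r := by rw [hr]; linarith
  have hb : ∀ w : ℂ, ‖w‖ ≤ r + 1 → 2 * Real.pi * ‖w‖ * (2 * Real.exp 1) ≤ y ^ 17 := by
    intro w hw
    have h1 : 2 * Real.pi * (2 * Real.exp 1) ≤ 40 := by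
      have := Real.pi_lt_d2
      have := Real.pi_pos
      have := Real.exp_one_lt_d9
      have := Real.exp_pos 1
      nlinarith
    have h2 : ‖w‖ ≤ y ^ 17 / 40 := by rw [hr] at hw; linarith
    calc _ = (2 * Real.pi * (2 * Real.exp 1)) * ‖w‖ := by ring
      _ ≤ 40 * (y ^ 17 / 40) := by gcongr
      _ = _ := by ring
  have hrn : ‖(r : ℂ) * ω‖ = r := by
    rw [norm_mul, hω1, mul_one, norm_real, Real.norm_of_nonneg]
    have : 0 ≤ y ^ 17 := by positivity
    linarith
  have h1 := norm_siegelIntegral_exp_le (w := r * ω + 1 / 2) (zero_le_one.trans hA) hy1 (hb _ (by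
    refine (norm_add_le _ _).trans ?_
    rw [hrn]; norm_num)) hc
  have h2 := norm_siegelIntegral_exp_le (w := r * ω - 1 / 2) (zero_le_one.trans hA) hy1 (hb _ (by
    refine (norm_sub_le _ _).trans ?_
    rw [hrn]; norm_num)) hc
  have h3 := norm_sub_le
    (siegelIntegral (fun x => exp (2 * Real.pi * I * (r * ω + 1 / 2) * x)) (1 / 2))
    (siegelIntegral (fun x => exp (2 * Real.pi * I * (r * ω - 1 / 2) * x)) (1 / 2))
  rw [siegelIntegral_exp_sub, norm_mul, norm_neg, ← hω, hω1, one_mul, Complex.norm_exp] at h3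
  -- Along `ω`, where `ω² = i`, the Gaussian has its fastest growth, `exp (πr²)`.
  have e : (-(Real.pi * I * (r * ω) ^ 2) : ℂ) = ((Real.pi * r ^ 2 : ℝ) : ℂ) := by
    rw [mul_pow, exp_pi_mul_I_div_four_sq]
    push_cast
    linear_combination (-Real.pi * r ^ 2 : ℂ) * I_sq
  rw [e, ofReal_re] at h3
  have h4 : Real.exp (Real.pi * r ^ 2) ≤ 4 * A * Real.exp (y ^ 32) := by linarith
  have h5 : 2 * y ^ 32 ≤ Real.pi * r ^ 2 := by
    have h6 : (y ^ 17 / 80) ^ 2 ≤ r ^ 2 := by gcongr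
    have h7 : (100 : ℝ) ^ 2 ≤ y ^ 2 := by gcongr; linarith
    have h8 : 100 ^ 2 * y ^ 32 ≤ y ^ 2 * y ^ 32 := by gcongr
    have h9 : 3 * r ^ 2 ≤ Real.pi * r ^ 2 := by
      gcongr
      exact Real.pi_gt_three.le
    have h10 : (y ^ 17 / 80) ^ 2 = y ^ 2 * y ^ 32 / 6400 := by ring
    have : 0 ≤ y ^ 32 := by positivity
    linarith
  have h6 : Real.exp (2 * y ^ 32) ≤ 4 * A * Real.exp (y ^ 32) :=
    (Real.exp_le_exp.2 h5).trans h4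
  rw [two_mul, Real.exp_add] at h6
  have h7 : Real.exp (y ^ 32) ≤ 4 * A := le_of_mul_le_mul_right h6 (Real.exp_pos _)
  have h8 : y ≤ y ^ 32 := le_self_pow₀ hy1 (by norm_num)
  have h9 := Real.add_one_le_exp (y ^ 32)
  linarith

/-! ### Zeros arbitrarily far down and up -/

theorem exists_riemannR_zero_im_lt (y₀ : ℝ) : ∃ s : ℂ, s.im < -y₀ ∧ riemannR s = 0 := by
  by_contra! h
  obtain ⟨C, hC, hg⟩ := exists_norm_riemannR_le
  obtain ⟨r₀, hsec⟩ := exists_riemannR_sector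
  exact not_eventually_norm_riemannR_neg_le
    (eventually_norm_neg_nat_le_of_zero_free differentiable_riemannR hC hg (K := 200)
      (by norm_num) hsec (abs_nonneg y₀) fun s hs => h s (by linarith [le_abs_self y₀]))

/-- The conjugate function `s ↦ conj (R (conj s))` has the same growth, the same sector bounds and
the same absolute values at `-m`, so the argument for the lower half-plane applies to it. -/
theorem exists_riemannR_zero_im_gt (y₀ : ℝ) : ∃ s : ℂ, y₀ < s.im ∧ riemannR s = 0 := by
  by_contra! h
  obtain ⟨C, hC, hg⟩ := exists_norm_riemannR_le
  obtain ⟨r₀, hsec⟩ := exists_riemannR_sector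
  have hd : Differentiable ℂ ((starRingEnd ℂ) ∘ riemannR ∘ (starRingEnd ℂ)) := fun s => by
    simpa using (differentiable_riemannR (starRingEnd ℂ s)).conj_conj
  have := eventually_norm_neg_nat_le_of_zero_free hd hC
    (fun s => by simpa using hg (starRingEnd ℂ s)) (K := 200) (r₀ := r₀) (y₀ := |y₀|)
    (by norm_num) (fun s hs hs' => by
      simpa using hsec (starRingEnd ℂ s) (by simpa using hs) (by simpa using hs'))
    (abs_nonneg y₀) (fun s hs h0 => h (starRingEnd ℂ s) (by
      rw [conj_im]
      linarith [le_abs_self y₀]) (by simpa using h0))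
  refine not_eventually_norm_riemannR_neg_le (this.mono fun m hm => ?_)
  simpa using hm

/-! ### The trivial zeros and the Gamma factor -/

/-- The trivial zeros. -/
noncomputable def negEven (k : ℕ) : ℂ := -(2 * (k + 1))

theorem negEven_ne_zero (k : ℕ) : negEven k ≠ 0 := by
  rw [negEven, neg_ne_zero]
  exact mul_ne_zero two_ne_zero (Nat.cast_add_one_ne_zero k)

theorem negEven_injective : Function.Injective negEven := by
  intro a b h
  simp only [negEven, neg_inj] at h
  have := mul_left_cancel₀ two_ne_zero h
  exact_mod_cast add_right_cancel this

theorem riemannR_negEven (k : ℕ) : riemannR (negEven k) = 0 := riemannR_neg_two_mul_succ k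

theorem one_add_half_eq_neg_iff (s : ℂ) (m : ℕ) : 1 + s / 2 = -m ↔ negEven m = s := by
  rw [negEven]
  constructor <;> intro h
  · linear_combination -2 * h
  · rw [← h]; ring

/-- The entire function `1 / Γ(1 + s / 2)`. -/
noncomputable def invGammaHalf (s : ℂ) : ℂ := (Gamma (1 + s / 2))⁻¹

theorem differentiable_invGammaHalf : Differentiable ℂ invGammaHalf :=
  differentiable_one_div_Gamma.comp (by fun_prop : Differentiable ℂ fun s : ℂ => 1 + s / 2)

theorem invGammaHalf_eq_zero_iff (s : ℂ) : invGammaHalf s = 0 ↔ ∃ k, negEven k = s := by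
  simp_rw [invGammaHalf, inv_eq_zero, Gamma_eq_zero_iff, one_add_half_eq_neg_iff]

/-- Differentiating `1/Γ(s) = s/Γ(s+1)` at `-(n+1)` leaves only `s` times the derivative at `-n`,
since `1/Γ(s+1)` vanishes there. -/
theorem deriv_one_div_Gamma_neg_nat_ne_zero (n : ℕ) :
    deriv (fun s : ℂ => (Gamma s)⁻¹) (-n) ≠ 0 := by
  have hd := differentiable_one_div_Gamma
  have hrec : (fun s : ℂ => (Gamma s)⁻¹) = fun s => s * (Gamma (s + 1))⁻¹ :=
    funext one_div_Gamma_eq_self_mul_one_div_Gamma_add_one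
  have hder : ∀ s : ℂ, deriv (fun s : ℂ => (Gamma s)⁻¹) s =
      (Gamma (s + 1))⁻¹ + s * deriv (fun s : ℂ => (Gamma s)⁻¹) (s + 1) := by
    intro s
    have h1 := (hd (s + 1)).hasDerivAt.comp_add_const s 1
    have h2 := (hasDerivAt_id s).mul h1
    rw [one_mul] at h2
    conv_lhs => rw [hrec]
    exact h2.deriv
  induction n with
  | zero => rw [hder]; simp
  | succ n ih =>
    have e : (-((n + 1 : ℕ) : ℂ)) + 1 = -n := by push_cast; ring
    rw [hder, e, Gamma_neg_nat_eq_zero, inv_zero, zero_add]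
    exact mul_ne_zero (neg_ne_zero.2 (Nat.cast_ne_zero.2 n.succ_ne_zero)) ih

theorem analyticOrderAt_invGammaHalf_negEven (k : ℕ) :
    analyticOrderAt invGammaHalf (negEven k) = 1 := by
  refine (differentiable_invGammaHalf.analyticAt _).analyticOrderAt_eq_one_of_zero_deriv_ne_zero
    ((invGammaHalf_eq_zero_iff _).2 ⟨k, rfl⟩) ?_
  have h1 : HasDerivAt (fun s : ℂ => 1 + s / 2) (1 / 2) (negEven k) :=
    ((hasDerivAt_id _).div_const 2).const_add 1
  have h2 := HasDerivAt.comp (negEven k) (differentiable_one_div_Gamma _).hasDerivAt h1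
  have h3 : deriv invGammaHalf (negEven k) = _ := h2.deriv
  rw [h3, (one_add_half_eq_neg_iff _ k).2 rfl]
  exact mul_ne_zero (deriv_one_div_Gamma_neg_nat_ne_zero k) (by norm_num)

theorem listsZeros_invGammaHalf : ListsZeros invGammaHalf negEven := by
  constructor
  · exact fun z => Set.Subsingleton.finite fun a ha b hb =>
      negEven_injective ((show negEven a = z from ha).trans hb.symm)
  · intro z
    by_cases hz : ∃ k, negEven k = z
    · obtain ⟨k, rfl⟩ := hz
      have : {i | negEven i = negEven k} = {k} := by
        ext i; simpa using negEven_injective.eq_iff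
      rw [analyticOrderAt_invGammaHalf_negEven, this, Set.ncard_singleton, Nat.cast_one]
    · have : {i | negEven i = z} = ∅ := by
        ext i; simpa using fun h => hz ⟨i, h⟩
      rw [this, Set.ncard_empty, Nat.cast_zero,
        (differentiable_invGammaHalf.analyticAt z).analyticOrderAt_eq_zero, Ne,
        invGammaHalf_eq_zero_iff]
      exact hz

theorem prod_one_add_div_mul_GammaSeq (z : ℂ) (hz : ∀ m : ℕ, z ≠ -m) (n : ℕ) :
    (∏ k ∈ Finset.range n, (1 + z / (k + 1))) * (z * GammaSeq z n) = (n : ℂ) ^ z := by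
  have h1 : ∏ k ∈ Finset.range n, (1 + z / (k + 1)) =
      (∏ k ∈ Finset.range n, (z + (k + 1))) / n.factorial := by
    rw [← Finset.prod_range_add_one_eq_factorial, Nat.cast_prod, ← Finset.prod_div_distrib]
    refine Finset.prod_congr rfl fun k _ => ?_
    have := Nat.cast_add_one_ne_zero (R := ℂ) k
    push_cast
    field_simp
    ring
  have h2 : ∀ j : ℕ, z + j ≠ 0 := fun j h => hz j (eq_neg_of_add_eq_zero_left h)
  have h3 : ∏ k ∈ Finset.range n, (z + ((k : ℂ) + 1)) ≠ 0 :=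
    Finset.prod_ne_zero_iff.2 fun k _ => by exact_mod_cast h2 (k + 1)
  have h4 : z ≠ 0 := by simpa using h2 0
  have h5 : (n.factorial : ℂ) ≠ 0 := Nat.cast_ne_zero.2 n.factorial_ne_zero
  rw [h1, GammaSeq, Finset.prod_range_succ']
  push_cast
  rw [add_zero]
  field_simp

/-- Weierstrass's product for `1/Γ` at `z = s/2`, from Euler's limit: in the partial products the
convergence factors give the harmonic number, `n^z` gives `log n`, and their difference tends to
`γ`. -/
theorem canonical_negEven (s : ℂ) :
    ∏' k, (1 - s / negEven k) * exp (s / negEven k) =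
      exp (-(Real.eulerMascheroniConstant / 2 * s)) * invGammaHalf s := by
  have hsum : Summable fun k => (‖negEven k‖ ^ 2)⁻¹ := by
    have h1 := ((summable_nat_add_iff 1).2 (Real.summable_nat_pow_inv.2 one_lt_two)).mul_left
      (1 / 4 : ℝ)
    refine h1.congr fun k => ?_
    have : ‖negEven k‖ = 2 * (k + 1) := by
      rw [negEven, norm_neg, norm_mul, ← Nat.cast_add_one, Complex.norm_natCast]
      simp
    rw [this]
    push_cast
    field_simp
    norm_num
  by_cases h0 : ∃ k, negEven k = s
  · rw [(invGammaHalf_eq_zero_iff s).2 h0, mul_zero]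
    obtain ⟨k, rfl⟩ := h0
    exact tprod_of_exists_eq_zero ⟨k, by rw [div_self (negEven_ne_zero k)]; simp⟩
  by_cases hs : s = 0
  · subst hs
    simp [invGammaHalf]
  set z := s / 2 with hz
  have hz0 : z ≠ 0 := div_ne_zero hs two_ne_zero
  have hzm : ∀ m : ℕ, z ≠ -m := by
    intro m hm
    rcases m with _ | m
    · simp at hm; exact hz0 hm
    · refine h0 ⟨m, ?_⟩
      rw [negEven]
      push_cast at hm
      linear_combination -2 * hm + 2 * hz
  have hlim := (multipliable_canonical hsum negEven_ne_zero s).hasProd.tendsto_prod_nat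
  have hpart : ∀ n : ℕ, n ≠ 0 →
      ∏ k ∈ Finset.range n, (1 - s / negEven k) * exp (s / negEven k) =
        exp (-(((harmonic n - Real.log n : ℝ) : ℂ) * z)) * (z * GammaSeq z n)⁻¹ := by
    intro n hn
    have e1 : ∀ k : ℕ, s / negEven k = -(z / (k + 1)) := by
      intro k
      have := Nat.cast_add_one_ne_zero (R := ℂ) k
      rw [negEven, hz]
      field_simp
    have h3 := prod_one_add_div_mul_GammaSeq z hzm n
    have hnc : (n : ℂ) ≠ 0 := Nat.cast_ne_zero.2 hn
    have h4 : z * GammaSeq z n ≠ 0 := by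
      intro h
      rw [h, mul_zero] at h3
      exact (cpow_ne_zero_iff_of_exponent_ne_zero hz0).2 hnc h3.symm
    simp_rw [e1, sub_neg_eq_add]
    rw [Finset.prod_mul_distrib, ← exp_sum, eq_mul_inv_iff_mul_eq₀ h4, mul_right_comm, h3,
      cpow_def_of_ne_zero hnc, ← exp_add, Finset.sum_neg_distrib]
    congr 1
    have e2 : ∑ k ∈ Finset.range n, z / ((k : ℂ) + 1) = (harmonic n : ℂ) * z := by
      rw [harmonic]
      push_cast
      rw [Finset.sum_mul]
      exact Finset.sum_congr rfl fun k _ => by rw [div_eq_inv_mul]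
    rw [e2]
    push_cast
    ring
  have hG : Gamma z ≠ 0 := Gamma_ne_zero hzm
  have h5 : Tendsto (fun n : ℕ => exp (-(((harmonic n - Real.log n : ℝ) : ℂ) * z)) *
      (z * GammaSeq z n)⁻¹) atTop
      (𝓝 (exp (-((Real.eulerMascheroniConstant : ℂ) * z)) * (z * Gamma z)⁻¹)) := by
    have h6 := (continuous_ofReal.tendsto _).comp Real.tendsto_harmonic_sub_log
    exact ((continuous_exp.tendsto _).comp (h6.mul_const z).neg).mul
      (((GammaSeq_tendsto_Gamma z).const_mul z).inv₀ (mul_ne_zero hz0 hG))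
  have h7 := tendsto_nhds_unique (hlim.congr' (by
    filter_upwards [eventually_ne_atTop 0] with n hn using hpart n hn)) h5
  rw [h7, invGammaHalf, add_comm, ← hz, Gamma_add_one z hz0]
  congr 3
  rw [hz]
  ring

/-! ### Multiplicities of the nontrivial zeros and the factorization of `R` -/

/-- For `|s| ≤ 4^k` the logarithm is at most `4 * 2^k`, and `4^k * 2^k = 8^k`: exponent `3/2`, which
suffices since it is below two. -/
theorem exists_norm_riemannR_le_exp_pow : ∃ C : ℝ, ∀ (k : ℕ) (s : ℂ), ‖s‖ ≤ 4 ^ k →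
    ‖riemannR s‖ ≤ Real.exp (C * 8 ^ k) := by
  obtain ⟨C, hC, h⟩ := exists_norm_riemannR_le
  refine ⟨2 + 2 * C, fun k s hs => (h s).trans (Real.exp_le_exp.2 ?_)⟩
  have h1 : max (-s.re) 0 ≤ 4 ^ k :=
    max_le (((neg_le_abs _).trans (abs_re_le_norm s)).trans hs) (by positivity)
  have hn := norm_nonneg s
  have h4 : (1 : ℝ) ≤ 4 ^ k := one_le_pow₀ (by norm_num)
  have h48 : (4 : ℝ) ^ k ≤ 8 ^ k := by gcongr; norm_num
  have h2 : Real.log (2 + ‖s‖) ≤ 4 * 2 ^ k := by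
    have e : Real.log (2 + ‖s‖) ≤ Real.log ((2 * 2 ^ k) ^ 2) := by
      apply Real.log_le_log (by positivity)
      rw [mul_pow, ← pow_mul, mul_comm k, pow_mul]
      norm_num
      linarith
    rw [Real.log_pow] at e
    have := Real.log_le_sub_one_of_pos (x := 2 * 2 ^ k) (by positivity)
    push_cast at e
    linarith
  have h0 : 0 ≤ Real.log (2 + ‖s‖) := Real.log_nonneg (by linarith)
  have h5 : max (-s.re) 0 / 2 * Real.log (2 + ‖s‖) ≤ 4 ^ k / 2 * (4 * 2 ^ k) := by gcongr
  have h6 : (8 : ℝ) ^ k = 4 ^ k * 2 ^ k := by rw [← mul_pow]; norm_num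
  have h7 : C * (1 + ‖s‖) ≤ C * (2 * 8 ^ k) := by gcongr; linarith
  have h8 : (4 : ℝ) ^ k / 2 * (4 * 2 ^ k) = 2 * 8 ^ k := by rw [h6]; ring
  linarith

theorem analyticOrderAt_riemannR_ne_top (z : ℂ) : analyticOrderAt riemannR z ≠ ⊤ := by
  intro h
  rw [analyticOrderAt_eq_top] at h
  have hA : AnalyticOnNhd ℂ riemannR Set.univ := fun z _ => differentiable_riemannR.analyticAt z
  have h0 := hA.eqOn_zero_of_preconnected_of_eventuallyEq_zero isPreconnected_univ
    (Set.mem_univ z) h (Set.mem_univ 0)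
  rw [riemannR_zero] at h0
  norm_num at h0

theorem countable_zeros_riemannR : {z | riemannR z = 0}.Countable := by
  have : DiscreteTopology {z | riemannR z = 0} := by
    rw [discreteTopology_subtype_iff]
    intro z _
    rw [← disjoint_iff, disjoint_principal_right]
    rcases (differentiable_riemannR.analyticAt z).eventually_eq_zero_or_eventually_ne_zero with h | h
    · exact absurd (analyticOrderAt_eq_top.2 h) (analyticOrderAt_riemannR_ne_top z)
    · exact h
  exact countable_of_Lindelof_of_discrete (X := {z | riemannR z = 0})

/-- The unit relating `R`, its completion and `1 / Γ(1 + s / 2)`. -/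
noncomputable def piHalfPow (s : ℂ) : ℂ := (Real.pi : ℂ) ^ (s / 2) / 2

theorem piHalfPow_ne_zero (s : ℂ) : piHalfPow s ≠ 0 := by
  have : (Real.pi : ℂ) ≠ 0 := by exact_mod_cast Real.pi_ne_zero
  exact div_ne_zero (by rw [Ne, cpow_eq_zero_iff]; exact fun h => this h.1) two_ne_zero

theorem differentiable_piHalfPow : Differentiable ℂ piHalfPow := by
  intro s
  have : (Real.pi : ℂ) ≠ 0 := by exact_mod_cast Real.pi_ne_zero
  unfold piHalfPow
  exact (((differentiable_id.div_const 2) s).const_cpow (Or.inl this)).div_const 2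

/-- From `s Γ(s/2) = 2 Γ(1+s/2)`. At a trivial zero both sides vanish whatever the junk value of
`completedR`; at `0` the formula fails, since there `completedR` is `0` and `R` is not. -/
theorem riemannR_eq_completedR_mul {s : ℂ} (hs : s ≠ 0) :
    riemannR s = completedR s * (invGammaHalf s * piHalfPow s) := by
  have hπ : (Real.pi : ℂ) ≠ 0 := by exact_mod_cast Real.pi_ne_zero
  by_cases h : invGammaHalf s = 0
  · obtain ⟨k, rfl⟩ := (invGammaHalf_eq_zero_iff s).1 h
    rw [h, riemannR_negEven]
    ring
  · rw [invGammaHalf, inv_eq_zero, add_comm, Gamma_add_one _ (div_ne_zero hs two_ne_zero)] at h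
    have h1 : (Real.pi : ℂ) ^ (-(s / 2)) * (Real.pi : ℂ) ^ (s / 2) = 1 := by
      rw [← cpow_add _ _ hπ, neg_add_cancel, cpow_zero]
    rw [completedR, piHalfPow, invGammaHalf, add_comm, Gamma_add_one _ (div_ne_zero hs two_ne_zero)]
    have h2 := right_ne_zero_of_mul h
    field_simp
    linear_combination -riemannR s * h1

theorem completedR_eq_mul {s : ℂ} (hs : s ≠ 0) :
    completedR s = riemannR s * (invGammaHalf s * piHalfPow s)⁻¹ := by
  by_cases h : invGammaHalf s = 0
  · rw [h, zero_mul, inv_zero, mul_zero]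
    rw [invGammaHalf, inv_eq_zero, add_comm, Gamma_add_one _ (div_ne_zero hs two_ne_zero)] at h
    have h2 := (mul_eq_zero.1 h).resolve_left (div_ne_zero hs two_ne_zero)
    rw [completedR, h2, mul_zero, zero_mul]
  · rw [riemannR_eq_completedR_mul hs,
      mul_inv_cancel_right₀ (mul_ne_zero h (piHalfPow_ne_zero s))]

/-- Each trivial zero uses up one unit of the order of `R`; any excess order there counts as a
nontrivial zero. Orders depend only on punctured neighbourhoods, so the exception at `0` is
harmless. -/
theorem meromorphicOrderAt_completedR_add (z : ℂ) :
    meromorphicOrderAt completedR z + (({k | negEven k = z}.ncard : ℤ) : WithTop ℤ) =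
      (analyticOrderAt riemannR z).map (↑) := by
  have hG : AnalyticAt ℂ invGammaHalf z := differentiable_invGammaHalf.analyticAt z
  have hP : AnalyticAt ℂ piHalfPow z := differentiable_piHalfPow.analyticAt z
  have hR : AnalyticAt ℂ riemannR z := differentiable_riemannR.analyticAt z
  have hne : ∀ᶠ s in 𝓝[≠] z, s ≠ 0 := by
    by_cases h : z = 0
    · subst h; exact self_mem_nhdsWithin
    · exact (eventually_ne_nhds h).filter_mono nhdsWithin_le_nhds
  have hGP : MeromorphicAt (invGammaHalf * piHalfPow) z := (hG.mul hP).meromorphicAt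
  have hC : MeromorphicAt completedR z := by
    refine (hR.meromorphicAt.mul hGP.inv).congr ?_
    filter_upwards [hne] with s hs
    simp [completedR_eq_mul hs]
  have h1 : meromorphicOrderAt riemannR z =
      meromorphicOrderAt (completedR * (invGammaHalf * piHalfPow)) z := by
    apply meromorphicOrderAt_congr
    filter_upwards [hne] with s hs
    simpa using riemannR_eq_completedR_mul hs
  rw [← hR.meromorphicOrderAt_eq, h1, meromorphicOrderAt_mul hC hGP,
    (hG.mul hP).meromorphicOrderAt_eq, analyticOrderAt_mul hG hP,
    (hP.analyticOrderAt_eq_zero).2 (piHalfPow_ne_zero z), add_zero,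
    listsZeros_invGammaHalf.card_fiber]
  rfl

theorem IsZeroEnumeration.listsZeros {ρ : ℤ → ℂ} (h : IsZeroEnumeration ρ) :
    ListsZeros riemannR (Sum.elim ρ negEven) := by
  have hset : ∀ z, {i | Sum.elim ρ negEven i = z} =
      Sum.inl '' {n | ρ n = z} ∪ Sum.inr '' {k | negEven k = z} := by
    intro z
    ext i
    rcases i with i | i <;> simp
  constructor
  · intro z
    rw [hset]
    exact ((h.finite_fiber z).image _).union ((listsZeros_invGammaHalf.finite_fiber z).image _)
  · intro z
    have h1 := meromorphicOrderAt_completedR_add z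
    rw [← h.card_fiber] at h1
    rw [hset, Set.ncard_union_eq _ ((h.finite_fiber z).image _)
      ((listsZeros_invGammaHalf.finite_fiber z).image _), Set.ncard_image_of_injective _
      Sum.inl_injective, Set.ncard_image_of_injective _ Sum.inr_injective]
    · obtain ⟨n, hn⟩ := ENat.ne_top_iff_exists.1 (analyticOrderAt_riemannR_ne_top z)
      rw [← hn] at h1 ⊢
      have h2 : ((({m | ρ m = z}.ncard : ℤ) + ({k | negEven k = z}.ncard : ℤ) : ℤ) : WithTop ℤ) =
          ((n : ℤ) : WithTop ℤ) := by
        rw [WithTop.coe_add]; exact h1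
      have h3 := WithTop.coe_injective h2
      norm_cast
      exact_mod_cast h3.symm
    · rw [Set.disjoint_left]
      rintro _ ⟨a, -, rfl⟩ ⟨b, -, hb⟩
      exact Sum.inr_ne_inl hb

theorem IsZeroEnumeration.ne_zero {ρ : ℤ → ℂ} (h : IsZeroEnumeration ρ) (n : ℤ) : ρ n ≠ 0 :=
  h.listsZeros.ne_zero (by rw [riemannR_zero]; norm_num) (Sum.inl n)

theorem IsZeroEnumeration.summable {ρ : ℤ → ℂ} (h : IsZeroEnumeration ρ) :
    Summable fun i => (‖Sum.elim ρ negEven i‖ ^ 2)⁻¹ := by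
  obtain ⟨C, hC⟩ := exists_norm_riemannR_le_exp_pow
  exact h.listsZeros.summable differentiable_riemannR (by rw [riemannR_zero]; norm_num) hC

/-- The Hadamard coefficient is `R'(0) / (-1/2)`, and the trivial half of the product contributes
`e^(-γs/2)` and `1/Γ(1+s/2)`. -/
theorem IsZeroEnumeration.riemannR_eq {ρ : ℤ → ℂ} (h : IsZeroEnumeration ρ) (s : ℂ) :
    riemannR s = -(exp ((-2 * deriv riemannR 0 - Real.eulerMascheroniConstant / 2) * s) / 2 *
      invGammaHalf s) * ∏' n : ℤ, (1 - s / ρ n) * exp (s / ρ n) := by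
  obtain ⟨C, hC⟩ := exists_norm_riemannR_le_exp_pow
  have h0 : riemannR 0 ≠ 0 := by rw [riemannR_zero]; norm_num
  have h1 := h.listsZeros.eq_canonical_product differentiable_riemannR h0 hC s
  have hm := multipliable_canonical h.summable (h.listsZeros.ne_zero h0) s
  have hl : Multipliable fun n : ℤ => (1 - s / ρ n) * exp (s / ρ n) :=
    multipliable_canonical (h.summable.comp_injective Sum.inl_injective) h.ne_zero s
  have hr : Multipliable fun k => (1 - s / negEven k) * exp (s / negEven k) :=
    multipliable_canonical (h.summable.comp_injective Sum.inr_injective) negEven_ne_zero s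
  rw [Multipliable.tprod_sum (f := fun i => (1 - s / Sum.elim ρ negEven i) *
    exp (s / Sum.elim ρ negEven i)) hl hr] at h1
  simp only [Sum.elim_inl, Sum.elim_inr] at h1
  rw [canonical_negEven, riemannR_zero] at h1
  rw [h1, show (-2 * deriv riemannR 0 - (Real.eulerMascheroniConstant : ℂ) / 2) * s =
    deriv riemannR 0 / (-1 / 2) * s + -(Real.eulerMascheroniConstant / 2 * s) by ring, exp_add]
  ring

/-! ### Existence of an enumeration by the integers -/

/-- The multiplicity of a nontrivial zero. -/
noncomputable def nontrivialOrder (z : ℂ) : ℕ :=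
  (analyticOrderAt riemannR z).toNat - {k | negEven k = z}.ncard

/-- The natural subtraction is not truncated, because `R` does vanish at every trivial zero. -/
theorem nontrivialOrder_add (z : ℂ) :
    nontrivialOrder z + {k | negEven k = z}.ncard = (analyticOrderAt riemannR z).toNat := by
  apply Nat.sub_add_cancel
  by_cases hz : ∃ k, negEven k = z
  · obtain ⟨k, rfl⟩ := hz
    have h1 : {i | negEven i = negEven k} = {k} := by
      ext i; simpa using negEven_injective.eq_iff
    rw [h1, Set.ncard_singleton, Nat.one_le_iff_ne_zero]
    intro h
    rw [ENat.toNat_eq_zero] at h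
    rcases h with h | h
    · rw [(differentiable_riemannR.analyticAt _).analyticOrderAt_eq_zero] at h
      exact h (riemannR_negEven k)
    · exact analyticOrderAt_riemannR_ne_top _ h
  · have : {i | negEven i = z} = ∅ := by
      ext i; simpa using fun h => hz ⟨i, h⟩
    rw [this, Set.ncard_empty]
    exact Nat.zero_le _

theorem meromorphicOrderAt_completedR (z : ℂ) :
    meromorphicOrderAt completedR z = ((nontrivialOrder z : ℤ) : WithTop ℤ) := by
  have h1 := meromorphicOrderAt_completedR_add z
  rw [← ENat.natCast_toNat (analyticOrderAt_riemannR_ne_top z), ← nontrivialOrder_add] at h1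
  have h2 : (((nontrivialOrder z : ℤ) : WithTop ℤ)) + (({k | negEven k = z}.ncard : ℤ) : WithTop ℤ)
      = ENat.map (↑) ((nontrivialOrder z + {k | negEven k = z}.ncard : ℕ) : ℕ∞) := by
    rw [← WithTop.coe_add, ← Nat.cast_add]
    rfl
  rw [← h2] at h1
  exact WithTop.add_right_cancel WithTop.coe_ne_top h1

theorem riemannR_eq_zero_of_nontrivialOrder {z : ℂ} (h : nontrivialOrder z ≠ 0) :
    riemannR z = 0 := by
  apply apply_eq_zero_of_analyticOrderAt_ne_zero
  intro h0
  have := nontrivialOrder_add z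
  rw [h0, ENat.toNat_zero] at this
  omega

theorem nontrivialOrder_ne_zero {z : ℂ} (hz : z.im ≠ 0) (h : riemannR z = 0) :
    nontrivialOrder z ≠ 0 := by
  intro h0
  have h1 := nontrivialOrder_add z
  have h2 : {i | negEven i = z} = ∅ := by
    ext i
    simp only [Set.mem_ofPred_eq, Set.mem_empty_iff_false, iff_false]
    rintro rfl
    simp [negEven] at hz
  rw [h0, h2, Set.ncard_empty, add_zero, eq_comm, ENat.toNat_eq_zero] at h1
  rcases h1 with h1 | h1
  · rw [(differentiable_riemannR.analyticAt _).analyticOrderAt_eq_zero] at h1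
    exact h1 h
  · exact analyticOrderAt_riemannR_ne_top _ h1

/-- The nontrivial zeros, repeated according to multiplicity. -/
abbrev NontrivialZero : Type := Σ z : ℂ, Fin (nontrivialOrder z)

theorem countable_nontrivialZero : Countable NontrivialZero := by
  have hc : Countable {z | riemannR z = 0} := countable_zeros_riemannR.to_subtype
  have hinj : Function.Injective (fun p : NontrivialZero =>
      ((⟨p.1, riemannR_eq_zero_of_nontrivialOrder (by have := p.2.2; omega)⟩, p.2) :
        {z | riemannR z = 0} × ℕ)) := by
    rintro ⟨z, i⟩ ⟨w, j⟩ h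
    simp only [Prod.mk.injEq, Subtype.mk.injEq] at h
    obtain ⟨rfl, h⟩ := h
    rw [Fin.ext h]
  exact hinj.countable

/-- A finite set has bounded imaginary parts, while zeros exist arbitrarily high, and those off the
real axis are nontrivial. -/
theorem infinite_nontrivialZero_pos : Infinite {p : NontrivialZero // 0 < p.1.im} := by
  rw [← not_finite_iff_infinite]
  intro hfin
  obtain ⟨M, hM⟩ := (Set.finite_range fun p : {p : NontrivialZero // 0 < p.1.im} =>
    p.1.1.im).bddAbove
  obtain ⟨s, hs, h0⟩ := exists_riemannR_zero_im_gt (max M 0)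
  have hpos : 0 < s.im := (le_max_right _ _).trans_lt hs
  have := hM ⟨⟨⟨s, ⟨0, Nat.pos_of_ne_zero (nontrivialOrder_ne_zero hpos.ne' h0)⟩⟩, hpos⟩, rfl⟩
  exact absurd ((le_max_left M 0).trans_lt hs) (not_lt.2 this)

theorem infinite_nontrivialZero_nonpos : Infinite {p : NontrivialZero // ¬ 0 < p.1.im} := by
  rw [← not_finite_iff_infinite]
  intro hfin
  obtain ⟨M, hM⟩ := (Set.finite_range fun p : {p : NontrivialZero // ¬ 0 < p.1.im} =>
    p.1.1.im).bddBelow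
  obtain ⟨s, hs, h0⟩ := exists_riemannR_zero_im_lt (max (-M) 0)
  have hneg : s.im < 0 := hs.trans_le (neg_nonpos.2 (le_max_right _ _))
  have := hM ⟨⟨⟨s, ⟨0, Nat.pos_of_ne_zero (nontrivialOrder_ne_zero hneg.ne h0)⟩⟩,
    not_lt.2 hneg.le⟩, rfl⟩
  dsimp only at this
  linarith [le_max_left (-M) 0]

/-- The zeros with `Im > 0` and those with `Im ≤ 0` are both countably infinite, so each class is in
bijection with its half of `ℤ`. -/
theorem exists_isZeroEnumeration : ∃ ρ : ℤ → ℂ, IsZeroEnumeration ρ := by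
  have hc := countable_nontrivialZero
  have hi1 := infinite_nontrivialZero_pos
  have hi2 := infinite_nontrivialZero_nonpos
  have hz1 : Infinite {n : ℤ // 1 ≤ n} := (Set.Ici_infinite (1 : ℤ)).to_subtype
  have hz2 : Infinite {n : ℤ // ¬ 1 ≤ n} := by
    have := (Set.Iio_infinite (1 : ℤ)).to_subtype
    simpa only [not_le] using! this
  obtain ⟨e1⟩ := nonempty_equiv_of_countable (α := {n : ℤ // 1 ≤ n})
    (β := {p : NontrivialZero // 0 < p.1.im})
  obtain ⟨e2⟩ := nonempty_equiv_of_countable (α := {n : ℤ // ¬ 1 ≤ n})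
    (β := {p : NontrivialZero // ¬ 0 < p.1.im})
  let E : ℤ ≃ NontrivialZero := (Equiv.sumCompl fun n : ℤ => 1 ≤ n).symm.trans
    ((Equiv.sumCongr e1 e2).trans (Equiv.sumCompl fun p : NontrivialZero => 0 < p.1.im))
  have hE : ∀ z, {n : ℤ | (E n).1 = z} = Set.range fun i : Fin (nontrivialOrder z) =>
      E.symm ⟨z, i⟩ := by
    intro z
    ext n
    simp only [Set.mem_ofPred_eq, Set.mem_range, Equiv.symm_apply_eq]
    constructor
    · rintro rfl
      exact ⟨(E n).2, rfl⟩
    · rintro ⟨i, hi⟩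
      rw [← hi]
  refine ⟨fun n => (E n).1, ?_, ?_, ?_, ?_⟩
  · intro z
    rw [hE]
    exact Set.finite_range _
  · intro z
    rw [hE, meromorphicOrderAt_completedR, ← Set.image_univ, Set.ncard_image_of_injective,
      Set.ncard_univ, Nat.card_eq_fintype_card, Fintype.card_fin]
    intro i j hij
    have := E.symm.injective hij
    simpa using this
  · intro n hn
    have : E n = (e1 ⟨n, hn⟩).1 := by
      simp [E, Equiv.sumCompl_symm_apply_of_pos (p := fun n : ℤ => 1 ≤ n) hn]
    rw [this]
    exact (e1 ⟨n, hn⟩).2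
  · intro n hn
    have hn' : ¬ 1 ≤ n := by omega
    have : E n = (e2 ⟨n, hn'⟩).1 := by
      simp [E, Equiv.sumCompl_symm_apply_of_neg (p := fun n : ℤ => 1 ≤ n) hn']
    rw [this]
    exact not_lt.1 (e2 ⟨n, hn'⟩).2

/-! ### Logarithmic derivative and conclusion -/

theorem logDeriv_invGammaHalf {s : ℂ} (h : invGammaHalf s ≠ 0) :
    logDeriv invGammaHalf s =
      -(1 / 2 * (deriv Gamma (1 + s / 2) / Gamma (1 + s / 2))) := by
  have hG : Gamma (1 + s / 2) ≠ 0 := fun h0 => h (by rw [invGammaHalf, h0, inv_zero])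
  have hd : DifferentiableAt ℂ Gamma (1 + s / 2) :=
    differentiableAt_Gamma _ fun m hm => hG (by rw [hm, Gamma_neg_nat_eq_zero])
  have h1 : HasDerivAt (fun s : ℂ => 1 + s / 2) (1 / 2) s :=
    ((hasDerivAt_id _).div_const 2).const_add 1
  have h2 := (HasDerivAt.comp s hd.hasDerivAt h1).inv hG
  have h3 : deriv invGammaHalf s = _ := h2.deriv
  rw [logDeriv_apply, h3, invGammaHalf, Function.comp_apply]
  field_simp

theorem IsZeroEnumeration.logDeriv_riemannR {ρ : ℤ → ℂ} (h : IsZeroEnumeration ρ) {s : ℂ}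
    (hs : riemannR s ≠ 0) :
    (Summable fun n : ℤ => 1 / (s - ρ n) + 1 / ρ n) ∧
      deriv riemannR s / riemannR s =
        -2 * deriv riemannR 0 - Real.eulerMascheroniConstant / 2 -
          1 / 2 * (deriv Gamma (1 + s / 2) / Gamma (1 + s / 2)) +
          ∑' n : ℤ, (1 / (s - ρ n) + 1 / ρ n) := by
  have hsum : Summable fun n => (‖ρ n‖ ^ 2)⁻¹ := by
    have := h.summable.comp_injective (i := Sum.inl) Sum.inl_injective
    exact this
  have hne : ∀ n, s ≠ ρ n := by
    intro n hn
    exact hs (hn ▸ h.listsZeros.apply_eq_zero (Sum.inl n))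
  refine ⟨summable_partial_fractions hsum h.ne_zero hne, ?_⟩
  have hfun := funext h.riemannR_eq
  have hs' := hs
  rw [h.riemannR_eq] at hs'
  have hp := right_ne_zero_of_mul hs'
  have hq := left_ne_zero_of_mul hs'
  -- As `R s ≠ 0`, no factor of the product formula vanishes at `s`; in particular `1 + s/2` is not
  -- a pole of `Γ`.
  have hi := right_ne_zero_of_mul (neg_ne_zero.1 hq)
  set a := -2 * deriv riemannR 0 - (Real.eulerMascheroniConstant : ℂ) / 2 with ha
  have hexp : HasDerivAt (fun s => exp (a * s) / 2) (exp (a * s) * a / 2) s := by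
    have := (((hasDerivAt_id s).const_mul a).cexp).div_const 2
    simpa using this
  have hG := (differentiable_invGammaHalf s).hasDerivAt
  have hP := (differentiable_canonical hsum h.ne_zero s).hasDerivAt
  have hlogP := logDeriv_canonical hsum h.ne_zero hne hp
  have hlogG := logDeriv_invGammaHalf hi
  rw [logDeriv_apply] at hlogP hlogG
  have hder := ((hexp.mul hG).neg.mul hP).deriv
  rw [← hlogP, sub_eq_add_neg, ← hlogG]
  have hR : deriv riemannR s = _ := (congrArg (fun f => deriv f s) hfun).trans hder
  rw [hR, h.riemannR_eq s]
  have he := exp_ne_zero (a * s)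
  simp only [← ha, Pi.mul_apply, Pi.neg_apply]
  field_simp
  ring

theorem mainTheorem7 :
    Differentiable ℂ riemannR ∧
    (∃ ρ : ℤ → ℂ, IsZeroEnumeration ρ) ∧
    ∃ a : ℂ,
      (∀ ρ : ℤ → ℂ, IsZeroEnumeration ρ →
        -- the product expansion of `R`, which is where the constant `a` comes from
        (∀ s : ℂ,
          Multipliable (fun n : ℤ => (1 - s / ρ n) * Complex.exp (s / ρ n)) ∧
          riemannR s = -(Complex.exp (a * s) / (2 * Complex.Gamma (1 + s / 2))) *
            ∏' n : ℤ, (1 - s / ρ n) * Complex.exp (s / ρ n)) ∧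
        -- the logarithmic derivative of `R`
        (∀ s : ℂ, riemannR s ≠ 0 →
          Summable (fun n : ℤ => 1 / (s - ρ n) + 1 / ρ n) ∧
          deriv riemannR s / riemannR s =
            a - 1 / 2 * (deriv Complex.Gamma (1 + s / 2) / Complex.Gamma (1 + s / 2)) +
              ∑' n : ℤ, (1 / (s - ρ n) + 1 / ρ n))) ∧
      a = -2 * deriv riemannR 0 - (Real.eulerMascheroniConstant : ℂ) / 2 := by
  refine ⟨differentiable_riemannR, exists_isZeroEnumeration,
    -2 * deriv riemannR 0 - (Real.eulerMascheroniConstant : ℂ) / 2, fun ρ hρ => ⟨fun s => ?_,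
      fun s hs => hρ.logDeriv_riemannR hs⟩, rfl⟩
  refine ⟨multipliable_canonical (hρ.summable.comp_injective Sum.inl_injective) hρ.ne_zero s, ?_⟩
  rw [hρ.riemannR_eq s, invGammaHalf]
  congr 2
  rw [div_mul_eq_div_div, ← div_eq_mul_inv]
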